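/- **Setting.** Let $d\ge 1$, $T>0$, and let $\mathcal D\subset\mathbb R^d$ be a bounded domain with smooth boundary, $x_0\in\mathcal D$. Let $\vartheta\in C^1(\bar{\mathcal D})$ be bounded away from zero, $\Delta_\vartheta=\nabla\cdot\vartheta\nabla$ with domain $W^{2,2}(\mathcal D)\cap W^{1,2}_0(\mathcal D)$, $(S(t))_{t\ge0}$ the $C_0$-semigroup on $L^2(\mathcal D)$ generated by it, $\xi\in L^2(\mathcal D)$ and $\sigma>0$. Let $X$ be the solution of $\partial_tX=\Delta_\vartheta X+\sigma\dot W$, $X_0=\xi$, on $[0,T)\times\mathcal D$ with Dirichlet boundary conditions, i.e. the Gaussian process $\varphi\mapsto\langle\!\langle X,\varphi\rangle\!\rangle$, indexed by continuous functions $\varphi$ with compact support in $[0,T)\times\mathcal D$, with mean $\int_0^\infty\langle S(t)\xi,\varphi(t,\cdot)\rangle\,dt$ and $$\mathrm{Cov}(\langle\!\langle X,\varphi\rangle\!\rangle,\langle\!\langle X,\psi\rangle\!\rangle)=\frac{\sigma^2}{2}\int_0^\infty\!\!\int_0^\infty\!\!\int_{|t-s|}^{t+s}\langle\varphi(t,\cdot),S(r)\psi(s,\cdot)\rangle\,dr\,ds\,dt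 .$$ Let $\dot V$ be an isonormal Gaussian process on $L^2([0,T)\times\mathcal D)$, independent of $X$, and for $\varepsilon>0$ let $Y=X+\varepsilon\dot V$ be the observation. **Estimator.** Let $K\in C^\infty(\mathbb R\times\mathbb R^d)$ have compact support in $(0,1)\times(-1,1)^d$, put $$K^{\varepsilon}_{k,x}(t,y)=\varepsilon^{-1/2-d/4}K\big(\varepsilon^{-1}t-k,\ \varepsilon^{-1/2}(y-x_0)-x\big),$$ $X'_{\varepsilon,k,x}=-\langle\!\langle Y,\partial_tK^\varepsilon_{k,x}\rangle\!\rangle$, $X^\Delta_{\varepsilon,k,x}=\langle\!\langle Y,\Delta K^\varepsilon_{k,x}\rangle\!\rangle$ and $N_\varepsilon=\lfloor T/\varepsilon\rfloor-1$. For all small $\varepsilon$ let $\mathcal X_\varepsilon\subset\mathbb R^d$ be a finite set such that the supports of $K^\varepsilon_{0,x}$, $x\in\mathcal X_\varepsilon$, are contained in $[0,T)\times\mathcal D$ and pairwise disjoint. Let $h=h_\varepsilon>0$ be a bandwidth and $w^h_\varepsilon(x)\in\mathbb R$, $x\in\mathcal X_\varepsilon$, be deterministic weights. Sums below are over $1\le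 k\le N_\varepsilon$ and $x\in\mathcal X_\varepsilon$. Set $$I_\varepsilon=\sum_{k,x}w^h_\varepsilon(x)X^\Delta_{\varepsilon,k-1,x}X^\Delta_{\varepsilon,k,x},\qquad \hat\vartheta_\varepsilon(x_0)=\frac1{I_\varepsilon}\sum_{k,x}w^h_\varepsilon(x)X^\Delta_{\varepsilon,k-1,x}X'_{\varepsilon,k,x},$$ $$B_\varepsilon=\sum_{k,x}w^h_\varepsilon(x)X^\Delta_{\varepsilon,k-1,x}\langle\!\langle X,[\Delta_\vartheta-\vartheta(x_0)\Delta]K^\varepsilon_{k,x}\rangle\!\rangle,\qquad \langle M_\varepsilon\rangle=\sigma_K^2\sum_{k,x}w^h_\varepsilon(x)^2(X^\Delta_{\varepsilon,k-1,x})^2,$$ with $\sigma_K^2=\sigma^2\|K\|_{L^2(\mathbb R\times\mathbb R^d)}^2+\|\partial_tK+\vartheta(x_0)\Delta K\|_{L^2(\mathbb R\times\mathbb R^d)}^2$. All asymptotics are for $\varepsilon\downarrow0$; $a_\varepsilon\sim b_\varepsilon$ means $a_\varepsilon=\mathcal O(b_\varepsilon)$ and $b_\varepsilon=\mathcal O(a_\varepsilon)$.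 **Theorem.** Assume that for some $\gamma\ge1$ the moment conditions $(A_\gamma)$ hold along $h=h_\varepsilon$: (a) $\mathbb E I_\varepsilon\sim N_\varepsilon$ and $\mathrm{Var}(I_\varepsilon)=o(N_\varepsilon^2)$; (b) $\mathbb E\langle M_\varepsilon\rangle=\mathcal O(N_\varepsilon|\mathcal X_\varepsilon|^{-1}h^{-d})$; (c) $\mathbb E B_\varepsilon^2=\mathcal O(h^{2\gamma}N_\varepsilon^2)$. Then $$\hat\vartheta_\varepsilon(x_0)-\vartheta(x_0)=\mathcal O_{\mathbb P}\Big(\frac1{\sqrt{N_\varepsilon|\mathcal X_\varepsilon|h^d}}+h^\gamma\Big).$$ Moreover $N_\varepsilon\sim\varepsilon^{-1}$, and if $|\mathcal X_\varepsilon|\sim\varepsilon^{-d/2}$, then $$\hat\vartheta_\varepsilon(x_0)-\vartheta(x_0)=\mathcal O_{\mathbb P}\big(\varepsilon^{1/2+d/4}h^{-d/2}\big)+\mathcal O_{\mathbb P}(h^\gamma).$$ If $h\sim\varepsilon^{\frac{2+d}{4\gamma+2d}}$, then $h$ is of optimal order for this expression, that is, $\varepsilon^{1/2+d/4}h^{-d/2}+h^\gamma=\mathcal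 O\big(\varepsilon^{1/2+d/4}(h')^{-d/2}+(h')^\gamma\big)$ for every choice of $h'=h'_\varepsilon>0$; if in addition $|\mathcal X_\varepsilon|\sim\varepsilon^{-d/2}$, then $$\hat\vartheta_\varepsilon(x_0)=\vartheta(x_0)+\mathcal O_{\mathbb P}\Big(\varepsilon^{\frac{(2+d)\gamma}{4\gamma+2d}}\Big).$$ -/

import Mathlib

open MeasureTheory ProbabilityTheory Filter Topology Set Asymptotics


noncomputable section

namespace NoisyHeat

/-- Euclidean space `ℝ^d`. -/
abbrev E (d : ℕ) : Type := EuclideanSpace ℝ (Fin d)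

/-! ### Function spaces on a domain -/

/-- The Hilbert space `L²(D)`. -/
abbrev L2 {d : ℕ} (D : Set (E d)) : Type := Lp ℝ 2 (volume.restrict D)

/-- The Hilbert space `L²([0,T) × D)`. -/
abbrev L2ST {d : ℕ} (T : ℝ) (D : Set (E d)) : Type :=
  Lp ℝ 2 ((volume : Measure (ℝ × E d)).restrict (Ico 0 T ×ˢ D))

open Classical in
/-- The class in `L²(μ)` of a square integrable function (`0` for other functions). -/
def toL2 {α : Type*} [MeasurableSpace α] (μ : Measure α) (f : α → ℝ) : Lp ℝ 2 μ :=
  if hf : MemLp f 2 μ then hf.toLp f else 0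

/-- `φ ∈ C_c^∞(D)`. -/
def IsSmoothTest {d : ℕ} (D : Set (E d)) (φ : E d → ℝ) : Prop :=
  ContDiff ℝ ((⊤ : ℕ∞) : WithTop ℕ∞) φ ∧ HasCompactSupport φ ∧ tsupport φ ⊆ D

/-- The partial derivative `∂_i f (x)`. -/
def partialDeriv {d : ℕ} (i : Fin d) (f : E d → ℝ) (x : E d) : ℝ :=
  fderiv ℝ f x (EuclideanSpace.single i 1)

/-- `v ∈ L²(D)` is the weak partial derivative `∂_i u` of `u ∈ L²(D)`. -/
def HasWeakPartial {d : ℕ} (D : Set (E d)) (i : Fin d) (u v : L2 D) : Prop :=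
  ∀ φ : E d → ℝ, IsSmoothTest D φ →
    ∫ x in D, u x * partialDeriv i φ x = - ∫ x in D, v x * φ x

/-- `u ∈ W^{2,2}(D)`. -/
def MemW22 {d : ℕ} (D : Set (E d)) (u : L2 D) : Prop :=
  ∃ g : Fin d → L2 D, (∀ i, HasWeakPartial D i u (g i)) ∧
    ∀ i j, ∃ v : L2 D, HasWeakPartial D j (g i) v

/-- `u ∈ W^{1,2}_0(D)`: `u` is a limit of functions in `C_c^∞(D)` with respect to the norm of
`W^{1,2}(D)`. -/
def MemW120 {d : ℕ} (D : Set (E d)) (u : L2 D) : Prop :=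
  ∃ g : Fin d → L2 D, (∀ i, HasWeakPartial D i u (g i)) ∧
    ∃ φ : ℕ → E d → ℝ, (∀ n, IsSmoothTest D (φ n)) ∧
      Tendsto (fun n => toL2 (volume.restrict D) (φ n)) atTop (𝓝 u) ∧
      ∀ i, Tendsto (fun n => toL2 (volume.restrict D) (partialDeriv i (φ n))) atTop (𝓝 (g i))

/-- `f = ∇ · (θ ∇u)` in `L²(D)`, with weak gradient and weak divergence. -/
def IsDivGrad {d : ℕ} (D : Set (E d)) (θ : E d → ℝ) (u f : L2 D) : Prop :=
  ∃ g : Fin d → L2 D, (∀ i, HasWeakPartial D i u (g i)) ∧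
    ∀ φ : E d → ℝ, IsSmoothTest D φ →
      ∫ x in D, θ x * ∑ i, g i x * partialDeriv i φ x = - ∫ x in D, f x * φ x

/-- `S` is the `C₀`-semigroup on `L²(D)` generated by
`Δ_θ = ∇ · θ ∇ : W^{2,2}(D) ∩ W^{1,2}_0(D) → L²(D)`. The last field says that the infinitesimal
generator of `S` and `Δ_θ` have the same graph. -/
structure IsHeatSemigroup {d : ℕ} (D : Set (E d)) (θ : E d → ℝ) (S : ℝ → L2 D →L[ℝ] L2 D) :
    Prop where
  map_zero : S 0 = ContinuousLinearMap.id ℝ (L2 D)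
  map_add : ∀ s t : ℝ, 0 ≤ s → 0 ≤ t → S (s + t) = (S s).comp (S t)
  continuous_zero : ∀ f : L2 D, Tendsto (fun t => S t f) (𝓝[>] 0) (𝓝 f)
  generator : ∀ u f : L2 D,
    Tendsto (fun t : ℝ => t⁻¹ • (S t u - u)) (𝓝[>] 0) (𝓝 f) ↔
      MemW22 D u ∧ MemW120 D u ∧ IsDivGrad D θ u f

/-- The boundary of `D` is smooth: locally `D` is the sublevel set `{ρ < 0}` of a smooth function
without critical points. -/
def HasSmoothBoundary {d : ℕ} (D : Set (E d)) : Prop :=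
  ∀ z ∈ frontier D, ∃ U : Set (E d), IsOpen U ∧ z ∈ U ∧ ∃ ρ : E d → ℝ,
    ContDiffOn ℝ ((⊤ : ℕ∞) : WithTop ℕ∞) ρ U ∧ (∀ x ∈ U, fderiv ℝ ρ x ≠ 0) ∧ D ∩ U = {x ∈ U | ρ x < 0}

/-- `θ ∈ C¹(closure D)`: `θ` is `C¹` in `D`, and `θ` and `∇θ` extend continuously to the closure. -/
def IsC1Closure {d : ℕ} (D : Set (E d)) (θ : E d → ℝ) : Prop :=
  ContDiffOn ℝ 1 θ D ∧ ContinuousOn θ (closure D) ∧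
    ∃ g : E d → (E d →L[ℝ] ℝ), ContinuousOn g (closure D) ∧ ∀ x ∈ D, g x = fderiv ℝ θ x

/-! ### The model -/

/-- The deterministic ingredients of the model, with the standing assumptions on them. -/
structure HeatModel (d : ℕ) where
  /-- the time horizon -/
  T : ℝ
  T_pos : 0 < T
  /-- the domain -/
  D : Set (E d)
  isOpen_D : IsOpen D
  isConnected_D : IsConnected D
  isBounded_D : Bornology.IsBounded D
  smooth_D : HasSmoothBoundary D
  /-- the diffusivity -/
  θ : E d → ℝ
  θ_C1 : IsC1Closure D θ
  θ_lower : ∃ c : ℝ, 0 < c ∧ ∀ x ∈ closure D, c ≤ θ x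
  /-- the initial condition -/
  ξ : L2 D
  /-- the intensity of the dynamic noise -/
  σ : ℝ
  σ_pos : 0 < σ
  /-- the point at which the diffusivity is estimated -/
  x₀ : E d
  x₀_mem : x₀ ∈ D
  /-- the reference kernel, a function of time and space -/
  K : ℝ × E d → ℝ
  K_smooth : ContDiff ℝ ((⊤ : ℕ∞) : WithTop ℕ∞) K
  K_compact : HasCompactSupport K
  K_support : tsupport K ⊆ Ioo (0 : ℝ) 1 ×ˢ {y : E d | ∀ i, -1 < y i ∧ y i < 1}

/-- Test functions: continuous functions with compact support in `[0,T) × D` (written as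
restrictions to `t ≥ 0` of functions on `ℝ × ℝ^d`; nothing below depends on the values for `t < 0`).
The class contains `C_c^∞([0,T) × D)` and its image under `∇ · θ ∇` for `θ` of class `C¹`. -/
def IsTest {d : ℕ} (T : ℝ) (D : Set (E d)) (φ : ℝ × E d → ℝ) : Prop :=
  Continuous φ ∧ HasCompactSupport φ ∧ tsupport φ ⊆ Iio T ×ˢ D

/-- The space of test functions. -/
abbrev Test {d : ℕ} (T : ℝ) (D : Set (E d)) : Type := {φ : ℝ × E d → ℝ // IsTest T D φ}

/-- The time slice `φ(t, ·)` as an element of `L²(D)`. -/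
def slice {d : ℕ} (D : Set (E d)) (φ : ℝ × E d → ℝ) (t : ℝ) : L2 D :=
  toL2 (volume.restrict D) (fun x => φ (t, x))

/-- `V` is an isonormal Gaussian process on the Hilbert space `H`. -/
structure IsIsonormal {H : Type*} [NormedAddCommGroup H] [InnerProductSpace ℝ H]
    {Ω : Type*} [MeasurableSpace Ω] (P : Measure Ω) (V : H → Ω → ℝ) : Prop where
  gaussian : IsGaussianProcess V P
  mean : ∀ f, ∫ ω, V f ω ∂P = 0
  cov : ∀ f g, ∫ ω, V f ω * V g ω ∂P = inner ℝ f g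

/-- `X` is the solution process of the stochastic heat equation
`∂_t X = ∇ · θ ∇ X + σ dW/dt`, `X_0 = ξ`, with Dirichlet boundary conditions: the Gaussian process
with mean `⟨⟨S(·)ξ, φ⟩⟩` and covariance
`σ²/2 ∫_0^∞ ∫_0^∞ ∫_{|t-s|}^{t+s} ⟨φ(t,·), S(r) ψ(s,·)⟩ dr ds dt`. -/
structure IsSignal {d : ℕ} (m : HeatModel d) (S : ℝ → L2 m.D →L[ℝ] L2 m.D)
    {Ω : Type*} [MeasurableSpace Ω] (P : Measure Ω) (X : Test m.T m.D → Ω → ℝ) : Prop where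
  gaussian : IsGaussianProcess X P
  mean : ∀ φ, ∫ ω, X φ ω ∂P = ∫ t in Ioi (0 : ℝ), inner ℝ (S t m.ξ) (slice m.D φ.1 t)
  cov : ∀ φ ψ, cov[X φ, X ψ; P] = m.σ ^ 2 / 2 *
    ∫ t in Ioi (0 : ℝ), ∫ s in Ioi (0 : ℝ), ∫ r in |t - s|..(t + s),
      inner ℝ (slice m.D φ.1 t) (S r (slice m.D ψ.1 s))

/-! ### Differential operators on functions of time and space -/

/-- `∂_t φ`. -/
def timeDeriv {d : ℕ} (φ : ℝ × E d → ℝ) : ℝ × E d → ℝ :=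
  fun p => deriv (fun t => φ (t, p.2)) p.1

/-- The spatial Laplacian `Δφ`. -/
def spaceLap {d : ℕ} (φ : ℝ × E d → ℝ) : ℝ × E d → ℝ :=
  fun p => Laplacian.laplacian (fun y => φ (p.1, y)) p.2

/-- `Δ_θ φ = ∇ · (θ ∇φ)` in the space variable. -/
def spaceDivGrad {d : ℕ} (θ : E d → ℝ) (φ : ℝ × E d → ℝ) : ℝ × E d → ℝ :=
  fun p => ∑ i, partialDeriv i (fun y => θ y * partialDeriv i (fun z => φ (p.1, z)) y) p.2

namespace HeatModel

variable {d : ℕ} (m : HeatModel d) {Ω : Type*} [MeasurableSpace Ω]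

/-! ### Observation and localized kernels -/

open Classical in
/-- `⟨⟨X, φ⟩⟩` for a function `φ` (`0` if `φ` is not a test function). -/
def pairX (X : Test m.T m.D → Ω → ℝ) (φ : ℝ × E d → ℝ) (ω : Ω) : ℝ :=
  if hφ : IsTest m.T m.D φ then X ⟨φ, hφ⟩ ω else 0

/-- The observation `Y = X + ε dV/dt`, evaluated at `φ`. -/
def pairY (X : Test m.T m.D → Ω → ℝ) (V : L2ST m.T m.D → Ω → ℝ) (ε : ℝ)
    (φ : ℝ × E d → ℝ) (ω : Ω) : ℝ :=
  m.pairX X φ ω + ε * V (toL2 _ φ) ω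

/-- The shifted kernel `K_{k,x}(t,y) = K(t - k, y - x)`, localized at `x₀`:
`(K_{k,x})_{ε,x₀}(t,y) = ε^{-1/2-d/4} K_{k,x}(ε⁻¹ t, ε^{-1/2} (y - x₀))`. -/
def locK (ε : ℝ) (k : ℕ) (x : E d) : ℝ × E d → ℝ :=
  fun p => ε ^ (-(1 / 2 : ℝ) - (d : ℝ) / 4) *
    m.K (ε⁻¹ * p.1 - k, ε ^ (-(1 / 2 : ℝ)) • (p.2 - m.x₀) - x)

/-- `N_ε = ⌊T/ε⌋ - 1`. -/
def N (ε : ℝ) : ℕ := ⌊m.T / ε⌋₊ - 1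

/-- Admissible sets of grid points for noise level `ε`. -/
def IsGrid (ε : ℝ) (G : Finset (E d)) : Prop :=
  (∀ x ∈ G, tsupport (m.locK ε 0 x) ⊆ Ico 0 m.T ×ˢ m.D) ∧
    ∀ x ∈ G, ∀ y ∈ G, x ≠ y → Disjoint (tsupport (m.locK ε 0 x)) (tsupport (m.locK ε 0 y))

variable (X : Test m.T m.D → Ω → ℝ) (V : L2ST m.T m.D → Ω → ℝ)

/-- `X'_{ε,k,x} = -⟨⟨Y, ∂_t (K_{k,x})_{ε,x₀}⟩⟩`. -/
def Xdot (ε : ℝ) (k : ℕ) (x : E d) (ω : Ω) : ℝ :=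
  - m.pairY X V ε (timeDeriv (m.locK ε k x)) ω

/-- `X^Δ_{ε,k,x} = ⟨⟨Y, Δ (K_{k,x})_{ε,x₀}⟩⟩`. -/
def Xlap (ε : ℝ) (k : ℕ) (x : E d) (ω : Ω) : ℝ :=
  m.pairY X V ε (spaceLap (m.locK ε k x)) ω

/-! ### The estimator and the quantities in its error decomposition

`G` is the set of grid points and `w` the weight function at a given noise level `ε`. -/

variable (ε : ℝ) (G : Finset (E d)) (w : E d → ℝ)

/-- The empirical Fisher information `I_{ε,N_ε}`. -/
def fisher (ω : Ω) : ℝ :=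
  ∑ k ∈ Finset.Icc 1 (m.N ε), ∑ x ∈ G, w x * m.Xlap X V ε (k - 1) x ω * m.Xlap X V ε k x ω

/-- The estimator of `θ(x₀)`. -/
def estimator (ω : Ω) : ℝ :=
  (∑ k ∈ Finset.Icc 1 (m.N ε), ∑ x ∈ G, w x * m.Xlap X V ε (k - 1) x ω * m.Xdot X V ε k x ω) /
    m.fisher X V ε G w ω

/-- The bias term `B_{ε,N_ε}`; here
`⟨⟨[Δ_θ - Δ_{θ(x₀)}] X, φ⟩⟩ = ⟨⟨X, [Δ_θ - Δ_{θ(x₀)}] φ⟩⟩`. -/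
def bias (ω : Ω) : ℝ :=
  ∑ k ∈ Finset.Icc 1 (m.N ε), ∑ x ∈ G, w x * m.Xlap X V ε (k - 1) x ω *
    m.pairX X (fun p => spaceDivGrad m.θ (m.locK ε k x) p
      - m.θ m.x₀ * spaceLap (m.locK ε k x) p) ω

/-- `σ_K² = σ² ‖K‖² + ‖∂_t K + θ(x₀) ΔK‖²`, with the norms of `L²(ℝ × ℝ^d)`. -/
def sigmaKSq : ℝ :=
  m.σ ^ 2 * (∫ p, m.K p ^ 2) + ∫ p, (timeDeriv m.K p + m.θ m.x₀ * spaceLap m.K p) ^ 2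

/-- The quadratic variation
`⟨M_ε⟩_{N_ε} = σ_K² ∑_{k=1}^{N_ε} ∑_x w(x)² (X^Δ_{ε,k-1,x})²` of the martingale part. -/
def quadVar (ω : Ω) : ℝ :=
  m.sigmaKSq * ∑ k ∈ Finset.Icc 1 (m.N ε), ∑ x ∈ G, w x ^ 2 * m.Xlap X V ε (k - 1) x ω ^ 2

end HeatModel

/-! ### Asymptotics as `ε → 0` -/

/-- `Z_ε = O_P(r_ε)` as `ε ↓ 0`. -/
def IsBigOInProb {Ω : Type*} [MeasurableSpace Ω] (P : Measure Ω) (Z : ℝ → Ω → ℝ) (r : ℝ → ℝ) :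
    Prop :=
  ∀ η : ℝ, 0 < η → ∃ C : ℝ, 0 < C ∧
    ∀ᶠ ε in 𝓝[>] (0 : ℝ), P.real {ω | C * |r ε| < |Z ε ω|} ≤ η

/-- The moment conditions with bias exponent `γ`, for the grids `G ε`, the weights
`w ε (h ε)` and the bandwidths `h ε`. Here `a ∼ b` is `=Θ`: `a = O(b)` and `b = O(a)`. -/
structure MomentConditions {d : ℕ} (m : HeatModel d) {Ω : Type*} [MeasurableSpace Ω]
    (P : Measure Ω) (X : Test m.T m.D → Ω → ℝ) (V : L2ST m.T m.D → Ω → ℝ)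
    (G : ℝ → Finset (E d)) (w : ℝ → ℝ → E d → ℝ) (h : ℝ → ℝ) (γ : ℝ) : Prop where
  fisher_mean : (fun ε => ∫ ω, m.fisher X V ε (G ε) (w ε (h ε)) ω ∂P)
    =Θ[𝓝[>] (0 : ℝ)] (fun ε => (m.N ε : ℝ))
  fisher_var : (fun ε => Var[m.fisher X V ε (G ε) (w ε (h ε)); P])
    =o[𝓝[>] (0 : ℝ)] (fun ε => (m.N ε : ℝ) ^ 2)
  quadVar_mean : (fun ε => ∫ ω, m.quadVar X V ε (G ε) (w ε (h ε)) ω ∂P)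
    =O[𝓝[>] (0 : ℝ)] (fun ε => (m.N ε : ℝ) * ((G ε).card : ℝ)⁻¹ * (h ε ^ d)⁻¹)
  bias_sq_mean : (fun ε => ∫ ω, m.bias X V ε (G ε) (w ε (h ε)) ω ^ 2 ∂P)
    =O[𝓝[>] (0 : ℝ)] (fun ε => h ε ^ (2 * γ) * (m.N ε : ℝ) ^ 2)

/-- The bandwidth-dependent rate `ε^{1/2+d/4} h^{-d/2} + h^γ`. -/
def hRate (d : ℕ) (γ : ℝ) (h : ℝ → ℝ) (ε : ℝ) : ℝ :=
  ε ^ ((1 : ℝ) / 2 + (d : ℝ) / 4) * h ε ^ (-((d : ℝ) / 2)) + h ε ^ γ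

end NoisyHeat

end

open NoisyHeat

noncomputable section

namespace NoisyHeat

/-! ### Strongly continuous semigroups on a real Hilbert space -/

/-! The estimator is a weighted least-squares quotient, so its error is driven by the residual X' −
ϑ(x₀)X^Δ. Write K for the localized kernel K_{k,x}. Almost surely the residual equals −Z + ⟨⟨X, [Δ_ϑ
− ϑ(x₀)Δ]K⟩⟩, where Z = ⟨⟨X, ∂_t K + Δ_ϑ K⟩⟩ + ε V(∂_t K + ϑ(x₀)ΔK) is pure noise (`ae_pairY_eq`).
Hence the error is (B − M)/I wherever I ≠ 0, with M the sum of w X^Δ_{k-1,x} Z_{k,x} (`ae_sum_eq`).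

The core is the identity E M² = E⟨M⟩ (`integral_martingalePart_sq`). No filtration is needed: all
variables are jointly Gaussian, so it suffices that the Z_{k,x} are centered with variance σ_K²,
mutually uncorrelated, and uncorrelated with observations on earlier time blocks
(`integral_sq_sum_of_cov_eq_zero`). These facts are extracted from the mean and covariance formulas
of X. Integrating along the semigroup turns the covariance of ⟨⟨X, ψ⟩⟩ and ⟨⟨X, ∂_t φ + Δ_ϑ φ⟩⟩ into
−σ² times the integral of ⟨ψ(t), S(t−s)φ(s)⟩ over 0 < s < t (`integral_integral_integral_orbit`).
This vanishes when ψ lives before φ. When ψ = ∂_t χ + Δ_ϑ χ, a second integration leaves σ² ∫ ⟨χ(s),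
φ(s)⟩ ds (`integral_orbit_paths`), so the noise is white. Both integrations rest on C_c^∞(D) lying
in the domain of Δ_ϑ and on symmetry of Δ_ϑ against such functions (`isDivGrad_toL2`,
`inner_divGrad_eq`). Parabolic scaling makes the variance of Z exactly σ_K² at every ε
(`sigmaKSq_eq`).

Linearity of X and V in their index is not assumed; it holds almost surely because means and
covariances are linear (`ae_eq_add_mul_of_cov`).

The rest is Chebyshev's inequality (`isBigOInProb_of_div`): I stays above a multiple of N with high
probability, while B and M have second moments of order h^{2γ}N² and N/(|𝒳|h^d). In the bandwidth
trade-off one term decreases in h and the other increases, so the larger of the two is at least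
their common value at the crossing point (`rpow_le_hRate`). -/

/-- `S` is a `C₀`-semigroup. -/
structure IsC0Semigroup {H : Type*} [NormedAddCommGroup H] [InnerProductSpace ℝ H]
    (S : ℝ → H →L[ℝ] H) : Prop where
  map_zero : S 0 = ContinuousLinearMap.id ℝ H
  map_add : ∀ s t : ℝ, 0 ≤ s → 0 ≤ t → S (s + t) = (S s).comp (S t)
  continuous_zero : ∀ f : H, Tendsto (fun t => S t f) (𝓝[>] 0) (𝓝 f)

/-- The generator of `S` maps `u` to `f`. -/
def Generates {H : Type*} [NormedAddCommGroup H] [InnerProductSpace ℝ H]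
    (S : ℝ → H →L[ℝ] H) (u f : H) : Prop :=
  Tendsto (fun t : ℝ => t⁻¹ • (S t u - u)) (𝓝[>] 0) (𝓝 f)

namespace IsC0Semigroup

variable {H : Type*} [NormedAddCommGroup H] [InnerProductSpace ℝ H]
  {S : ℝ → H →L[ℝ] H}

lemma apply_zero (hS : IsC0Semigroup S) (f : H) : S 0 f = f := by simp [hS.map_zero]

lemma apply_add (hS : IsC0Semigroup S) {s t : ℝ} (hs : 0 ≤ s) (ht : 0 ≤ t) (f : H) :
    S (s + t) f = S s (S t f) := by rw [hS.map_add s t hs ht]; rfl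

/-- The absolute value makes the one-sided limit two-sided, the form in which it is composed with
differences of times. -/
lemma tendsto_abs (hS : IsC0Semigroup S) (f : H) :
    Tendsto (fun t : ℝ => ‖S |t| f - f‖) (𝓝 0) (𝓝 0) := by
  have h1 : Tendsto (fun t => S t f) (𝓝[≥] 0) (𝓝 f) := by
    rw [← Ioi_insert, nhdsWithin_insert, tendsto_sup]
    exact ⟨by rw [tendsto_pure_left]; intro s hs; rw [hS.apply_zero]; exact mem_of_mem_nhds hs,
      hS.continuous_zero f⟩
  have h2 : Tendsto (fun t : ℝ => |t|) (𝓝 0) (𝓝[≥] 0) :=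
    tendsto_nhdsWithin_iff.2 ⟨by simpa using (continuous_abs (G := ℝ)).tendsto 0,
      Eventually.of_forall fun t => abs_nonneg t⟩
  simpa using ((h1.comp h2).sub_const f).norm

/-- Factoring out the smaller time reduces continuity anywhere to continuity at zero. -/
lemma norm_sub_le (hS : IsC0Semigroup S) {R M : ℝ} (hM : ∀ t, 0 ≤ t → t ≤ R → ‖S t‖ ≤ M)
    {r s : ℝ} (hr : 0 ≤ r) (hrR : r ≤ R) (hs : 0 ≤ s) (hsR : s ≤ R) (f : H) :
    ‖S r f - S s f‖ ≤ M * ‖S |r - s| f - f‖ := by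
  wlog h : s ≤ r generalizing r s
  · rw [norm_sub_rev, abs_sub_comm]
    exact this hs hsR hr hrR (le_of_not_ge h)
  have : S r f - S s f = S s (S |r - s| f - f) := by
    rw [map_sub, ← hS.apply_add hs (abs_nonneg _), abs_of_nonneg (by linarith)]
    congr 3; ring
  rw [this]
  exact (S s).le_of_opNorm_le (hM s hs hsR) _

lemma tendsto_slope_orbit (hS : IsC0Semigroup S) {u f : H} (huf : Generates S u f) {r : ℝ}
    (hr : 0 ≤ r) : Tendsto (fun t : ℝ => t⁻¹ • (S (r + t) u - S r u)) (𝓝[>] 0) (𝓝 (S r f)) := by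
  refine (((S r).continuous.tendsto f).comp huf).congr' ?_
  filter_upwards [self_mem_nhdsWithin] with t ht
  simp only [Function.comp, map_smul, map_sub]
  rw [hS.apply_add hr (le_of_lt ht)]

lemma generates_orbit (hS : IsC0Semigroup S) {u f : H} (huf : Generates S u f) {r : ℝ}
    (hr : 0 ≤ r) : Generates S (S r u) (S r f) := by
  refine (hS.tendsto_slope_orbit huf hr).congr' ?_
  filter_upwards [self_mem_nhdsWithin] with t ht
  rw [add_comm, hS.apply_add (le_of_lt ht) hr]

/-- Nothing is known about `S` at negative times, so orbits are frozen there by `max r 0`; this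
makes them continuous on the whole line and is used throughout. -/
lemma hasDerivWithinAt_orbit (hS : IsC0Semigroup S) {u f : H} (huf : Generates S u f) {r : ℝ}
    (hr : 0 ≤ r) : HasDerivWithinAt (fun r => S (max r 0) u) (S (max r 0) f) (Ioi r) r := by
  rw [hasDerivWithinAt_iff_tendsto_slope' (by simp)]
  have h1 : Tendsto (fun s : ℝ => s - r) (𝓝[>] r) (𝓝[>] 0) := by
    refine tendsto_nhdsWithin_iff.2 ⟨?_, ?_⟩
    · have : Continuous fun s : ℝ => s - r := by fun_prop
      simpa using (this.tendsto r).mono_left nhdsWithin_le_nhds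
    · filter_upwards [self_mem_nhdsWithin] with s hs
      simpa using hs
  rw [max_eq_left hr]
  refine ((hS.tendsto_slope_orbit huf hr).comp h1).congr' ?_
  filter_upwards [self_mem_nhdsWithin] with s hs
  have hs' : r < s := hs
  simp only [Function.comp, slope, vsub_eq_sub, add_sub_cancel]
  rw [max_eq_left hr, max_eq_left (hr.trans hs'.le)]

variable [CompleteSpace H]

/-- Otherwise the norms blow up along some times decreasing to zero, although every orbit converges
along them; this contradicts the uniform boundedness principle. -/
lemma exists_bound_near_zero (hS : IsC0Semigroup S) :
    ∃ δ > 0, ∃ M : ℝ, ∀ t, 0 ≤ t → t ≤ δ → ‖S t‖ ≤ M := by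
  by_contra! hcon
  have h1 : ∀ n : ℕ, ∃ t : ℝ, 0 ≤ t ∧ t ≤ 1 / ((n : ℝ) + 1) ∧ (n : ℝ) + 1 < ‖S t‖ := by
    intro n
    obtain ⟨t, h0, ht, hM⟩ := hcon (1 / ((n : ℝ) + 1)) (by positivity) ((n : ℝ) + 1)
    exact ⟨t, h0, ht, hM⟩
  choose t ht0 htle htn using h1
  -- Time zero has to be excluded because strong continuity is a limit through positive times.
  have htpos : ∀ n, 0 < t n := by
    intro n
    refine lt_of_le_of_ne (ht0 n) fun h => ?_
    have := htn n
    rw [← h, hS.map_zero] at this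
    have h2 : ‖ContinuousLinearMap.id ℝ H‖ ≤ 1 := ContinuousLinearMap.norm_id_le
    have h3 : (0 : ℝ) ≤ n := n.cast_nonneg
    linarith
  have htend : Tendsto t atTop (𝓝[>] 0) := by
    refine tendsto_nhdsWithin_iff.2 ⟨?_, Eventually.of_forall htpos⟩
    exact squeeze_zero ht0 htle tendsto_one_div_add_atTop_nhds_zero_nat
  obtain ⟨C, hC⟩ := banach_steinhaus (g := fun n => S (t n)) (fun f => by
    obtain ⟨C, hC⟩ := (Metric.isBounded_range_of_tendsto _
      ((hS.continuous_zero f).comp htend)).exists_norm_le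
    exact ⟨C, fun n => hC _ ⟨n, rfl⟩⟩)
  obtain ⟨n, hn⟩ := exists_nat_gt C
  have := htn n
  have := hC n
  linarith

/-- The semigroup law propagates the bound near zero, one step of length `δ` at a time. -/
lemma exists_bound (hS : IsC0Semigroup S) (T : ℝ) :
    ∃ M : ℝ, 0 ≤ M ∧ ∀ t, 0 ≤ t → t ≤ T → ‖S t‖ ≤ M := by
  obtain ⟨δ, hδ, M, hM⟩ := hS.exists_bound_near_zero
  have key : ∀ n : ℕ, ∃ C : ℝ, 0 ≤ C ∧ ∀ t, 0 ≤ t → t ≤ n * δ → ‖S t‖ ≤ C := by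
    intro n
    induction n with
    | zero =>
      refine ⟨‖S 0‖, norm_nonneg _, fun t h0 h1 => ?_⟩
      rw [le_antisymm (by simpa using h1) h0]
    | succ n ih =>
      obtain ⟨C, hC0, hC⟩ := ih
      refine ⟨max C (C * M), le_max_of_le_left hC0, fun t h0 h1 => ?_⟩
      rcases le_or_gt t (n * δ) with h | h
      · exact (hC t h0 h).trans (le_max_left _ _)
      · have hn : 0 ≤ n * δ := by positivity
        have : S t = (S (n * δ)).comp (S (t - n * δ)) := by
          rw [← hS.map_add _ _ hn (by linarith)]; congr 1; ring
        rw [this]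
        refine le_max_of_le_right ((ContinuousLinearMap.opNorm_comp_le _ _).trans ?_)
        gcongr
        · exact hC _ hn le_rfl
        · refine hM _ (by linarith) ?_
          push_cast at h1; linarith
  obtain ⟨n, hn⟩ := exists_nat_gt (T / δ)
  obtain ⟨C, hC0, hC⟩ := key n
  refine ⟨C, hC0, fun t h0 h1 => hC t h0 (h1.trans ?_)⟩
  rw [div_lt_iff₀ hδ] at hn
  exact hn.le

lemma continuous_orbit (hS : IsC0Semigroup S) (f : H) :
    Continuous fun r : ℝ => S (max r 0) f := by
  rw [continuous_iff_continuousAt]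
  intro r
  set R := |r| + 1
  obtain ⟨M, hM0, hM⟩ := hS.exists_bound R
  rw [ContinuousAt, tendsto_iff_norm_sub_tendsto_zero]
  have h0 : Tendsto (fun s : ℝ => max s 0 - max r 0) (𝓝 r) (𝓝 0) := by
    have : Continuous fun s : ℝ => max s 0 - max r 0 := by fun_prop
    simpa using this.tendsto r
  have h1 : Tendsto (fun s : ℝ => M * ‖S |max s 0 - max r 0| f - f‖) (𝓝 r) (𝓝 0) := by
    simpa using ((hS.tendsto_abs f).comp h0).const_mul M
  refine squeeze_zero' (Eventually.of_forall fun _ => norm_nonneg _) ?_ h1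
  have h2 : ∀ᶠ s in 𝓝 r, s < R := by
    refine eventually_lt_nhds ?_
    have := le_abs_self r
    simp only [R]; linarith
  have hR : 0 ≤ R := by positivity
  filter_upwards [h2] with s hs
  refine hS.norm_sub_le hM (le_max_right _ _) (max_le hs.le hR) (le_max_right _ _) ?_ f
  refine max_le ?_ hR
  have := le_abs_self r
  simp only [R]; linarith

/-- Strong continuity together with a local bound on the norms gives joint continuity, which later
supplies all measurability and integrability for Fubini. -/
lemma continuous_uncurry (hS : IsC0Semigroup S) :
    Continuous fun p : ℝ × H => S (max p.1 0) p.2 := by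
  rw [continuous_iff_continuousAt]
  rintro ⟨r, f⟩
  obtain ⟨M, hM0, hM⟩ := hS.exists_bound (|r| + 1)
  rw [ContinuousAt, tendsto_iff_norm_sub_tendsto_zero]
  have h1 : Tendsto (fun p : ℝ × H => M * ‖p.2 - f‖ + ‖S (max p.1 0) f - S (max r 0) f‖)
      (𝓝 (r, f)) (𝓝 0) := by
    have : Continuous fun p : ℝ × H => M * ‖p.2 - f‖ + ‖S (max p.1 0) f - S (max r 0) f‖ := by
      have h3 : Continuous fun p : ℝ × H => S (max p.1 0) f :=
        (hS.continuous_orbit f).comp continuous_fst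
      exact ((continuous_snd.sub continuous_const).norm.const_mul M).add
        (h3.sub continuous_const).norm
    simpa using this.tendsto (r, f)
  refine squeeze_zero' (Eventually.of_forall fun _ => norm_nonneg _) ?_ h1
  have h2 : ∀ᶠ p : ℝ × H in 𝓝 (r, f), p.1 < |r| + 1 := by
    refine (continuous_fst.tendsto _).eventually (eventually_lt_nhds ?_)
    have := le_abs_self r
    simp only; linarith
  filter_upwards [h2] with p hp
  have h3 : S (max p.1 0) p.2 - S (max r 0) f =
      S (max p.1 0) (p.2 - f) + (S (max p.1 0) f - S (max r 0) f) := by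
    rw [map_sub]; abel
  rw [h3]
  refine (norm_add_le _ _).trans ?_
  gcongr
  exact (S _).le_of_opNorm_le (hM _ (le_max_right _ _) (max_le hp.le (by positivity))) _

lemma continuous_comp (hS : IsC0Semigroup S) {α : Type*} [TopologicalSpace α] {a : α → ℝ}
    {g : α → H} (ha : Continuous a) (hg : Continuous g) :
    Continuous fun x => S (max (a x) 0) (g x) :=
  hS.continuous_uncurry.comp (ha.prodMk hg)

/-- The fundamental theorem of calculus needs only right derivatives, and those are immediate from
the semigroup law. -/
lemma integral_orbit (hS : IsC0Semigroup S) {u f : H} (huf : Generates S u f) {a b : ℝ}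
    (ha : 0 ≤ a) (hab : a ≤ b) :
    ∫ r in a..b, S (max r 0) f = S (max b 0) u - S (max a 0) u :=
  intervalIntegral.integral_eq_sub_of_hasDeriv_right_of_le hab (hS.continuous_orbit u).continuousOn
    (fun _ hx => hS.hasDerivWithinAt_orbit huf (ha.trans hx.1.le))
    ((hS.continuous_orbit f).intervalIntegrable _ _)

/-- The left derivative comes for free: the orbit is the integral of a continuous function. -/
lemma hasDerivAt_orbit (hS : IsC0Semigroup S) {u f : H} (huf : Generates S u f) {r : ℝ}
    (hr : 0 < r) : HasDerivAt (fun r => S (max r 0) u) (S (max r 0) f) r := by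
  have h1 : HasDerivAt (fun b => S 0 u + ∫ r in (0 : ℝ)..b, S (max r 0) f) (S (max r 0) f) r :=
    (intervalIntegral.integral_hasDerivAt_right ((hS.continuous_orbit f).intervalIntegrable _ _)
      ((hS.continuous_orbit f).stronglyMeasurableAtFilter _ _)
      (hS.continuous_orbit f).continuousAt).const_add _
  refine h1.congr_of_eventuallyEq ?_
  filter_upwards [eventually_gt_nhds hr] with b hb
  rw [hS.integral_orbit huf le_rfl hb.le]
  simp

/-- The domain of the generator is dense. -/
lemma exists_generates_near (hS : IsC0Semigroup S) (f : H) {δ : ℝ} (hδ : 0 < δ) :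
    ∃ u g, Generates S u g ∧ ‖u - f‖ < δ := by
  have hint : ∀ a b, IntervalIntegrable (fun r => S (max r 0) f) volume a b :=
    fun a b => (hS.continuous_orbit f).intervalIntegrable _ _
  have hder : ∀ h : ℝ, HasDerivAt (fun b => ∫ r in (0 : ℝ)..b, S (max r 0) f) (S (max h 0) f) h :=
    fun h => intervalIntegral.integral_hasDerivAt_right (hint _ _)
      ((hS.continuous_orbit f).stronglyMeasurableAtFilter _ _) (hS.continuous_orbit f).continuousAt
  have h0 := (hder 0).tendsto_slope_zero_right
  simp only [zero_add, intervalIntegral.integral_same, sub_zero, max_self, hS.apply_zero] at h0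
  obtain ⟨h, hlt, hh⟩ := ((h0.eventually (Metric.ball_mem_nhds f hδ)).and
    self_mem_nhdsWithin).exists
  have hh0 : (0 : ℝ) < h := hh
  -- A short time average of the orbit is close to `f` and lies in the domain: applying `S t`
  -- translates the window of integration, so only its two ends contribute to the difference
  -- quotient.
  refine ⟨h⁻¹ • ∫ r in (0 : ℝ)..h, S (max r 0) f, h⁻¹ • (S (max h 0) f - f), ?_, by
    simpa [dist_eq_norm] using hlt⟩
  have h1 := ((hder h).tendsto_slope_zero_right.sub h0).const_smul h⁻¹
  refine h1.congr' ?_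
  filter_upwards [self_mem_nhdsWithin] with t ht
  have ht0 : (0 : ℝ) < t := ht
  have h2 : S t (∫ r in (0 : ℝ)..h, S (max r 0) f) = ∫ r in t..(h + t), S (max r 0) f := by
    rw [← (S t).intervalIntegral_comp_comm (hint _ _)]
    have h3 := intervalIntegral.integral_comp_add_right (a := 0) (b := h)
      (fun r => S (max r 0) f) t
    rw [zero_add] at h3
    rw [← h3]
    refine intervalIntegral.integral_congr fun r hr => ?_
    rw [uIcc_of_le hh0.le] at hr
    rw [max_eq_left hr.1, max_eq_left (by linarith [hr.1]), add_comm r t,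
      hS.apply_add ht0.le hr.1]
  rw [map_smul, h2, ← smul_sub, ← smul_sub, smul_comm t⁻¹]
  congr 2
  rw [← intervalIntegral.integral_add_adjacent_intervals (hint 0 t) (hint t (h + t))]
  abel

/-- If `a` is the image of `χ` under the adjoint of the generator, then `⟨χ, S(t) f⟩` has
derivative `⟨a, S(t) f⟩`. -/
lemma inner_orbit_sub (hS : IsC0Semigroup S) {χ a : H}
    (hχ : ∀ u g, Generates S u g → inner ℝ a u = inner ℝ χ g) (f : H) {t : ℝ} (ht : 0 ≤ t) :
    inner ℝ χ (S (max t 0) f) - inner ℝ χ f = ∫ r in (0 : ℝ)..t, inner ℝ a (S (max r 0) f) := by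
  -- Both sides are continuous in `f`, so it suffices to treat `f` in the domain, where the orbit
  -- stays in the domain and `hχ` moves the generator onto it.
  have hdense : Dense {u : H | ∃ g, Generates S u g} := by
    rw [Metric.dense_iff]
    intro f r hr
    obtain ⟨u, g, hug, hu⟩ := hS.exists_generates_near f hr
    exact ⟨u, by simpa [dist_eq_norm] using hu, g, hug⟩
  have hc1 : Continuous fun f : H => inner ℝ χ (S (max t 0) f) - inner ℝ χ f := by fun_prop
  have hc2 : Continuous fun f : H => ∫ r in (0 : ℝ)..t, inner ℝ a (S (max r 0) f) := by
    refine intervalIntegral.continuous_parametric_intervalIntegral_of_continuous'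
      (f := fun (f : H) (r : ℝ) => inner ℝ a (S (max r 0) f)) ?_ 0 t
    exact continuous_const.inner (hS.continuous_comp continuous_snd continuous_fst)
  refine congrFun (hc1.ext_on hdense hc2 ?_) f
  rintro u ⟨g, hug⟩
  have h1 : ∀ r ∈ uIcc 0 t, inner ℝ a (S (max r 0) u) = inner ℝ χ (S (max r 0) g) :=
    fun r _ => hχ _ _ (hS.generates_orbit hug (le_max_right _ _))
  simp only
  rw [intervalIntegral.integral_congr h1]
  have h2 := (innerSL ℝ χ).intervalIntegral_comp_comm
    ((hS.continuous_orbit g).intervalIntegrable (μ := volume) 0 t)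
  simp only [innerSL_apply_apply] at h2
  rw [h2, hS.integral_orbit hug le_rfl ht, inner_sub_right]
  simp [hS.apply_zero]

lemma hasDerivAt_inner_orbit (hS : IsC0Semigroup S) {χ a : H}
    (hχ : ∀ u g, Generates S u g → inner ℝ a u = inner ℝ χ g) (f : H) {t : ℝ} (ht : 0 < t) :
    HasDerivAt (fun t => (inner ℝ χ (S (max t 0) f) : ℝ)) (inner ℝ a (S (max t 0) f)) t := by
  have hc : Continuous fun r => (inner ℝ a (S (max r 0) f) : ℝ) :=
    continuous_const.inner (hS.continuous_orbit f)
  have h1 : HasDerivAt (fun b => inner ℝ χ f + ∫ r in (0 : ℝ)..b, inner ℝ a (S (max r 0) f))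
      (inner ℝ a (S (max t 0) f)) t :=
    (intervalIntegral.integral_hasDerivAt_right (hc.intervalIntegrable _ _)
      (hc.stronglyMeasurableAtFilter _ _) hc.continuousAt).const_add _
  refine h1.congr_of_eventuallyEq ?_
  filter_upwards [eventually_gt_nhds ht] with b hb
  rw [← hS.inner_orbit_sub hχ f hb.le]
  ring

end IsC0Semigroup

/-! ### Paths of test functions in the domain of the generator -/

/-- `p` is a continuously differentiable path with derivative `p'`, supported in `(0, T)`, and `q`
is a continuous path such that `⟨q t, u⟩ = ⟨p t, A u⟩` for `u` in the domain of the generator `A`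
of `S`. -/
structure IsAdjointPath {H : Type*} [NormedAddCommGroup H] [InnerProductSpace ℝ H]
    (S : ℝ → H →L[ℝ] H) (T : ℝ) (p p' q : ℝ → H) : Prop where
  hasDerivAt : ∀ t, HasDerivAt p (p' t) t
  continuous_deriv : Continuous p'
  continuous_adjoint : Continuous q
  eq_zero : ∀ t, t ∉ Ioo 0 T → p t = 0
  adjoint_eq_zero : ∀ t, t ∉ Ioo 0 T → q t = 0
  adjoint : ∀ t u g, Generates S u g → inner ℝ (q t) u = inner ℝ (p t) g

lemma setIntegral_Ioi_eq_intervalIntegral {g : ℝ → ℝ} {a R : ℝ} (haR : a ≤ R)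
    (hg : ∀ t, R < t → g t = 0) : ∫ t in Ioi a, g t = ∫ t in a..R, g t := by
  rw [intervalIntegral.integral_of_le haR]
  exact setIntegral_eq_of_subset_of_forall_sdiff_eq_zero measurableSet_Ioi
    (fun t ht => ht.1) (fun t ht => hg t (not_le.1 fun h => ht.2 ⟨ht.1, h⟩))

/-- Regions such as `s < t` are encoded as indicators on a rectangle, so that Fubini applies without
variable limits. -/
lemma integrable_indicator_of_continuous {F : ℝ × ℝ → ℝ} (hF : Continuous F) {s : Set (ℝ × ℝ)}
    (hs : MeasurableSet s) (a b c e : ℝ) :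
    Integrable (s.indicator F)
      ((volume.restrict (Ioc a b)).prod (volume.restrict (Ioc c e))) := by
  refine Integrable.indicator ?_ hs
  rw [Measure.prod_restrict]
  have h : IntegrableOn F (Icc a b ×ˢ Icc c e) (volume.prod volume) :=
    hF.continuousOn.integrableOn_compact (isCompact_Icc.prod isCompact_Icc)
  refine h.mono_set ?_
  exact prod_mono Ioc_subset_Icc_self Ioc_subset_Icc_self

lemma setIntegral_indicator_Ioi {g : ℝ → ℝ} {a b c : ℝ} (hac : a ≤ c) (hcb : c ≤ b) :
    ∫ x in Ioc a b, (Ioi c).indicator g x = ∫ x in c..b, g x := by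
  rw [setIntegral_indicator measurableSet_Ioi, Ioc_inter_Ioi, max_eq_right hac,
    intervalIntegral.integral_of_le hcb]

section Paths

variable {H : Type*} [NormedAddCommGroup H] [InnerProductSpace ℝ H]
  {S : ℝ → H →L[ℝ] H} {T : ℝ} {p p' q : ℝ → H}

lemma IsAdjointPath.continuous (hp : IsAdjointPath S T p p' q) : Continuous p :=
  continuous_iff_continuousAt.2 fun t => (hp.hasDerivAt t).continuousAt

lemma IsAdjointPath.continuous_add (hp : IsAdjointPath S T p p' q) :
    Continuous fun t => p' t + q t := hp.continuous_deriv.add hp.continuous_adjoint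

lemma IsAdjointPath.deriv_eq_zero (hp : IsAdjointPath S T p p' q) {t : ℝ} (ht : T < t) :
    p' t = 0 := by
  have h : p =ᶠ[𝓝 t] fun _ => 0 := by
    filter_upwards [eventually_gt_nhds ht] with s hs
    exact hp.eq_zero s fun h => absurd h.2 (not_lt.2 hs.le)
  exact (hp.hasDerivAt t).unique ((hasDerivAt_const t (0 : H)).congr_of_eventuallyEq h)

lemma IsAdjointPath.add_eq_zero (hp : IsAdjointPath S T p p' q) {t : ℝ} (ht : T < t) :
    p' t + q t = 0 := by
  rw [hp.deriv_eq_zero ht, hp.adjoint_eq_zero t fun h => absurd h.2 (not_lt.2 ht.le), add_zero]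

variable [CompleteSpace H]

namespace IsC0Semigroup

/-- A product rule although `S` is not differentiable in operator norm: the difference quotient of
the path is carried along by joint continuity, and the orbit is differentiated at the fixed vector
`p s`. -/
lemma hasDerivAt_orbit_path (hS : IsC0Semigroup S) (hp : ∀ t, HasDerivAt p (p' t) t)
    (hq : ∀ t, Generates S (p t) (q t)) {v s : ℝ} (hv : 0 < s + v) :
    HasDerivAt (fun s => S (max (s + v) 0) (p s)) (S (max (s + v) 0) (p' s + q s)) s := by
  have h1 : HasDerivAt (fun t => S (max (t + v) 0) (p s)) (S (max (s + v) 0) (q s)) s :=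
    (hS.hasDerivAt_orbit (hq s) hv).comp_add_const s v
  have h2 : Tendsto (fun t => S (max (t + v) 0) (slope p s t)) (𝓝[≠] s)
      (𝓝 (S (max (s + v) 0) (p' s))) := by
    have hc := hS.continuous_uncurry.tendsto (s + v, p' s)
    refine hc.comp (Tendsto.prodMk_nhds ?_ (hasDerivAt_iff_tendsto_slope.1 (hp s)))
    exact ((continuous_add_const v).tendsto s).mono_left nhdsWithin_le_nhds
  rw [hasDerivAt_iff_tendsto_slope] at h1 ⊢
  rw [(S (max (s + v) 0)).map_add]
  refine (h2.add h1).congr fun t => ?_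
  simp only [slope, vsub_eq_sub, map_smul, map_sub, ← smul_add]
  congr 1
  abel

/-- The weak form of the product rule. Only the adjoint relation is needed, so `f` may be outside
the domain. -/
lemma hasDerivAt_inner_path (hS : IsC0Semigroup S) (hp : IsAdjointPath S T p p' q) (f : H)
    {v t : ℝ} (hv : 0 < t + v) :
    HasDerivAt (fun t => (inner ℝ (p t) (S (max (t + v) 0) f) : ℝ))
      (inner ℝ (p' t + q t) (S (max (t + v) 0) f)) t := by
  have h1 : HasDerivAt (fun s => (inner ℝ (p t) (S (max (s + v) 0) f) : ℝ))
      (inner ℝ (q t) (S (max (t + v) 0) f)) t :=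
    (hS.hasDerivAt_inner_orbit (hp.adjoint t) f hv).comp_add_const t v
  have hc : Continuous fun s => S (max (s + v) 0) f :=
    hS.continuous_comp (continuous_add_const v) continuous_const
  have h2 : Tendsto (fun s => (inner ℝ (slope p t s) (S (max (s + v) 0) f) : ℝ)) (𝓝[≠] t)
      (𝓝 (inner ℝ (p' t) (S (max (t + v) 0) f))) :=
    (hasDerivAt_iff_tendsto_slope.1 (hp.hasDerivAt t)).inner
      ((hc.tendsto t).mono_left nhdsWithin_le_nhds)
  rw [hasDerivAt_iff_tendsto_slope] at h1 ⊢
  rw [inner_add_left]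
  refine (h2.add h1).congr fun s => ?_
  simp only [slope, vsub_eq_sub, real_inner_smul_left, inner_sub_left, smul_eq_mul]
  ring

lemma continuous_inner_path (hS : IsC0Semigroup S) (hp : IsAdjointPath S T p p' q) (f : H)
    (v : ℝ) : Continuous fun t => (inner ℝ (p' t + q t) (S (max (t + v) 0) f) : ℝ) :=
  hp.continuous_add.inner (hS.continuous_comp (continuous_add_const v) continuous_const)

lemma integral_inner_path (hS : IsC0Semigroup S) (hp : IsAdjointPath S T p p' q) (f : H)
    {s R : ℝ} (hsR : s ≤ R) (hR : T ≤ R) :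
    ∫ t in s..R, (inner ℝ (p' t + q t) (S (max (t + -s) 0) f) : ℝ) = - inner ℝ (p s) f := by
  have hcont : Continuous fun t => (inner ℝ (p t) (S (max (t + -s) 0) f) : ℝ) :=
    hp.continuous.inner (hS.continuous_comp (continuous_add_const (-s)) continuous_const)
  rw [intervalIntegral.integral_eq_sub_of_hasDerivAt_of_le hsR hcont.continuousOn
    (fun t ht => hS.hasDerivAt_inner_path hp f (by linarith [ht.1]))
    ((hS.continuous_inner_path hp f (-s)).intervalIntegrable _ _),
    hp.eq_zero R fun h => absurd h.2 (not_lt.2 hR)]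
  simp [hS.apply_zero]

/-- The mean of the signal at `∂_t φ + A φ` vanishes. -/
lemma integral_inner_orbit_path (hS : IsC0Semigroup S) (hp : IsAdjointPath S T p p' q)
    (hT : 0 ≤ T) (f : H) : ∫ t in Ioi (0 : ℝ), (inner ℝ (S t f) (p' t + q t) : ℝ) = 0 := by
  rw [setIntegral_Ioi_eq_intervalIntegral hT fun t ht => by rw [hp.add_eq_zero ht, inner_zero_right]]
  have h := hS.integral_inner_path hp f hT le_rfl
  simp only [neg_zero, add_zero] at h
  rw [hp.eq_zero 0 (by simp), inner_zero_left, neg_zero] at h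
  refine Eq.trans (intervalIntegral.integral_congr fun t ht => ?_) h
  rw [uIcc_of_le hT] at ht
  simp only [max_eq_left ht.1]
  exact real_inner_comm _ _

/-- With `r = s + v`, the integrand at fixed `v` is the `s`-derivative of `⟨f, S(s + v) p(s)⟩`.
After exchanging the integrals, the `s`-integral reduces to its lower endpoint `(t - v) / 2`, since
the path vanishes at the upper one. -/
lemma integral_integral_orbit_max (hS : IsC0Semigroup S) (hp : IsAdjointPath S T p p' q)
    (hq : ∀ t, Generates S (p t) (q t)) (hT : 0 ≤ T) (f : H) {t : ℝ} (ht : 0 < t) :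
    ∫ s in Ioi (0 : ℝ), ∫ r in |t - s|..(t + s), (inner ℝ f (S (max r 0) (p' s + q s)) : ℝ) =
      -2 * ∫ s in (0 : ℝ)..t, inner ℝ f (S (max (t - s) 0) (p s)) := by
  set R := max T t
  have hTR : T ≤ R := le_max_left _ _
  have htR : t ≤ R := le_max_right _ _
  have hR : 0 ≤ R := hT.trans hTR
  set F : ℝ × ℝ → ℝ := fun z => inner ℝ f (S (max (z.1 + z.2) 0) (p' z.1 + q z.1)) with hF
  have hFc : Continuous F := by
    refine continuous_const.inner (hS.continuous_comp (by fun_prop) ?_)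
    exact hp.continuous_add.comp continuous_fst
  set U : Set (ℝ × ℝ) := {z | t - 2 * z.1 < z.2}
  have hU : MeasurableSet U := measurableSet_lt (by fun_prop) (by fun_prop)
  have h1 : ∀ s ∈ Ioc 0 R, ∫ r in |t - s|..(t + s), (inner ℝ f (S (max r 0) (p' s + q s)) : ℝ) =
      ∫ v in Ioc (-t) t, U.indicator F (s, v) := by
    intro s hs
    have e1 : ∀ v, U.indicator F (s, v) = (Ioi (t - 2 * s)).indicator (fun v => F (s, v)) v :=
      fun v => rfl
    simp_rw [e1]
    -- In the variable `v` the window becomes the fixed interval `(-t, t]` cut by the half-plane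
    -- `U`.
    have e2 : |t - s| - s = max (t - 2 * s) (-t) := by
      rcases le_total s t with h | h
      · rw [abs_of_nonneg (by linarith), max_eq_left (by linarith)]; ring
      · rw [abs_of_nonpos (by linarith), max_eq_right (by linarith)]; ring
    have e3 := intervalIntegral.integral_comp_add_left (a := |t - s| - s) (b := t)
      (fun r => (inner ℝ f (S (max r 0) (p' s + q s)) : ℝ)) s
    rw [setIntegral_indicator measurableSet_Ioi, Ioc_inter_Ioi, sup_comm, ← e2,
      ← intervalIntegral.integral_of_le (by rw [e2]; exact max_le (by linarith [hs.1]) (by linarith)),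
      e3]
    congr 1 <;> ring
  have h2 : ∀ v ∈ Ioc (-t) t, ∫ s in Ioc 0 R, U.indicator F (s, v) =
      - inner ℝ f (S (max (t - (t / 2 - v / 2)) 0) (p (t / 2 - v / 2))) := by
    intro v hv
    have e1 : ∀ s, U.indicator F (s, v) =
        (Ioi (t / 2 - v / 2)).indicator (fun s => F (s, v)) s := by
      intro s
      simp only [indicator, U, mem_ofPred_eq, mem_Ioi]
      congr 1
      exact propext ⟨fun h => by linarith, fun h => by linarith⟩
    simp_rw [e1]
    have hle : t / 2 - v / 2 ≤ R := by linarith [hv.1]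
    rw [setIntegral_indicator_Ioi (by linarith [hv.2]) hle]
    have hcont : Continuous fun s => (inner ℝ f (S (max (s + v) 0) (p s)) : ℝ) :=
      continuous_const.inner (hS.continuous_comp (continuous_add_const v) hp.continuous)
    rw [intervalIntegral.integral_eq_sub_of_hasDerivAt_of_le hle hcont.continuousOn
      (fun s hs => ?_)
      (Continuous.intervalIntegrable (u := fun s => F (s, v)) (hFc.comp (Continuous.prodMk_left v)) _ _),
      hp.eq_zero R fun h => absurd h.2 (not_lt.2 hTR)]
    · rw [_root_.map_zero, inner_zero_right, zero_sub,
        show t / 2 - v / 2 + v = t - (t / 2 - v / 2) by ring]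
    · have := hS.hasDerivAt_orbit_path hp.hasDerivAt hq (v := v) (s := s)
        (by linarith [hs.1, hv.1])
      exact (innerSL ℝ f).hasFDerivAt.comp_hasDerivAt s this
  -- Returning from `v` to `s = (t - v) / 2` produces the factor 2.
  have h3 := intervalIntegral.integral_comp_sub_div (a := -t) (b := t)
    (fun s => (inner ℝ f (S (max (t - s) 0) (p s)) : ℝ)) two_ne_zero (t / 2)
  rw [setIntegral_Ioi_eq_intervalIntegral hR (fun s hs => by
      simp [hp.add_eq_zero (hTR.trans_lt hs)]),
    intervalIntegral.integral_of_le hR, setIntegral_congr_fun measurableSet_Ioc h1,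
    integral_integral_swap (f := fun s v => U.indicator F (s, v))
      (integrable_indicator_of_continuous hFc hU _ _ _ _),
    setIntegral_congr_fun measurableSet_Ioc h2, integral_neg,
    ← intervalIntegral.integral_of_le (by linarith), h3]
  simp only [smul_eq_mul, neg_mul, neg_div, sub_self, sub_neg_eq_add, add_halves]

/-- The covariance form of the signal at `(ψ, ∂_t φ + A φ)`. -/
lemma integral_integral_integral_orbit (hS : IsC0Semigroup S) (hp : IsAdjointPath S T p p' q)
    (hq : ∀ t, Generates S (p t) (q t)) (hT : 0 ≤ T) (ψ : ℝ → H) :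
    ∫ t in Ioi (0 : ℝ), ∫ s in Ioi (0 : ℝ), ∫ r in |t - s|..(t + s),
      (inner ℝ (ψ t) (S r (p' s + q s)) : ℝ) =
      -2 * ∫ t in Ioi (0 : ℝ), ∫ s in (0 : ℝ)..t, inner ℝ (ψ t) (S (max (t - s) 0) (p s)) := by
  rw [← integral_const_mul]
  refine setIntegral_congr_fun measurableSet_Ioi fun t ht => ?_
  have ht0 : (0 : ℝ) < t := ht
  rw [← hS.integral_integral_orbit_max hp hq hT (ψ t) ht0]
  refine setIntegral_congr_fun measurableSet_Ioi fun s hs => ?_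
  have hs0 : (0 : ℝ) < s := hs
  refine intervalIntegral.integral_congr fun r hr => ?_
  rw [uIcc_of_le (abs_le.2 ⟨by linarith, by linarith⟩)] at hr
  simp only [max_eq_left ((abs_nonneg _).trans hr.1)]

/-- Causality: after the reduction only pairs `s < t` remain, and there one factor is zero. -/
lemma integral_orbit_eq_zero_of_before (hS : IsC0Semigroup S) (hp : IsAdjointPath S T p p' q)
    (hq : ∀ t, Generates S (p t) (q t)) (hT : 0 ≤ T) {ψ : ℝ → H}
    (hψ : ∀ s t, s < t → ψ t = 0 ∨ p s = 0) :
    ∫ t in Ioi (0 : ℝ), ∫ s in Ioi (0 : ℝ), ∫ r in |t - s|..(t + s),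
      (inner ℝ (ψ t) (S r (p' s + q s)) : ℝ) = 0 := by
  rw [hS.integral_integral_integral_orbit hp hq hT, mul_eq_zero]
  right
  refine setIntegral_eq_zero_of_forall_eq_zero fun t ht => ?_
  have ht0 : (0 : ℝ) < t := ht
  rw [intervalIntegral.integral_of_le ht0.le, integral_Ioc_eq_integral_Ioo]
  refine setIntegral_eq_zero_of_forall_eq_zero fun s hs => ?_
  rcases hψ s t hs.2 with h | h <;> simp [h]

/-- The first reduction leaves `-2` times an integral over `s < t`. Integrating in `t` first,
`integral_inner_path` collapses it to `-⟨χ s, p s⟩` on the diagonal; the two signs cancel. -/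
lemma integral_orbit_paths (hS : IsC0Semigroup S) (hp : IsAdjointPath S T p p' q)
    (hq : ∀ t, Generates S (p t) (q t)) (hT : 0 ≤ T) {χ χ' a : ℝ → H}
    (hχ : IsAdjointPath S T χ χ' a) :
    ∫ t in Ioi (0 : ℝ), ∫ s in Ioi (0 : ℝ), ∫ r in |t - s|..(t + s),
      (inner ℝ (χ' t + a t) (S r (p' s + q s)) : ℝ) =
      2 * ∫ s in (0 : ℝ)..T, inner ℝ (χ s) (p s) := by
  set F : ℝ × ℝ → ℝ := fun z => inner ℝ (χ' z.1 + a z.1) (S (max (z.1 - z.2) 0) (p z.2)) with hF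
  have hFc : Continuous F :=
    (hχ.continuous_add.comp continuous_fst).inner
      (hS.continuous_comp (by fun_prop) (hp.continuous.comp continuous_snd))
  set U : Set (ℝ × ℝ) := {z | z.2 < z.1}
  have hU : MeasurableSet U := measurableSet_lt (by fun_prop) (by fun_prop)
  have h1 : ∀ t ∈ Ioc 0 T, ∫ s in (0 : ℝ)..t, (inner ℝ (χ' t + a t) (S (max (t - s) 0) (p s)) : ℝ) =
      ∫ s in Ioc 0 T, U.indicator F (t, s) := by
    intro t ht
    have e1 : ∀ s, U.indicator F (t, s) = (Iio t).indicator (fun s => F (t, s)) s := fun _ => rfl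
    simp_rw [e1]
    rw [setIntegral_indicator measurableSet_Iio, intervalIntegral.integral_of_le ht.1.le,
      integral_Ioc_eq_integral_Ioo]
    congr 2
    ext s
    simp only [mem_Ioo, mem_inter_iff, mem_Ioc, mem_Iio]
    exact ⟨fun h => ⟨⟨h.1, h.2.le.trans ht.2⟩, h.2⟩, fun h => ⟨h.1.1, h.2⟩⟩
  have h2 : ∀ s ∈ Ioc 0 T, ∫ t in Ioc 0 T, U.indicator F (t, s) = - inner ℝ (χ s) (p s) := by
    intro s hs
    have e1 : ∀ t, U.indicator F (t, s) = (Ioi s).indicator (fun t => F (t, s)) t := fun _ => rfl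
    simp_rw [e1]
    rw [setIntegral_indicator_Ioi hs.1.le hs.2, ← hS.integral_inner_path hχ (p s) hs.2 le_rfl]
    simp only [hF, sub_eq_add_neg]
  rw [hS.integral_integral_integral_orbit hp hq hT, setIntegral_Ioi_eq_intervalIntegral hT
      (fun t ht => by simp [hχ.add_eq_zero ht]),
    intervalIntegral.integral_of_le hT, setIntegral_congr_fun measurableSet_Ioc h1,
    integral_integral_swap (f := fun t s => U.indicator F (t, s))
      (integrable_indicator_of_continuous hFc hU _ _ _ _),
    setIntegral_congr_fun measurableSet_Ioc h2, integral_neg, intervalIntegral.integral_of_le hT]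
  ring

end IsC0Semigroup

end Paths

/-! ### Classes in `L²` -/

section ToL2

variable {α : Type*} [MeasurableSpace α] {μ : Measure α} {f g : α → ℝ}

lemma toL2_eq_toLp (hf : MemLp f 2 μ) : toL2 μ f = hf.toLp f := dif_pos hf

lemma coeFn_toL2 (hf : MemLp f 2 μ) : toL2 μ f =ᵐ[μ] f := by
  rw [toL2_eq_toLp hf]
  exact hf.coeFn_toLp

lemma toL2_add (hf : MemLp f 2 μ) (hg : MemLp g 2 μ) :
    toL2 μ (fun x => f x + g x) = toL2 μ f + toL2 μ g := by
  rw [toL2_eq_toLp hf, toL2_eq_toLp hg, ← MemLp.toLp_add]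
  exact toL2_eq_toLp (hf.add hg)

lemma toL2_sub (hf : MemLp f 2 μ) (hg : MemLp g 2 μ) :
    toL2 μ (fun x => f x - g x) = toL2 μ f - toL2 μ g := by
  rw [toL2_eq_toLp hf, toL2_eq_toLp hg, ← MemLp.toLp_sub]
  exact toL2_eq_toLp (hf.sub hg)

lemma toL2_const_mul (c : ℝ) (hf : MemLp f 2 μ) :
    toL2 μ (fun x => c * f x) = c • toL2 μ f := by
  rw [toL2_eq_toLp hf, ← MemLp.toLp_const_smul]
  exact toL2_eq_toLp (hf.const_smul c)

lemma toL2_zero : toL2 μ (fun _ => (0 : ℝ)) = 0 := by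
  rw [toL2_eq_toLp MemLp.zero']
  exact MemLp.toLp_zero _

lemma inner_toL2_right (u : Lp ℝ 2 μ) (hf : MemLp f 2 μ) :
    inner ℝ u (toL2 μ f) = ∫ x, u x * f x ∂μ := by
  rw [L2.inner_def]
  refine integral_congr_ae ?_
  filter_upwards [coeFn_toL2 hf] with x hx
  simp [hx, mul_comm]

lemma inner_toL2_toL2 (hf : MemLp f 2 μ) (hg : MemLp g 2 μ) :
    inner ℝ (toL2 μ f) (toL2 μ g) = ∫ x, f x * g x ∂μ := by
  rw [inner_toL2_right _ hg]
  refine integral_congr_ae ?_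
  filter_upwards [coeFn_toL2 hf] with x hx
  simp [hx]

lemma norm_toL2_le [IsFiniteMeasure μ] (hf : MemLp f 2 μ) {C : ℝ} (hC : 0 ≤ C)
    (h : ∀ x, |f x| ≤ C) : ‖toL2 μ f‖ ≤ (measureUnivNNReal μ : ℝ) ^ (2 : ENNReal).toReal⁻¹ * C := by
  refine Lp.norm_le_of_ae_bound hC ?_
  filter_upwards [coeFn_toL2 hf] with x hx
  rw [hx]
  exact h x

end ToL2

/-! ### Partial derivatives -/

section Partial

variable {d : ℕ} {D : Set (E d)} {f g : E d → ℝ}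

lemma contDiff_partialDeriv {n m : WithTop ℕ∞} (hf : ContDiff ℝ n f) (hmn : m + 1 ≤ n) (i : Fin d) :
    ContDiff ℝ m (partialDeriv i f) :=
  (hf.fderiv_right hmn).clm_apply contDiff_const

lemma support_partialDeriv_subset (i : Fin d) (f : E d → ℝ) :
    Function.support (partialDeriv i f) ⊆ tsupport f := by
  intro x hx
  refine support_fderiv_subset ℝ (f := f) fun h => hx ?_
  simp [partialDeriv, h]

lemma tsupport_partialDeriv_subset (i : Fin d) (f : E d → ℝ) :
    tsupport (partialDeriv i f) ⊆ tsupport f :=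
  closure_minimal (support_partialDeriv_subset i f) (isClosed_tsupport f)

lemma partialDeriv_eq_zero_of_notMem {i : Fin d} {x : E d} (hx : x ∉ tsupport f) :
    partialDeriv i f x = 0 := by
  by_contra h
  exact hx (support_partialDeriv_subset i f h)

lemma IsSmoothTest.partialDeriv (hf : IsSmoothTest D f) (i : Fin d) :
    IsSmoothTest D (partialDeriv i f) :=
  ⟨contDiff_partialDeriv hf.1 (by simp) i,
    hf.2.1.of_isClosed_subset (isClosed_tsupport _) (tsupport_partialDeriv_subset i f),
    (tsupport_partialDeriv_subset i f).trans hf.2.2⟩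

lemma IsSmoothTest.memLp (hf : IsSmoothTest D f) : MemLp f 2 (volume.restrict D) :=
  hf.1.continuous.memLp_of_hasCompactSupport hf.2.1

lemma integral_mul_partialDeriv (hf : ContDiff ℝ 1 f) (hfc : HasCompactSupport f)
    (hg : ContDiff ℝ 1 g) (i : Fin d) :
    ∫ x, f x * partialDeriv i g x = - ∫ x, partialDeriv i f x * g x := by
  have hf' := contDiff_partialDeriv (m := 0) hf (by simp) i
  have hg' := contDiff_partialDeriv (m := 0) hg (by simp) i
  have hfc' : HasCompactSupport (partialDeriv i f) :=
    hfc.of_isClosed_subset (isClosed_tsupport _) (tsupport_partialDeriv_subset i f)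
  exact integral_mul_fderiv_eq_neg_fderiv_mul_of_integrable (v := EuclideanSpace.single i (1 : ℝ))
    ((hf'.continuous.mul hg.continuous).integrable_of_hasCompactSupport hfc'.mul_right)
    ((hf.continuous.mul hg'.continuous).integrable_of_hasCompactSupport hfc.mul_right)
    ((hf.continuous.mul hg.continuous).integrable_of_hasCompactSupport hfc.mul_right)
    (fun x _ => (hf.differentiable (by simp)).differentiableAt)
    (fun x _ => (hg.differentiable (by simp)).differentiableAt)

lemma setIntegral_mul_partialDeriv (hf : ContDiff ℝ 1 f) (hfc : HasCompactSupport f)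
    (hfD : tsupport f ⊆ D) (hg : ContDiff ℝ 1 g) (i : Fin d) :
    ∫ x in D, f x * partialDeriv i g x = - ∫ x in D, partialDeriv i f x * g x := by
  rw [setIntegral_eq_integral_of_forall_compl_eq_zero fun x hx => ?_,
    setIntegral_eq_integral_of_forall_compl_eq_zero fun x hx => ?_,
    integral_mul_partialDeriv hf hfc hg i]
  · rw [partialDeriv_eq_zero_of_notMem fun h => hx (hfD h), zero_mul]
  · rw [image_eq_zero_of_notMem_tsupport fun h => hx (hfD h), zero_mul]

lemma hasWeakPartial_toL2 (hf : IsSmoothTest D f) (i : Fin d) :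
    HasWeakPartial D i (toL2 _ f) (toL2 _ (partialDeriv i f)) := by
  intro φ hφ
  have h1 : ∫ x in D, (toL2 (volume.restrict D) f) x * partialDeriv i φ x =
      ∫ x in D, f x * partialDeriv i φ x := by
    refine integral_congr_ae ?_
    filter_upwards [coeFn_toL2 hf.memLp] with x hx
    rw [hx]
  have h2 : ∫ x in D, (toL2 (volume.restrict D) (partialDeriv i f)) x * φ x =
      ∫ x in D, partialDeriv i f x * φ x := by
    refine integral_congr_ae ?_
    filter_upwards [coeFn_toL2 (hf.partialDeriv i).memLp] with x hx
    rw [hx]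
  rw [h1, h2]
  exact setIntegral_mul_partialDeriv (hf.1.of_le (by simp)) hf.2.1 hf.2.2
    (hφ.1.of_le (by simp)) i

/-- Weak partial derivatives are unique. -/
lemma HasWeakPartial.unique (hD : IsOpen D) {i : Fin d} {u v w : L2 D}
    (hv : HasWeakPartial D i u v) (hw : HasWeakPartial D i u w) : v = w := by
  have hloc : ∀ v : L2 D, LocallyIntegrableOn v D volume := fun v =>
    locallyIntegrableOn_of_locallyIntegrable_restrict
      ((Lp.memLp v).locallyIntegrable (by norm_num))
  have h := hD.ae_eq_zero_of_integral_contDiff_smul_eq_zero (μ := volume)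
    (f := fun x => v x - w x) ((hloc v).sub (hloc w)) ?_
  · refine Lp.ext ?_
    rw [EventuallyEq, ae_restrict_iff' hD.measurableSet]
    filter_upwards [h] with x hx hxD
    linarith [hx hxD]
  · intro φ h1 h2 h3
    have hφ : IsSmoothTest D φ := ⟨h1, h2, h3⟩
    have e := (hv φ hφ).symm.trans (hw φ hφ)
    rw [neg_inj] at e
    rw [← setIntegral_eq_integral_of_forall_compl_eq_zero (s := D) fun x hx => by
      rw [image_eq_zero_of_notMem_tsupport fun h => hx (h3 h), zero_smul]]
    have hi : ∀ v : L2 D, Integrable (fun x => v x * φ x) (volume.restrict D) := fun v =>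
      (Lp.memLp v).integrable_mul hφ.memLp
    have e2 : ∫ x in D, φ x • (v x - w x) = ∫ x in D, (v x * φ x - w x * φ x) := by
      congr 1 with x
      rw [smul_eq_mul]; ring
    rw [e2, integral_sub (hi v) (hi w), e, sub_self]

/-! ### The operator `∇ · θ ∇` -/

/-- `∇ · (θ ∇f)`. -/
def divGrad (θ : E d → ℝ) (f : E d → ℝ) : E d → ℝ :=
  fun x => ∑ i, partialDeriv i (fun y => θ y * partialDeriv i f y) x

variable {θ : E d → ℝ}

/-- The diffusivity is regular only inside `D`; products with functions supported in `D` are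
nevertheless smooth everywhere. -/
lemma contDiff_of_forall_tsupport {n : WithTop ℕ∞} {F : Type*} [NormedAddCommGroup F]
    [NormedSpace ℝ F] {h : F → ℝ} (hh : ∀ x ∈ tsupport h, ContDiffAt ℝ n h x) : ContDiff ℝ n h := by
  rw [contDiff_iff_contDiffAt]
  intro x
  by_cases hx : x ∈ tsupport h
  · exact hh x hx
  · exact contDiffAt_const.congr_of_eventuallyEq (notMem_tsupport_iff_eventuallyEq.1 hx)

lemma tsupport_mul_partialDeriv_subset (θ f : E d → ℝ) (i : Fin d) :
    tsupport (fun y => θ y * partialDeriv i f y) ⊆ tsupport f :=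
  (tsupport_mul_subset_right (f := θ)).trans (tsupport_partialDeriv_subset i f)

lemma contDiff_mul_partialDeriv (hD : IsOpen D) (hθ : ContDiffOn ℝ 1 θ D) (hf : IsSmoothTest D f)
    (i : Fin d) : ContDiff ℝ 1 (fun y => θ y * partialDeriv i f y) := by
  refine contDiff_of_forall_tsupport fun x hx => ?_
  have hxD : x ∈ D := hf.2.2 (tsupport_mul_partialDeriv_subset θ f i hx)
  exact (hθ.contDiffAt (hD.mem_nhds hxD)).mul
    ((hf.partialDeriv i).1.of_le (by simp)).contDiffAt

lemma hasCompactSupport_mul_partialDeriv (θ : E d → ℝ) (hf : IsSmoothTest D f) (i : Fin d) :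
    HasCompactSupport (fun y => θ y * partialDeriv i f y) :=
  hf.2.1.of_isClosed_subset (isClosed_tsupport _) (tsupport_mul_partialDeriv_subset θ f i)

lemma continuous_divGrad (hD : IsOpen D) (hθ : ContDiffOn ℝ 1 θ D) (hf : IsSmoothTest D f) :
    Continuous (divGrad θ f) :=
  continuous_finsetSum _ fun i _ =>
    (contDiff_partialDeriv (m := 0) (contDiff_mul_partialDeriv hD hθ hf i) (by simp) i).continuous

lemma divGrad_eq_zero_of_notMem {x : E d} (hx : x ∉ tsupport f) : divGrad θ f x = 0 :=
  Finset.sum_eq_zero fun i _ => partialDeriv_eq_zero_of_notMem fun h =>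
    hx (tsupport_mul_partialDeriv_subset θ f i h)

lemma hasCompactSupport_divGrad (hf : HasCompactSupport f) : HasCompactSupport (divGrad θ f) :=
  HasCompactSupport.intro hf fun _ hx => divGrad_eq_zero_of_notMem hx

lemma memLp_divGrad (hD : IsOpen D) (hθ : ContDiffOn ℝ 1 θ D) (hf : IsSmoothTest D f) :
    MemLp (divGrad θ f) 2 (volume.restrict D) :=
  (continuous_divGrad hD hθ hf).memLp_of_hasCompactSupport (hasCompactSupport_divGrad hf.2.1)

lemma memLp_mul_partialDeriv (hD : IsOpen D) (hθ : ContDiffOn ℝ 1 θ D) (hf : IsSmoothTest D f)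
    (i : Fin d) : MemLp (fun y => θ y * partialDeriv i f y) 2 (volume.restrict D) :=
  (contDiff_mul_partialDeriv hD hθ hf i).continuous.memLp_of_hasCompactSupport
    (hasCompactSupport_mul_partialDeriv θ hf i)

lemma sum_inner_partialDeriv (hD : IsOpen D) (hθ : ContDiffOn ℝ 1 θ D) (hf : IsSmoothTest D f)
    (hg : IsSmoothTest D g) :
    ∑ i, (inner ℝ (toL2 (volume.restrict D) (partialDeriv i g))
      (toL2 (volume.restrict D) fun y => θ y * partialDeriv i f y) : ℝ) =
      - inner ℝ (toL2 (volume.restrict D) g) (toL2 (volume.restrict D) (divGrad θ f)) := by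
  rw [inner_toL2_toL2 hg.memLp (memLp_divGrad hD hθ hf)]
  have h1 : ∀ i, (inner ℝ (toL2 (volume.restrict D) (partialDeriv i g))
      (toL2 (volume.restrict D) fun y => θ y * partialDeriv i f y) : ℝ) =
      - ∫ x in D, g x * partialDeriv i (fun y => θ y * partialDeriv i f y) x := by
    intro i
    rw [inner_toL2_toL2 (hg.partialDeriv i).memLp (memLp_mul_partialDeriv hD hθ hf i),
      setIntegral_mul_partialDeriv (hg.1.of_le (by simp)) hg.2.1 hg.2.2
        (contDiff_mul_partialDeriv hD hθ hf i), neg_neg]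
  simp_rw [h1]
  rw [Finset.sum_neg_distrib, ← integral_finsetSum]
  · simp only [divGrad, Finset.mul_sum]
  · intro i _
    refine Continuous.integrable_of_hasCompactSupport ?_ (hg.2.1.mul_right)
    exact hg.1.continuous.mul (contDiff_partialDeriv (m := 0)
      (contDiff_mul_partialDeriv hD hθ hf i) (by simp) i).continuous

/-- Moving the weight onto the smooth factor gives inner products in `L²`, which pass to limits of
the gradients `g i`. -/
lemma setIntegral_weighted_sum (hD : IsOpen D) (hθ : ContDiffOn ℝ 1 θ D) (hf : IsSmoothTest D f)
    (g : Fin d → L2 D) :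
    ∫ x in D, θ x * ∑ i, g i x * partialDeriv i f x =
      ∑ i, (inner ℝ (g i) (toL2 (volume.restrict D) fun y => θ y * partialDeriv i f y) : ℝ) := by
  simp_rw [inner_toL2_right _ (memLp_mul_partialDeriv hD hθ hf _)]
  rw [← integral_finsetSum]
  · refine integral_congr_ae (Eventually.of_forall fun x => ?_)
    simp only [Finset.mul_sum]
    refine Finset.sum_congr rfl fun i _ => by ring
  · intro i _
    exact (Lp.memLp (g i)).integrable_mul (memLp_mul_partialDeriv hD hθ hf i)

/-- Functions in `C_c^∞(D)` lie in the domain of `∇ · θ ∇`. -/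
lemma isDivGrad_toL2 (hD : IsOpen D) (hθ : ContDiffOn ℝ 1 θ D) (hf : IsSmoothTest D f) :
    MemW22 D (toL2 _ f) ∧ MemW120 D (toL2 _ f) ∧
      IsDivGrad D θ (toL2 _ f) (toL2 _ (divGrad θ f)) := by
  refine ⟨⟨fun i => toL2 _ (partialDeriv i f), hasWeakPartial_toL2 hf, fun i j =>
      ⟨_, hasWeakPartial_toL2 (hf.partialDeriv i) j⟩⟩,
    ⟨fun i => toL2 _ (partialDeriv i f), hasWeakPartial_toL2 hf, fun _ => f, fun _ => hf,
      tendsto_const_nhds, fun i => tendsto_const_nhds⟩,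
    ⟨fun i => toL2 _ (partialDeriv i f), hasWeakPartial_toL2 hf, fun φ hφ => ?_⟩⟩
  have h1 : ∫ x in D, θ x * ∑ i, (toL2 (volume.restrict D) (partialDeriv i f)) x *
      partialDeriv i φ x = ∑ i, (inner ℝ (toL2 (volume.restrict D) (partialDeriv i φ))
      (toL2 (volume.restrict D) fun y => θ y * partialDeriv i f y) : ℝ) := by
    rw [setIntegral_weighted_sum hD hθ hφ]
    refine Finset.sum_congr rfl fun i _ => ?_
    rw [inner_toL2_toL2 (hf.partialDeriv i).memLp (memLp_mul_partialDeriv hD hθ hφ i),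
      inner_toL2_toL2 (hφ.partialDeriv i).memLp (memLp_mul_partialDeriv hD hθ hf i)]
    congr 1 with x
    ring
  rw [h1, sum_inner_partialDeriv hD hθ hf hφ, real_inner_comm, inner_toL2_right _ hφ.memLp]

/-- `∇ · θ ∇` is symmetric on pairs consisting of a function in `C_c^∞(D)` and an element of the
domain. -/
lemma inner_divGrad_eq (hD : IsOpen D) (hθ : ContDiffOn ℝ 1 θ D) (hf : IsSmoothTest D f)
    {u v : L2 D} (hu : MemW120 D u) (huv : IsDivGrad D θ u v) :
    (inner ℝ (toL2 _ (divGrad θ f)) u : ℝ) = inner ℝ (toL2 _ f) v := by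
  obtain ⟨g, hg, φ, hφ, hlim, hlim'⟩ := hu
  obtain ⟨g', hg', hdiv⟩ := huv
  -- The gradient from the approximation in `W^{1,2}_0` and the one in the weak divergence must be
  -- the same for the limit below to apply.
  obtain rfl : g' = g := funext fun i => (hg' i).unique hD (hg i)
  have h1 := hdiv f hf
  rw [setIntegral_weighted_sum hD hθ hf, ← inner_toL2_right _ hf.memLp] at h1
  -- Green's formula holds for each approximant; the zero boundary values of `u` enter only through
  -- this limit.
  have h2 : Tendsto (fun n => ∑ i, (inner ℝ (toL2 (volume.restrict D) (partialDeriv i (φ n)))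
      (toL2 (volume.restrict D) fun y => θ y * partialDeriv i f y) : ℝ)) atTop
      (𝓝 (∑ i, (inner ℝ (g' i) (toL2 (volume.restrict D) fun y => θ y * partialDeriv i f y) : ℝ))) :=
    tendsto_finsetSum _ fun i _ => (hlim' i).inner tendsto_const_nhds
  have h3 : Tendsto (fun n => - (inner ℝ (toL2 (volume.restrict D) (φ n))
      (toL2 (volume.restrict D) (divGrad θ f)) : ℝ)) atTop
      (𝓝 (- inner ℝ u (toL2 (volume.restrict D) (divGrad θ f)))) :=
    (hlim.inner tendsto_const_nhds).neg
  simp_rw [sum_inner_partialDeriv hD hθ hf (hφ _)] at h2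
  have h4 := tendsto_nhds_unique h2 h3
  rw [h1, neg_inj] at h4
  rw [real_inner_comm, ← h4, real_inner_comm]

end Partial

/-! ### The heat semigroup -/

lemma IsHeatSemigroup.isC0Semigroup {d : ℕ} {D : Set (E d)} {θ : E d → ℝ}
    {S : ℝ → L2 D →L[ℝ] L2 D} (hS : IsHeatSemigroup D θ S) : IsC0Semigroup S :=
  ⟨hS.map_zero, hS.map_add, hS.continuous_zero⟩

/-! ### Test functions of time and space -/

section SpaceTime

variable {d : ℕ} {D : Set (E d)} {T : ℝ} {φ ψ : ℝ × E d → ℝ}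

lemma IsTest.add (hφ : IsTest T D φ) (hψ : IsTest T D ψ) : IsTest T D fun p => φ p + ψ p :=
  ⟨hφ.1.add hψ.1, hφ.2.1.add hψ.2.1,
    (tsupport_add φ ψ).trans (union_subset hφ.2.2 hψ.2.2)⟩

lemma IsTest.const_mul (hφ : IsTest T D φ) (c : ℝ) : IsTest T D fun p => c * φ p :=
  ⟨continuous_const.mul hφ.1, hφ.2.1.mul_left, tsupport_mul_subset_right.trans hφ.2.2⟩

lemma IsTest.sub (hφ : IsTest T D φ) (hψ : IsTest T D ψ) : IsTest T D fun p => φ p - ψ p := by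
  simpa [sub_eq_add_neg] using hφ.add (hψ.const_mul (-1))

lemma IsTest.of_support {ψ : ℝ × E d → ℝ} (hφ : IsTest T D φ) (hψ : Continuous ψ)
    (h : ∀ p, p ∉ tsupport φ → ψ p = 0) : IsTest T D ψ := by
  have hsub : tsupport ψ ⊆ tsupport φ :=
    closure_minimal (fun p hp => by by_contra hn; exact hp (h p hn)) (isClosed_tsupport φ)
  exact ⟨hψ, hφ.2.1.of_isClosed_subset (isClosed_tsupport _) hsub, hsub.trans hφ.2.2⟩

lemma hasCompactSupport_slice (hφ : HasCompactSupport φ) (t : ℝ) :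
    HasCompactSupport fun x => φ (t, x) := by
  refine HasCompactSupport.intro (hφ.image continuous_snd) fun x hx => ?_
  exact image_eq_zero_of_notMem_tsupport fun h => hx ⟨(t, x), h, rfl⟩

lemma memLp_slice (hφ : Continuous φ) (hφc : HasCompactSupport φ) (t : ℝ) :
    MemLp (fun x => φ (t, x)) 2 (volume.restrict D) :=
  (hφ.comp (Continuous.prodMk_right t)).memLp_of_hasCompactSupport (hasCompactSupport_slice hφc t)

lemma slice_add (hφ : IsTest T D φ) (hψ : IsTest T D ψ) (t : ℝ) :
    slice D (fun p => φ p + ψ p) t = slice D φ t + slice D ψ t :=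
  toL2_add (memLp_slice hφ.1 hφ.2.1 t) (memLp_slice hψ.1 hψ.2.1 t)

lemma slice_const_mul (hφ : IsTest T D φ) (c t : ℝ) :
    slice D (fun p => c * φ p) t = c • slice D φ t :=
  toL2_const_mul c (memLp_slice hφ.1 hφ.2.1 t)

lemma slice_eq_zero {t : ℝ} (h : ∀ x, φ (t, x) = 0) : slice D φ t = 0 := by
  rw [slice, funext h]
  exact toL2_zero

lemma slice_eq_zero_of_le (hφ : IsTest T D φ) {t : ℝ} (ht : T ≤ t) : slice D φ t = 0 :=
  slice_eq_zero fun _ => image_eq_zero_of_notMem_tsupport fun h =>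
    absurd (hφ.2.2 h).1 (not_lt.2 ht)

lemma uniform_bound (hφ : Continuous φ) (hφc : HasCompactSupport φ) {η : ℝ} (hη : 0 < η) :
    ∃ δ > 0, ∀ s t : ℝ, |s - t| < δ → ∀ x, |φ (s, x) - φ (t, x)| ≤ η := by
  obtain ⟨δ, hδ, h⟩ := Metric.uniformContinuous_iff.1
    (hφc.uniformContinuous_of_continuous hφ) η hη
  refine ⟨δ, hδ, fun s t hst x => ?_⟩
  have := @h (s, x) (t, x) (by rw [Prod.dist_eq, dist_self, max_eq_left dist_nonneg, Real.dist_eq]; exact hst)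
  exact this.le

lemma isFiniteMeasure_restrict (hD : Bornology.IsBounded D) :
    IsFiniteMeasure ((volume : Measure (E d)).restrict D) :=
  ⟨by rw [Measure.restrict_apply_univ]; exact hD.measure_lt_top⟩

/-- Uniform continuity controls the slices in supremum norm, and on a domain of finite volume this
controls the `L²` norm. -/
lemma continuous_slice (hD : Bornology.IsBounded D) (hφ : Continuous φ)
    (hφc : HasCompactSupport φ) : Continuous (slice D φ) := by
  have := isFiniteMeasure_restrict hD
  set c : ℝ := (measureUnivNNReal ((volume : Measure (E d)).restrict D) : ℝ) ^
    (2 : ENNReal).toReal⁻¹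
  have hc : 0 ≤ c := by positivity
  rw [Metric.continuous_iff]
  intro t η hη
  obtain ⟨δ, hδ, h⟩ := uniform_bound hφ hφc (η := η / (c + 1)) (by positivity)
  refine ⟨δ, hδ, fun s hs => ?_⟩
  rw [dist_eq_norm, slice, slice, ← toL2_sub (memLp_slice hφ hφc s) (memLp_slice hφ hφc t)]
  refine (norm_toL2_le ((memLp_slice hφ hφc s).sub (memLp_slice hφ hφc t)) (by positivity)
    (h s t hs)).trans_lt ?_
  change c * (η / (c + 1)) < η
  rw [mul_div_assoc', div_lt_iff₀ (by positivity)]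
  nlinarith

lemma hasDerivAt_timeDeriv (hφ : ContDiff ℝ 1 φ) (t : ℝ) (x : E d) :
    HasDerivAt (fun t => φ (t, x)) (fderiv ℝ φ (t, x) (1, 0)) t := by
  have h1 : HasFDerivAt φ (fderiv ℝ φ (t, x)) (t, x) :=
    (hφ.differentiable (by simp)).differentiableAt.hasFDerivAt
  have h2 : HasDerivAt (fun t : ℝ => (t, x)) ((1 : ℝ), (0 : E d)) t :=
    (hasDerivAt_id t).prodMk (hasDerivAt_const t x)
  exact h1.comp_hasDerivAt t h2

lemma timeDeriv_eq_fderiv (hφ : ContDiff ℝ 1 φ) :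
    timeDeriv φ = fun p => fderiv ℝ φ p (1, 0) :=
  funext fun p => (hasDerivAt_timeDeriv hφ p.1 p.2).deriv

lemma continuous_timeDeriv (hφ : ContDiff ℝ 1 φ) : Continuous (timeDeriv φ) := by
  rw [timeDeriv_eq_fderiv hφ]
  exact (hφ.continuous_fderiv (by simp)).clm_apply continuous_const

lemma timeDeriv_eq_zero (p : ℝ × E d) (hp : p ∉ tsupport φ) : timeDeriv φ p = 0 := by
  have h := notMem_tsupport_iff_eventuallyEq.1 hp
  have h2 : Tendsto (fun t => (t, p.2)) (𝓝 p.1) (𝓝 p) :=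
    (Continuous.prodMk_left p.2).tendsto p.1
  have h3 : (fun t => φ (t, p.2)) =ᶠ[𝓝 p.1] fun _ => 0 := h2.eventually h
  rw [timeDeriv, h3.deriv_eq, deriv_const]

lemma hasCompactSupport_timeDeriv (hφ : HasCompactSupport φ) : HasCompactSupport (timeDeriv φ) :=
  HasCompactSupport.intro hφ fun p hp => timeDeriv_eq_zero p hp

/-- The mean value inequality for `φ (r, x) - r ∂_t φ (t, x)` bounds the Taylor remainder uniformly
in `x`, by uniform continuity of the time derivative; finite volume gives the `L²` bound. -/
lemma hasDerivAt_slice (hD : Bornology.IsBounded D) (hφ : ContDiff ℝ 1 φ)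
    (hφc : HasCompactSupport φ) (t : ℝ) :
    HasDerivAt (slice D φ) (slice D (timeDeriv φ) t) t := by
  have := isFiniteMeasure_restrict hD
  set c : ℝ := (measureUnivNNReal ((volume : Measure (E d)).restrict D) : ℝ) ^
    (2 : ENNReal).toReal⁻¹
  have hc : 0 ≤ c := by positivity
  have hφ' := continuous_timeDeriv hφ
  have hφc' := hasCompactSupport_timeDeriv hφc
  rw [hasDerivAt_iff_isLittleO, isLittleO_iff]
  intro η hη
  obtain ⟨δ, hδ, h⟩ := uniform_bound hφ' hφc' (η := η / (c + 1)) (by positivity)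
  filter_upwards [Metric.ball_mem_nhds t hδ] with s hs
  have hml : MemLp (fun x => φ (s, x) - φ (t, x)) 2 (volume.restrict D) :=
    (memLp_slice hφ.continuous hφc s).sub (memLp_slice hφ.continuous hφc t)
  have e : slice D φ s - slice D φ t - (s - t) • slice D (timeDeriv φ) t =
      toL2 (volume.restrict D)
        (fun x => (φ (s, x) - φ (t, x)) - (s - t) * timeDeriv φ (t, x)) := by
    rw [toL2_sub hml ((memLp_slice hφ' hφc' t).const_mul (s - t)),
      toL2_const_mul _ (memLp_slice hφ' hφc' t),
      toL2_sub (memLp_slice hφ.continuous hφc s) (memLp_slice hφ.continuous hφc t)]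
    rfl
  rw [e]
  have hb : ∀ x, |(φ (s, x) - φ (t, x)) - (s - t) * timeDeriv φ (t, x)| ≤
      η / (c + 1) * |s - t| := by
    intro x
    have h1 : ∀ r ∈ Metric.ball t δ, HasDerivWithinAt
        (fun r => φ (r, x) - r * timeDeriv φ (t, x))
        (timeDeriv φ (r, x) - timeDeriv φ (t, x)) (Metric.ball t δ) r := by
      intro r _
      have h2 := (hasDerivAt_timeDeriv hφ r x).sub
        ((hasDerivAt_id r).mul_const (timeDeriv φ (t, x)))
      rw [one_mul] at h2
      rw [timeDeriv_eq_fderiv hφ] at h2 ⊢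
      exact h2.hasDerivWithinAt
    have h3 := Convex.norm_image_sub_le_of_norm_hasDerivWithin_le h1
      (fun r hr => h r t hr x) (convex_ball t δ) (Metric.mem_ball_self hδ) hs
    rw [Real.norm_eq_abs, Real.norm_eq_abs] at h3
    refine le_trans (le_of_eq ?_) h3
    congr 1; ring
  refine (norm_toL2_le (hml.sub ((memLp_slice hφ' hφc' t).const_mul (s - t))) (by positivity)
    hb).trans ?_
  change c * (η / (c + 1) * |s - t|) ≤ η * ‖s - t‖
  rw [Real.norm_eq_abs, ← mul_assoc]
  gcongr
  rw [mul_div_assoc', div_le_iff₀ (by positivity)]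
  nlinarith

/-- `φ ∈ C_c^∞((0,T) × D)`. -/
structure IsSmoothSpaceTimeTest (T : ℝ) (D : Set (E d)) (φ : ℝ × E d → ℝ) : Prop where
  contDiff : ContDiff ℝ ((⊤ : ℕ∞) : WithTop ℕ∞) φ
  hasCompactSupport : HasCompactSupport φ
  tsupport_subset : tsupport φ ⊆ Ioo 0 T ×ˢ D

namespace IsSmoothSpaceTimeTest

lemma contDiff_one (hφ : IsSmoothSpaceTimeTest T D φ) : ContDiff ℝ 1 φ := hφ.contDiff.of_le (by simp)

lemma isTest (hφ : IsSmoothSpaceTimeTest T D φ) : IsTest T D φ :=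
  ⟨hφ.contDiff.continuous, hφ.hasCompactSupport,
    hφ.tsupport_subset.trans (prod_mono Ioo_subset_Iio_self subset_rfl)⟩

lemma isTest_timeDeriv (hφ : IsSmoothSpaceTimeTest T D φ) : IsTest T D (timeDeriv φ) :=
  hφ.isTest.of_support (continuous_timeDeriv hφ.contDiff_one) timeDeriv_eq_zero

lemma isSmoothTest_slice (hφ : IsSmoothSpaceTimeTest T D φ) (t : ℝ) :
    IsSmoothTest D fun y => φ (t, y) := by
  refine ⟨hφ.contDiff.comp (contDiff_prodMk_right t), hasCompactSupport_slice hφ.hasCompactSupport t,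
    fun x hx => ?_⟩
  exact (hφ.tsupport_subset (tsupport_comp_subset_preimage φ (Continuous.prodMk_right t) hx)).2

end IsSmoothSpaceTimeTest

lemma spaceDivGrad_eq_zero (θ : E d → ℝ) (p : ℝ × E d) (hp : p ∉ tsupport φ) :
    spaceDivGrad θ φ p = 0 :=
  divGrad_eq_zero_of_notMem fun h =>
    hp (tsupport_comp_subset_preimage φ (Continuous.prodMk_right p.1) h)

lemma partialDeriv_slice (hφ : ContDiff ℝ 1 φ) (i : Fin d) (t : ℝ) (x : E d) :
    partialDeriv i (fun y => φ (t, y)) x = fderiv ℝ φ (t, x) (0, EuclideanSpace.single i 1) := by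
  have h1 : HasFDerivAt φ (fderiv ℝ φ (t, x)) (t, x) :=
    (hφ.differentiable (by simp)).differentiableAt.hasFDerivAt
  have h2 : HasFDerivAt (fun y : E d => (t, y)) (ContinuousLinearMap.inr ℝ ℝ (E d)) x :=
    hasFDerivAt_prodMk_right t x
  have h3 := (h1.comp x h2).fderiv
  simp only [Function.comp_def] at h3
  rw [partialDeriv, h3]
  simp

lemma partialDeriv_mul {θ g : E d → ℝ} {x : E d} (hθ : DifferentiableAt ℝ θ x)
    (hg : DifferentiableAt ℝ g x) (i : Fin d) :
    partialDeriv i (fun y => θ y * g y) x = partialDeriv i θ x * g x + θ x * partialDeriv i g x := by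
  have h := fderiv_mul hθ hg
  rw [partialDeriv, show (fun y => θ y * g y) = θ * g from rfl, h]
  simp [partialDeriv]
  ring

/-- Joint continuity in time and space matters only on the support, which lies over `D`. There the
product rule expresses the operator through `θ`, its gradient and space-time derivatives of `φ`. -/
lemma continuous_spaceDivGrad (hD : IsOpen D) {θ : E d → ℝ} (hθ : ContDiffOn ℝ 1 θ D)
    (hφ : IsSmoothSpaceTimeTest T D φ) : Continuous (spaceDivGrad θ φ) := by
  set ψ : Fin d → ℝ × E d → ℝ := fun i p => fderiv ℝ φ p (0, EuclideanSpace.single i 1) with hψdef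
  have hψ : ∀ i, ContDiff ℝ ((⊤ : ℕ∞) : WithTop ℕ∞) (ψ i) := fun i =>
    (hφ.contDiff.fderiv_right (by simp)).clm_apply contDiff_const
  refine continuous_of_tsupport fun p hp => ?_
  have hp' : p.2 ∈ D := (hφ.tsupport_subset (closure_minimal (fun q hq => by
    by_contra hn; exact hq (spaceDivGrad_eq_zero θ q hn)) (isClosed_tsupport φ) hp)).2
  have hU : ∀ᶠ q : ℝ × E d in 𝓝 p, q.2 ∈ D :=
    (continuous_snd.tendsto p).eventually (hD.mem_nhds hp')
  have hform : spaceDivGrad θ φ =ᶠ[𝓝 p] fun q => ∑ i, (partialDeriv i θ q.2 * ψ i q +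
      θ q.2 * fderiv ℝ (ψ i) q (0, EuclideanSpace.single i 1)) := by
    filter_upwards [hU] with q hq
    refine Finset.sum_congr rfl fun i _ => ?_
    have e : (fun y => θ y * partialDeriv i (fun z => φ (q.1, z)) y) =
        fun y => θ y * ψ i (q.1, y) :=
      funext fun y => by rw [partialDeriv_slice hφ.contDiff_one]
    have hdiff : DifferentiableAt ℝ (fun y => ψ i (q.1, y)) q.2 :=
      (((hψ i).comp (contDiff_prodMk_right q.1)).differentiable (by simp)).differentiableAt
    rw [e, partialDeriv_mul ((hθ.contDiffAt (hD.mem_nhds hq)).differentiableAt (by simp)) hdiff,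
      partialDeriv_slice ((hψ i).of_le (by simp))]
  refine ContinuousAt.congr ?_ hform.symm
  refine tendsto_finsetSum _ fun i _ => ?_
  have h1 : ContinuousAt (fun q : ℝ × E d => partialDeriv i θ q.2) p := by
    have : ContinuousAt (partialDeriv i θ) p.2 :=
      (((hθ.contDiffAt (hD.mem_nhds hp')).fderiv_right (m := 0) (by simp)).continuousAt).clm_apply
        continuousAt_const
    exact this.comp continuousAt_snd
  have h2 : ContinuousAt (fun q : ℝ × E d => θ q.2) p :=
    (hθ.continuousOn.continuousAt (hD.mem_nhds hp')).comp continuousAt_snd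
  have h3 : Continuous fun q => fderiv ℝ (ψ i) q (0, EuclideanSpace.single i 1) :=
    ((hψ i).continuous_fderiv (by simp)).clm_apply continuous_const
  exact (h1.mul (hψ i).continuous.continuousAt).add (h2.mul h3.continuousAt)

/-- Makes the Laplacian the special case of constant diffusivity, so that support and continuity
results need be proved only once. -/
lemma laplacian_eq_divGrad {f : E d → ℝ} (hf : ContDiff ℝ 2 f) :
    Laplacian.laplacian f = divGrad (fun _ => 1) f := by
  rw [InnerProductSpace.laplacian_eq_iteratedFDeriv_orthonormalBasis f
    (EuclideanSpace.basisFun (Fin d) ℝ)]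
  funext x
  refine Finset.sum_congr rfl fun i _ => ?_
  simp only [one_mul, iteratedFDeriv_two_apply, EuclideanSpace.basisFun_apply]
  have h : DifferentiableAt ℝ (fderiv ℝ f) x :=
    ((hf.fderiv_right (m := 1) (by norm_num)).differentiable (by simp)).differentiableAt
  have h2 := (h.hasFDerivAt.clm_apply
    (hasFDerivAt_const (EuclideanSpace.single i (1 : ℝ)) x)).fderiv
  change _ = fderiv ℝ (fun y => fderiv ℝ f y (EuclideanSpace.single i 1)) x _
  rw [h2]
  simp

namespace IsSmoothSpaceTimeTest

lemma spaceLap_eq (hφ : IsSmoothSpaceTimeTest T D φ) :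
    spaceLap φ = spaceDivGrad (fun _ => 1) φ := by
  funext p
  exact congrFun (laplacian_eq_divGrad ((hφ.isSmoothTest_slice p.1).1.of_le
    (WithTop.coe_le_coe.2 (le_top : (2 : ℕ∞) ≤ ⊤)))) p.2

lemma isTest_spaceDivGrad (hφ : IsSmoothSpaceTimeTest T D φ) (hD : IsOpen D) {θ : E d → ℝ}
    (hθ : ContDiffOn ℝ 1 θ D) : IsTest T D (spaceDivGrad θ φ) :=
  hφ.isTest.of_support (continuous_spaceDivGrad hD hθ hφ) (spaceDivGrad_eq_zero θ)

lemma isTest_spaceLap (hφ : IsSmoothSpaceTimeTest T D φ) (hD : IsOpen D) :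
    IsTest T D (spaceLap φ) := by
  rw [hφ.spaceLap_eq]
  exact hφ.isTest_spaceDivGrad hD contDiffOn_const

lemma slice_of_notMem (hφ : IsSmoothSpaceTimeTest T D φ) {ψ : ℝ × E d → ℝ}
    (h : ∀ p, p ∉ tsupport φ → ψ p = 0) {t : ℝ} (ht : t ∉ Ioo 0 T) : slice D ψ t = 0 :=
  slice_eq_zero fun _ => h _ fun hx => ht (hφ.tsupport_subset hx).1

lemma generates (hφ : IsSmoothSpaceTimeTest T D φ) (hD : IsOpen D) {θ : E d → ℝ}
    (hθ : ContDiffOn ℝ 1 θ D) {S : ℝ → L2 D →L[ℝ] L2 D} (hS : IsHeatSemigroup D θ S) (t : ℝ) :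
    Generates S (slice D φ t) (slice D (spaceDivGrad θ φ) t) :=
  (hS.generator _ _).2 (isDivGrad_toL2 hD hθ (hφ.isSmoothTest_slice t))

lemma isAdjointPath (hφ : IsSmoothSpaceTimeTest T D φ) (hD : IsOpen D)
    (hDb : Bornology.IsBounded D) {θ : E d → ℝ} (hθ : ContDiffOn ℝ 1 θ D)
    {S : ℝ → L2 D →L[ℝ] L2 D} (hS : IsHeatSemigroup D θ S) :
    IsAdjointPath S T (slice D φ) (slice D (timeDeriv φ)) (slice D (spaceDivGrad θ φ)) where
  hasDerivAt := hasDerivAt_slice hDb hφ.contDiff_one hφ.hasCompactSupport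
  continuous_deriv := continuous_slice hDb hφ.isTest_timeDeriv.1 hφ.isTest_timeDeriv.2.1
  continuous_adjoint := continuous_slice hDb (hφ.isTest_spaceDivGrad hD hθ).1
    (hφ.isTest_spaceDivGrad hD hθ).2.1
  eq_zero _ ht := hφ.slice_of_notMem (fun _ => image_eq_zero_of_notMem_tsupport) ht
  adjoint_eq_zero _ ht := hφ.slice_of_notMem (spaceDivGrad_eq_zero θ) ht
  adjoint t u g hug := by
    obtain ⟨_, h1, h2⟩ := (hS.generator u g).1 hug
    exact inner_divGrad_eq hD hθ (hφ.isSmoothTest_slice t) h1 h2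

end IsSmoothSpaceTimeTest

end SpaceTime

/-! ### Gaussian processes -/

section Gaussian

variable {Ω : Type*} [MeasurableSpace Ω] {P : Measure Ω}

lemma holderTriple_four_four_two : ENNReal.HolderTriple 4 4 2 where
  inv_add_inv_eq_inv := by
    rw [← two_mul, show (4 : ENNReal) = 2 * 2 by norm_num,
      ENNReal.mul_inv (by simp) (by simp), ← mul_assoc, ENNReal.mul_inv_cancel (by simp) (by simp),
      one_mul]

/-- Gaussian variables have fourth moments, so Hölder with exponents 4 and 4 applies. -/
lemma memLp_mul_of_hasGaussianLaw {A B : Ω → ℝ} (hA : HasGaussianLaw A P)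
    (hB : HasGaussianLaw B P) : MemLp (fun ω => A ω * B ω) 2 P :=
  have := holderTriple_four_four_two
  (hB.memLp (p := 4) (by simp)).mul (hA.memLp (p := 4) (by simp))

/-- An equality of random variables follows from the corresponding identities for means and
covariances. -/
lemma ae_eq_add_mul_of_cov [IsProbabilityMeasure P] {A B C : Ω → ℝ} {c : ℝ} (hA : MemLp A 2 P)
    (hB : MemLp B 2 P) (hC : MemLp C 2 P) (hmean : ∫ ω, A ω ∂P = ∫ ω, B ω ∂P + c * ∫ ω, C ω ∂P)
    (h1 : cov[A, A; P] = cov[A, B; P] + c * cov[A, C; P])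
    (h2 : cov[B, A; P] = cov[B, B; P] + c * cov[B, C; P])
    (h3 : cov[C, A; P] = cov[C, B; P] + c * cov[C, C; P]) :
    A =ᵐ[P] fun ω => B ω + c * C ω := by
  have hcC : MemLp (c • C) 2 P := hC.const_smul c
  -- The residual is uncorrelated with `A`, `B` and `C`, hence with itself, so it equals its mean,
  -- which is zero.
  set R : Ω → ℝ := A - (B + c • C) with hR
  have hRm : MemLp R 2 P := hA.sub (hB.add hcC)
  have hZ : ∀ Z : Ω → ℝ, MemLp Z 2 P → cov[Z, A; P] = cov[Z, B; P] + c * cov[Z, C; P] →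
      cov[Z, R; P] = 0 := by
    intro Z hZm hZ
    rw [hR, covariance_sub_right hZm hA (hB.add hcC), covariance_add_right hZm hB hcC,
      covariance_smul_right, hZ, sub_self]
  have hvar : Var[R; P] = 0 := by
    rw [← covariance_self hRm.aestronglyMeasurable.aemeasurable]
    nth_rw 1 [hR]
    rw [covariance_sub_left hA (hB.add hcC) hRm, covariance_add_left hB hcC hRm,
      covariance_smul_left, hZ A hA h1, hZ B hB h2, hZ C hC h3]
    simp
  have hmeanR : ∫ ω, R ω ∂P = 0 := by
    rw [hR, integral_sub' (hA.integrable (by simp)) ((hB.add hcC).integrable (by simp)),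
      integral_add' (hB.integrable (by simp)) (hcC.integrable (by simp)), hmean]
    simp only [Pi.smul_apply, smul_eq_mul, integral_const_mul, sub_self]
  filter_upwards [ae_eq_integral_of_variance_eq_zero hRm hvar] with ω hω
  rw [hmeanR] at hω
  simp only [hR, Pi.sub_apply, Pi.add_apply, Pi.smul_apply, smul_eq_mul] at hω
  linarith

variable {τ : Type*} {Z : τ → Ω → ℝ}

/-- For jointly Gaussian variables zero covariance is independence. This replaces the martingale
property: conditioning on the past is never needed. -/
lemma indepFun_of_cov_eq_zero (hZ : IsGaussianProcess Z P) {n : ℕ} {j : τ} (a : Fin n → τ)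
    (h : ∀ i, cov[Z j, Z (a i); P] = 0) :
    IndepFun (Z j) (fun ω i => Z (a i) ω) P := by
  have h1 : IsGaussianProcess (Sum.elim (fun _ : Unit => Z j) fun i => Z (a i)) P := by
    have e : (Sum.elim (fun _ : Unit => Z j) fun i => Z (a i)) =
        Z ∘ Sum.elim (fun _ : Unit => j) a := by
      funext x; cases x <;> rfl
    rw [e]
    exact hZ.comp_right _
  have h2 := h1.indepFun_of_covariance_eq_zero (fun _ => hZ.aemeasurable j)
    (fun i => hZ.aemeasurable (a i)) (fun _ i => h i)
  exact h2.comp (φ := fun f : Unit → ℝ => f ()) (ψ := fun f : Fin n → ℝ => f)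
    (measurable_pi_apply ()) measurable_id

lemma integral_mul_mul_mul_eq_zero (hZ : IsGaussianProcess Z P) {j a b c : τ}
    (hj : ∫ ω, Z j ω ∂P = 0) (ha : cov[Z j, Z a; P] = 0) (hb : cov[Z j, Z b; P] = 0)
    (hc : cov[Z j, Z c; P] = 0) : ∫ ω, Z j ω * (Z a ω * Z b ω * Z c ω) ∂P = 0 := by
  have h1 := indepFun_of_cov_eq_zero hZ ![a, b, c] (j := j) (by
    intro i; fin_cases i <;> simp [ha, hb, hc])
  have h2 : IndepFun (Z j) (fun ω => Z a ω * Z b ω * Z c ω) P :=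
    h1.comp (φ := id) (ψ := fun f : Fin 3 → ℝ => f 0 * f 1 * f 2) measurable_id (by fun_prop)
  have h3 := h2.integral_mul_eq_mul_integral (hZ.aemeasurable j).aestronglyMeasurable
    (((hZ.aemeasurable a).mul (hZ.aemeasurable b)).mul (hZ.aemeasurable c)).aestronglyMeasurable
  rw [hj, zero_mul] at h3
  exact h3

lemma integral_sq_mul_sq (hZ : IsGaussianProcess Z P) {j a : τ}
    (ha : cov[Z j, Z a; P] = 0) :
    ∫ ω, (Z a ω * Z j ω) ^ 2 ∂P = (∫ ω, Z j ω ^ 2 ∂P) * ∫ ω, Z a ω ^ 2 ∂P := by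
  have h1 := indepFun_of_cov_eq_zero hZ ![a] (j := j) (by
    intro i; fin_cases i; simp [ha])
  have h2 : IndepFun (fun ω => Z j ω ^ 2) (fun ω => Z a ω ^ 2) P :=
    h1.comp (φ := fun x : ℝ => x ^ 2) (ψ := fun f : Fin 1 → ℝ => f 0 ^ 2) (by fun_prop)
      (by fun_prop)
  have h3 := h2.integral_mul_eq_mul_integral
    ((hZ.aemeasurable j).pow_const 2).aestronglyMeasurable
    ((hZ.aemeasurable a).pow_const 2).aestronglyMeasurable
  rw [← h3]
  refine integral_congr_ae (Eventually.of_forall fun ω => ?_)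
  simp only [Pi.mul_apply]
  ring

/-- Second moment of a sum of products of Gaussian variables, in which the second factors are
centered, mutually uncorrelated, and uncorrelated with the past. -/
lemma integral_sq_sum_of_cov_eq_zero (hZ : IsGaussianProcess Z P) {ι : Type*} (I : Finset ι)
    (a b : ι → τ) (w : ι → ℝ) (v : ℝ) (hmean : ∀ i ∈ I, ∫ ω, Z (b i) ω ∂P = 0)
    (hvar : ∀ i ∈ I, cov[Z (b i), Z (b i); P] = v) (hab : ∀ i ∈ I, cov[Z (b i), Z (a i); P] = 0)
    (hbb : ∀ i ∈ I, ∀ j ∈ I, i ≠ j → cov[Z (b i), Z (b j); P] = 0)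
    (hba : ∀ i ∈ I, ∀ j ∈ I, i ≠ j →
      cov[Z (b i), Z (a j); P] = 0 ∨ cov[Z (b j), Z (a i); P] = 0) :
    ∫ ω, (∑ i ∈ I, w i * Z (a i) ω * Z (b i) ω) ^ 2 ∂P =
      v * ∑ i ∈ I, w i ^ 2 * ∫ ω, Z (a i) ω ^ 2 ∂P := by
  have hP := hZ.isProbabilityMeasure
  have hG := fun t => hZ.hasGaussianLaw_eval t
  have hL : ∀ i, MemLp (fun ω => w i * Z (a i) ω * Z (b i) ω) 2 P := by
    intro i
    simp_rw [mul_assoc]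
    exact (memLp_mul_of_hasGaussianLaw (hG (a i)) (hG (b i))).const_mul (w i)
  have hint : ∀ i j, Integrable (fun ω => (w i * Z (a i) ω * Z (b i) ω) *
      (w j * Z (a j) ω * Z (b j) ω)) P := fun i j => (hL i).integrable_mul (hL j)
  simp_rw [pow_two (∑ i ∈ I, _), Finset.sum_mul_sum]
  rw [integral_finsetSum _ fun i _ => integrable_finsetSum _ fun j _ => hint i j, Finset.mul_sum]
  refine Finset.sum_congr rfl fun i hi => ?_
  rw [integral_finsetSum _ fun j _ => hint i j, Finset.sum_eq_single_of_mem i hi]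
  · have h1 : ∫ ω, Z (b i) ω ^ 2 ∂P = v := by
      have h2 := covariance_eq_sub (hG (b i)).memLp_two (hG (b i)).memLp_two
      rw [hvar i hi, hmean i hi, zero_mul, sub_zero] at h2
      rw [h2]
      simp only [Pi.mul_apply, pow_two]
    have h3 : ∀ ω, (w i * Z (a i) ω * Z (b i) ω) * (w i * Z (a i) ω * Z (b i) ω) =
        w i ^ 2 * (Z (a i) ω * Z (b i) ω) ^ 2 := fun ω => by ring
    simp_rw [h3]
    rw [integral_const_mul, integral_sq_mul_sq hZ (hab i hi), h1]
    ring
  -- Off the diagonal, one of the two noise factors is uncorrelated with the other three factors;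
  -- being centered and independent of them, it annihilates the expectation.
  · intro j hj hji
    rcases hba i hi j hj hji.symm with h | h
    · have h3 : ∀ ω, (w i * Z (a i) ω * Z (b i) ω) * (w j * Z (a j) ω * Z (b j) ω) =
          w i * w j * (Z (b i) ω * (Z (a i) ω * Z (a j) ω * Z (b j) ω)) := fun ω => by ring
      simp_rw [h3]
      rw [integral_const_mul, integral_mul_mul_mul_eq_zero hZ (hmean i hi) (hab i hi) h
        (hbb i hi j hj hji.symm), mul_zero]
    · have h3 : ∀ ω, (w i * Z (a i) ω * Z (b i) ω) * (w j * Z (a j) ω * Z (b j) ω) =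
          w i * w j * (Z (b j) ω * (Z (a j) ω * Z (a i) ω * Z (b i) ω)) := fun ω => by ring
      simp_rw [h3]
      rw [integral_const_mul, integral_mul_mul_mul_eq_zero hZ (hmean j hj) (hab j hj) h
        (hbb j hj i hi hji), mul_zero]

/-- A linear combination of independent Gaussian processes is a Gaussian process. -/
lemma isGaussianProcess_add_mul {τ' : Type*} {X : τ → Ω → ℝ} {V : τ' → Ω → ℝ}
    (hX : IsGaussianProcess X P) (hV : IsGaussianProcess V P)
    (hXV : IndepFun (fun ω φ => X φ ω) (fun ω f => V f ω) P) (ε : ℝ) :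
    IsGaussianProcess (fun (p : τ × τ') ω => X p.1 ω + ε * V p.2 ω) P where
  hasGaussianLaw I := by
    classical
    -- Finitely many indices involve finite subvectors of `X` and `V`; these are independent
    -- Gaussian vectors, hence jointly Gaussian, and `L` recombines them.
    set A := I.image Prod.fst
    set B := I.image Prod.snd
    have h1 : IndepFun (fun ω => A.restrict (X · ω)) (fun ω => B.restrict (V · ω)) P :=
      hXV.comp (φ := A.restrict) (ψ := B.restrict) (Finset.measurable_restrict A)
        (Finset.measurable_restrict B)
    have h2 := h1.hasGaussianLaw (hX.hasGaussianLaw A) (hV.hasGaussianLaw B)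
    let L : (A → ℝ) × (B → ℝ) →L[ℝ] (I → ℝ) := ContinuousLinearMap.pi fun i =>
      (ContinuousLinearMap.proj (R := ℝ) (φ := fun _ : A => ℝ)
          ⟨i.1.1, Finset.mem_image_of_mem _ i.2⟩).comp (ContinuousLinearMap.fst ℝ _ _) +
        ε • (ContinuousLinearMap.proj (R := ℝ) (φ := fun _ : B => ℝ)
          ⟨i.1.2, Finset.mem_image_of_mem _ i.2⟩).comp (ContinuousLinearMap.snd ℝ _ _)
    exact h2.map_fun L

end Gaussian

/-! ### Linearity of the covariance form -/

namespace IsC0Semigroup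

variable {H : Type*} [NormedAddCommGroup H] [InnerProductSpace ℝ H]
  {S : ℝ → H →L[ℝ] H} {T : ℝ} {ψ p p₁ p₂ : ℝ → H}

/-- Compact intervals and the frozen semigroup make every layer of the integral continuous, hence
integrable. -/
lemma integral_integral_integral_eq (hT : 0 ≤ T)
    (hψ : ∀ t, T < t → ψ t = 0) (hp : ∀ t, T < t → p t = 0) :
    ∫ t in Ioi (0 : ℝ), ∫ s in Ioi (0 : ℝ), ∫ r in |t - s|..(t + s),
      (inner ℝ (ψ t) (S r (p s)) : ℝ) =
    ∫ t in (0 : ℝ)..T, ∫ s in (0 : ℝ)..T, ∫ r in |t - s|..(t + s),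
      (inner ℝ (ψ t) (S (max r 0) (p s)) : ℝ) := by
  rw [setIntegral_Ioi_eq_intervalIntegral hT fun t ht => by simp [hψ t ht]]
  refine intervalIntegral.integral_congr fun t ht => ?_
  rw [uIcc_of_le hT] at ht
  rw [setIntegral_Ioi_eq_intervalIntegral hT fun s hs => by simp [hp s hs]]
  refine intervalIntegral.integral_congr fun s hs => ?_
  rw [uIcc_of_le hT] at hs
  refine intervalIntegral.integral_congr fun r hr => ?_
  rw [uIcc_of_le (abs_le.2 ⟨by linarith [ht.1], by linarith [hs.1]⟩)] at hr
  simp only [max_eq_left ((abs_nonneg _).trans hr.1)]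

variable [CompleteSpace H]

lemma continuous_integral_window (hS : IsC0Semigroup S) (hψ : Continuous ψ) (hp : Continuous p) :
    Continuous fun z : ℝ × ℝ =>
      ∫ r in |z.1 - z.2|..(z.1 + z.2), (inner ℝ (ψ z.1) (S (max r 0) (p z.2)) : ℝ) := by
  have hF : Continuous (Function.uncurry fun (z : ℝ × ℝ) (r : ℝ) =>
      (inner ℝ (ψ z.1) (S (max r 0) (p z.2)) : ℝ)) :=
    (hψ.comp (continuous_fst.comp continuous_fst)).inner
      (hS.continuous_comp continuous_snd (hp.comp (continuous_snd.comp continuous_fst)))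
  have hi : ∀ z : ℝ × ℝ, ∀ a b, IntervalIntegrable
      (fun r => (inner ℝ (ψ z.1) (S (max r 0) (p z.2)) : ℝ)) volume a b := fun z a b =>
    (continuous_const.inner (hS.continuous_orbit _)).intervalIntegrable _ _
  -- Only the upper limit may vary in the continuity theorem, so the window is a difference of two
  -- integrals from zero.
  have h : ∀ z : ℝ × ℝ,
      ∫ r in |z.1 - z.2|..(z.1 + z.2), (inner ℝ (ψ z.1) (S (max r 0) (p z.2)) : ℝ) =
      (∫ r in (0 : ℝ)..(z.1 + z.2), (inner ℝ (ψ z.1) (S (max r 0) (p z.2)) : ℝ)) -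
        ∫ r in (0 : ℝ)..|z.1 - z.2|, (inner ℝ (ψ z.1) (S (max r 0) (p z.2)) : ℝ) := fun z =>
    (intervalIntegral.integral_interval_sub_left (hi z _ _) (hi z _ _)).symm
  simp_rw [h]
  exact (intervalIntegral.continuous_parametric_intervalIntegral_of_continuous hF
      (by fun_prop)).sub
    (intervalIntegral.continuous_parametric_intervalIntegral_of_continuous hF (by fun_prop))

lemma integral_integral_integral_add_mul (hS : IsC0Semigroup S) (hT : 0 ≤ T)
    (hψ : Continuous ψ) (h₁ : Continuous p₁) (h₂ : Continuous p₂)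
    (hψT : ∀ t, T < t → ψ t = 0) (h₁T : ∀ t, T < t → p₁ t = 0) (h₂T : ∀ t, T < t → p₂ t = 0)
    (c : ℝ) :
    ∫ t in Ioi (0 : ℝ), ∫ s in Ioi (0 : ℝ), ∫ r in |t - s|..(t + s),
      (inner ℝ (ψ t) (S r (p₁ s + c • p₂ s)) : ℝ) =
    (∫ t in Ioi (0 : ℝ), ∫ s in Ioi (0 : ℝ), ∫ r in |t - s|..(t + s),
      (inner ℝ (ψ t) (S r (p₁ s)) : ℝ)) +
    c * ∫ t in Ioi (0 : ℝ), ∫ s in Ioi (0 : ℝ), ∫ r in |t - s|..(t + s),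
      (inner ℝ (ψ t) (S r (p₂ s)) : ℝ) := by
  rw [integral_integral_integral_eq hT hψT h₁T, integral_integral_integral_eq hT hψT h₂T,
    integral_integral_integral_eq (p := fun s => p₁ s + c • p₂ s) hT hψT
      fun t ht => by simp [h₁T t ht, h₂T t ht]]
  have hc₁ := hS.continuous_integral_window hψ h₁
  have hc₂ := hS.continuous_integral_window hψ h₂
  have e : ∀ t s, ∫ r in |t - s|..(t + s), (inner ℝ (ψ t) (S (max r 0) (p₁ s + c • p₂ s)) : ℝ) =
      (∫ r in |t - s|..(t + s), (inner ℝ (ψ t) (S (max r 0) (p₁ s)) : ℝ)) +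
      c * ∫ r in |t - s|..(t + s), (inner ℝ (ψ t) (S (max r 0) (p₂ s)) : ℝ) := by
    intro t s
    simp only [_root_.map_add, map_smul, inner_add_right, real_inner_smul_right]
    rw [intervalIntegral.integral_add
      ((continuous_const.inner (hS.continuous_orbit _)).intervalIntegrable _ _)
      (((continuous_const.inner (hS.continuous_orbit _)).const_mul c).intervalIntegrable _ _),
      intervalIntegral.integral_const_mul]
  simp_rw [e]
  have hs : ∀ t, ∫ s in (0 : ℝ)..T,
      ((∫ r in |t - s|..(t + s), (inner ℝ (ψ t) (S (max r 0) (p₁ s)) : ℝ)) +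
      c * ∫ r in |t - s|..(t + s), (inner ℝ (ψ t) (S (max r 0) (p₂ s)) : ℝ)) =
      (∫ s in (0 : ℝ)..T, ∫ r in |t - s|..(t + s), (inner ℝ (ψ t) (S (max r 0) (p₁ s)) : ℝ)) +
      c * ∫ s in (0 : ℝ)..T, ∫ r in |t - s|..(t + s),
        (inner ℝ (ψ t) (S (max r 0) (p₂ s)) : ℝ) := by
    intro t
    have k₁ : Continuous fun s => ∫ r in |t - s|..(t + s),
        (inner ℝ (ψ t) (S (max r 0) (p₁ s)) : ℝ) := hc₁.comp (Continuous.prodMk_right t)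
    have k₂ : Continuous fun s => ∫ r in |t - s|..(t + s),
        (inner ℝ (ψ t) (S (max r 0) (p₂ s)) : ℝ) := hc₂.comp (Continuous.prodMk_right t)
    rw [intervalIntegral.integral_add (k₁.intervalIntegrable _ _)
      ((k₂.const_mul c).intervalIntegrable _ _),
      intervalIntegral.integral_const_mul]
  simp_rw [hs]
  have hd₁ := intervalIntegral.continuous_parametric_intervalIntegral_of_continuous'
    (μ := volume) (f := fun t s => ∫ r in |t - s|..(t + s),
      (inner ℝ (ψ t) (S (max r 0) (p₁ s)) : ℝ)) hc₁ 0 T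
  have hd₂ := intervalIntegral.continuous_parametric_intervalIntegral_of_continuous'
    (μ := volume) (f := fun t s => ∫ r in |t - s|..(t + s),
      (inner ℝ (ψ t) (S (max r 0) (p₂ s)) : ℝ)) hc₂ 0 T
  rw [intervalIntegral.integral_add (hd₁.intervalIntegrable _ _)
    ((hd₂.const_mul c).intervalIntegrable _ _), intervalIntegral.integral_const_mul]

end IsC0Semigroup

/-! ### The signal process -/

section Signal

lemma HeatModel.pairX_of_isTest {d : ℕ} {m : HeatModel d} {Ω : Type*}
    (X : Test m.T m.D → Ω → ℝ) {φ : ℝ × E d → ℝ}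
    (hφ : IsTest m.T m.D φ) : m.pairX X φ = X ⟨φ, hφ⟩ := by
  funext ω
  exact dif_pos hφ

variable {d : ℕ} {m : HeatModel d} {S : ℝ → L2 m.D →L[ℝ] L2 m.D} {Ω : Type*} [MeasurableSpace Ω]
  {P : Measure Ω} {X : Test m.T m.D → Ω → ℝ}

lemma IsTest.slice_eq_zero {T : ℝ} {D : Set (E d)} {φ : ℝ × E d → ℝ} (hφ : IsTest T D φ) (t : ℝ)
    (ht : T < t) : slice D φ t = 0 := slice_eq_zero_of_le hφ ht.le

lemma IsTest.continuous_slice {φ : ℝ × E d → ℝ} (hφ : IsTest m.T m.D φ) :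
    Continuous (slice m.D φ) :=
  NoisyHeat.continuous_slice m.isBounded_D hφ.1 hφ.2.1

lemma slice_add_const_mul {T : ℝ} {D : Set (E d)} {φ ψ : ℝ × E d → ℝ} (hφ : IsTest T D φ)
    (hψ : IsTest T D ψ) (c t : ℝ) :
    slice D (fun p => φ p + c * ψ p) t = slice D φ t + c • slice D ψ t := by
  rw [slice_add hφ (hψ.const_mul c), slice_const_mul hψ]

variable {φ ψ χ : ℝ × E d → ℝ}

lemma IsSignal.cov_add_const_mul (hX : IsSignal m S P X) (hS : IsHeatSemigroup m.D m.θ S)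
    (hφ : IsTest m.T m.D φ) (hψ : IsTest m.T m.D ψ) (c : ℝ) (χ : Test m.T m.D) :
    cov[X χ, X ⟨fun p => φ p + c * ψ p, hφ.add (hψ.const_mul c)⟩; P] =
      cov[X χ, X ⟨φ, hφ⟩; P] + c * cov[X χ, X ⟨ψ, hψ⟩; P] := by
  rw [hX.cov, hX.cov, hX.cov]
  simp only [slice_add_const_mul hφ hψ]
  rw [hS.isC0Semigroup.integral_integral_integral_add_mul m.T_pos.le χ.2.continuous_slice
    hφ.continuous_slice hψ.continuous_slice χ.2.slice_eq_zero hφ.slice_eq_zero hψ.slice_eq_zero]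
  ring

lemma IsSignal.mean_add_const_mul (hX : IsSignal m S P X) (hS : IsHeatSemigroup m.D m.θ S)
    (hφ : IsTest m.T m.D φ) (hψ : IsTest m.T m.D ψ) (c : ℝ) :
    ∫ ω, X ⟨fun p => φ p + c * ψ p, hφ.add (hψ.const_mul c)⟩ ω ∂P =
      ∫ ω, X ⟨φ, hφ⟩ ω ∂P + c * ∫ ω, X ⟨ψ, hψ⟩ ω ∂P := by
  rw [hX.mean, hX.mean, hX.mean]
  simp only [slice_add_const_mul hφ hψ, inner_add_right, real_inner_smul_right]
  have hI : ∀ {φ : ℝ × E d → ℝ} (_ : IsTest m.T m.D φ),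
      IntegrableOn (fun t => (inner ℝ (S t m.ξ) (slice m.D φ t) : ℝ)) (Ioi 0) := by
    intro φ hφ
    have h1 : IntegrableOn (fun t => (inner ℝ (S (max t 0) m.ξ) (slice m.D φ t) : ℝ))
        (Ioc 0 m.T) :=
      (((hS.isC0Semigroup.continuous_orbit m.ξ).inner hφ.continuous_slice).continuousOn
        |>.integrableOn_compact isCompact_Icc).mono_set Ioc_subset_Icc_self
    have h2 : IntegrableOn (fun t => (inner ℝ (S t m.ξ) (slice m.D φ t) : ℝ)) (Ioc 0 m.T) :=
      h1.congr_fun (fun t ht => by simp only [max_eq_left ht.1.le]) measurableSet_Ioc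
    refine h2.of_forall_sdiff_eq_zero measurableSet_Ioi fun t ht => ?_
    rw [hφ.slice_eq_zero t (not_le.1 fun h => ht.2 ⟨ht.1, h⟩), inner_zero_right]
  rw [integral_add (hI hφ) ((hI hψ).const_mul c), integral_const_mul]

lemma IsSignal.memLp (hX : IsSignal m S P X) (φ : Test m.T m.D) : MemLp (X φ) 2 P :=
  (hX.gaussian.hasGaussianLaw_eval φ).memLp_two

/-- The signal process is almost surely linear. -/
lemma IsSignal.ae_eq_add_const_mul [IsProbabilityMeasure P] (hX : IsSignal m S P X)
    (hS : IsHeatSemigroup m.D m.θ S) (hφ : IsTest m.T m.D φ) (hψ : IsTest m.T m.D ψ) (c : ℝ) :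
    X ⟨fun p => φ p + c * ψ p, hφ.add (hψ.const_mul c)⟩ =ᵐ[P]
      fun ω => X ⟨φ, hφ⟩ ω + c * X ⟨ψ, hψ⟩ ω :=
  ae_eq_add_mul_of_cov (hX.memLp _) (hX.memLp _) (hX.memLp _) (hX.mean_add_const_mul hS hφ hψ c)
    (hX.cov_add_const_mul hS hφ hψ c _) (hX.cov_add_const_mul hS hφ hψ c _)
    (hX.cov_add_const_mul hS hφ hψ c _)

/-- The image `∂_t φ + ∇ · θ ∇φ` of `φ` under the adjoint of the heat operator. -/
def heatAdjoint (θ : E d → ℝ) (φ : ℝ × E d → ℝ) : ℝ × E d → ℝ :=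
  fun p => timeDeriv φ p + spaceDivGrad θ φ p

lemma IsSmoothSpaceTimeTest.isTest_heatAdjoint (hφ : IsSmoothSpaceTimeTest m.T m.D φ) :
    IsTest m.T m.D (heatAdjoint m.θ φ) :=
  hφ.isTest_timeDeriv.add (hφ.isTest_spaceDivGrad m.isOpen_D m.θ_C1.1)

lemma slice_heatAdjoint (hφ : IsSmoothSpaceTimeTest m.T m.D φ) (t : ℝ) :
    slice m.D (heatAdjoint m.θ φ) t =
      slice m.D (timeDeriv φ) t + slice m.D (spaceDivGrad m.θ φ) t :=
  slice_add hφ.isTest_timeDeriv (hφ.isTest_spaceDivGrad m.isOpen_D m.θ_C1.1) t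

lemma IsSignal.mean_heatAdjoint (hX : IsSignal m S P X) (hS : IsHeatSemigroup m.D m.θ S)
    (hφ : IsSmoothSpaceTimeTest m.T m.D φ) :
    ∫ ω, X ⟨heatAdjoint m.θ φ, hφ.isTest_heatAdjoint⟩ ω ∂P = 0 := by
  rw [hX.mean]
  simp only [slice_heatAdjoint hφ]
  exact hS.isC0Semigroup.integral_inner_orbit_path
    (hφ.isAdjointPath m.isOpen_D m.isBounded_D m.θ_C1.1 hS) m.T_pos.le m.ξ

/-- The covariance sees `φ` only at times before those of `ψ`; hence the noise in `φ` is
uncorrelated with a signal tested earlier. -/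
lemma IsSignal.cov_heatAdjoint_of_before (hX : IsSignal m S P X)
    (hS : IsHeatSemigroup m.D m.θ S) (hφ : IsSmoothSpaceTimeTest m.T m.D φ) (ψ : Test m.T m.D)
    (h : ∀ s t, s < t → slice m.D ψ.1 t = 0 ∨ slice m.D φ s = 0) :
    cov[X ψ, X ⟨heatAdjoint m.θ φ, hφ.isTest_heatAdjoint⟩; P] = 0 := by
  rw [hX.cov]
  simp only [slice_heatAdjoint hφ]
  rw [hS.isC0Semigroup.integral_orbit_eq_zero_of_before
    (hφ.isAdjointPath m.isOpen_D m.isBounded_D m.θ_C1.1 hS)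
    (hφ.generates m.isOpen_D m.θ_C1.1 hS) m.T_pos.le h, mul_zero]

/-- The noise `⟨⟨X, ∂_t φ + ∇ · θ ∇φ⟩⟩` is white. -/
lemma IsSignal.cov_heatAdjoint_heatAdjoint (hX : IsSignal m S P X)
    (hS : IsHeatSemigroup m.D m.θ S) (hφ : IsSmoothSpaceTimeTest m.T m.D φ)
    (hψ : IsSmoothSpaceTimeTest m.T m.D ψ) :
    cov[X ⟨heatAdjoint m.θ ψ, hψ.isTest_heatAdjoint⟩,
      X ⟨heatAdjoint m.θ φ, hφ.isTest_heatAdjoint⟩; P] =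
      m.σ ^ 2 * ∫ s in (0 : ℝ)..m.T, inner ℝ (slice m.D ψ s) (slice m.D φ s) := by
  rw [hX.cov]
  simp only [slice_heatAdjoint hφ, slice_heatAdjoint hψ]
  rw [hS.isC0Semigroup.integral_orbit_paths
    (hφ.isAdjointPath m.isOpen_D m.isBounded_D m.θ_C1.1 hS)
    (hφ.generates m.isOpen_D m.θ_C1.1 hS) m.T_pos.le
    (hψ.isAdjointPath m.isOpen_D m.isBounded_D m.θ_C1.1 hS)]
  ring

end Signal

/-! ### The observation noise -/

section Isonormal

variable {H : Type*} [NormedAddCommGroup H] [InnerProductSpace ℝ H] {Ω : Type*}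
  [MeasurableSpace Ω] {P : Measure Ω} {V : H → Ω → ℝ}

lemma IsIsonormal.memLp (hV : IsIsonormal P V) (f : H) : MemLp (V f) 2 P :=
  (hV.gaussian.hasGaussianLaw_eval f).memLp_two

lemma IsIsonormal.covariance_eq (hV : IsIsonormal P V) (f g : H) :
    cov[V f, V g; P] = inner ℝ f g := by
  have := hV.gaussian.isProbabilityMeasure
  rw [covariance_eq_sub (hV.memLp f) (hV.memLp g), hV.mean, zero_mul, sub_zero, ← hV.cov]
  rfl

lemma IsIsonormal.ae_eq_add_smul (hV : IsIsonormal P V) (f g : H) (c : ℝ) :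
    V (f + c • g) =ᵐ[P] fun ω => V f ω + c * V g ω := by
  have := hV.gaussian.isProbabilityMeasure
  refine ae_eq_add_mul_of_cov (hV.memLp _) (hV.memLp _) (hV.memLp _) ?_ ?_ ?_ ?_
  · simp [hV.mean]
  all_goals
    simp only [hV.covariance_eq]
    rw [inner_add_right, real_inner_smul_right]

end Isonormal

/-! ### Localized kernels -/

section Kernel

variable {d : ℕ}

/-- The affine change of variables `(t, y) ↦ (a t - k, b (y - x₀) - x)`. -/
def rescale (a b k : ℝ) (x₀ x : E d) (p : ℝ × E d) : ℝ × E d := (a * p.1 - k, b • (p.2 - x₀) - x)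

/-- `rescale` as a homeomorphism. -/
def rescaleHomeomorph {a b : ℝ} (ha : a ≠ 0) (hb : b ≠ 0) (k : ℝ) (x₀ x : E d) :
    ℝ × E d ≃ₜ ℝ × E d :=
  ((Homeomorph.mulLeft₀ a ha).trans (Homeomorph.subRight k)).prodCongr
    (((Homeomorph.subRight x₀).trans (Homeomorph.smulOfNeZero b hb)).trans (Homeomorph.subRight x))

lemma integral_rescale {a b : ℝ} (ha : 0 < a) (hb : 0 < b) (k : ℝ) (x₀ x : E d)
    {F : ℝ × E d → ℝ} (hF : Continuous F) (hFc : HasCompactSupport F) :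
    ∫ p, F (rescale a b k x₀ x p) = a⁻¹ * (b ^ d)⁻¹ * ∫ p, F p := by
  have h1 : Integrable (fun p => F (rescale a b k x₀ x p)) (volume.prod volume) := by
    have hc := hFc.comp_homeomorph (rescaleHomeomorph ha.ne' hb.ne' k x₀ x)
    have hcont := hF.comp (rescaleHomeomorph ha.ne' hb.ne' k x₀ x).continuous
    exact hcont.integrable_of_hasCompactSupport hc
  have h2 : Integrable F (volume.prod volume) := hF.integrable_of_hasCompactSupport hFc
  rw [Measure.volume_eq_prod, integral_prod _ h1, integral_prod _ h2]
  have h3 : ∀ t, ∫ y, F (rescale a b k x₀ x (t, y)) = (b ^ d)⁻¹ * ∫ y, F (a * t - k, y) := by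
    intro t
    have e := integral_sub_right_eq_self (μ := (volume : Measure (E d)))
      (fun y => F (a * t - k, b • y - x)) x₀
    have e2 := Measure.integral_comp_smul (volume : Measure (E d))
      (fun y => F (a * t - k, y - x)) b
    have e3 := integral_sub_right_eq_self (μ := (volume : Measure (E d)))
      (fun y => F (a * t - k, y)) x
    simp only [rescale]
    rw [e, e2, e3, finrank_euclideanSpace, Fintype.card_fin, abs_of_pos (by positivity), smul_eq_mul]
  simp_rw [h3]
  rw [integral_const_mul]
  have e := Measure.integral_comp_smul (volume : Measure ℝ)
    (fun t => ∫ y, F (t - k, y)) a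
  have e2 := integral_sub_right_eq_self (μ := (volume : Measure ℝ)) (fun t => ∫ y, F (t, y)) k
  simp only [smul_eq_mul, Module.finrank_self, pow_one] at e
  rw [e, e2, abs_of_pos (by positivity)]
  ring

lemma partialDeriv_comp_affine {g : E d → ℝ} (hg : Differentiable ℝ g) (c b : ℝ) (x₀ x : E d)
    (i : Fin d) : partialDeriv i (fun y => c * g (b • (y - x₀) - x)) =
      fun y => c * b * partialDeriv i g (b • (y - x₀) - x) := by
  funext y
  have h1 : HasFDerivAt (fun y : E d => b • (y - x₀) - x) (b • ContinuousLinearMap.id ℝ (E d)) y :=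
    (((hasFDerivAt_id y).sub_const x₀).const_smul b).sub_const x
  have h2 := ((hg.differentiableAt.hasFDerivAt.comp y h1).const_mul c).fderiv
  simp only [Function.comp_def] at h2
  rw [partialDeriv, h2]
  simp [partialDeriv, mul_assoc]

lemma divGrad_one_comp_affine {g : E d → ℝ} (hg : ContDiff ℝ 2 g) (c b : ℝ) (x₀ x y : E d) :
    divGrad (fun _ => 1) (fun y => c * g (b • (y - x₀) - x)) y =
      c * b ^ 2 * divGrad (fun _ => 1) g (b • (y - x₀) - x) := by
  simp only [divGrad, one_mul, Finset.mul_sum]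
  refine Finset.sum_congr rfl fun i _ => ?_
  rw [partialDeriv_comp_affine (hg.differentiable (by simp)),
    show (fun y => c * b * partialDeriv i g (b • (y - x₀) - x)) = _ from rfl]
  have h := partialDeriv_comp_affine
    ((contDiff_partialDeriv (m := 1) hg (by norm_num) i).differentiable (by simp)) (c * b) b x₀ x i
  rw [h]
  simp only
  ring

lemma timeDeriv_comp_affine {F : ℝ × E d → ℝ} (hF : ContDiff ℝ 1 F) (c a b k : ℝ) (x₀ x : E d)
    (p : ℝ × E d) : timeDeriv (fun p => c * F (rescale a b k x₀ x p)) p =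
      c * a * timeDeriv F (rescale a b k x₀ x p) := by
  have h1 : HasDerivAt (fun t : ℝ => a * t - k) a p.1 := by
    simpa using ((hasDerivAt_id p.1).const_mul a).sub_const k
  have h2 := ((hasDerivAt_timeDeriv hF (a * p.1 - k) (b • (p.2 - x₀) - x)).comp p.1 h1).const_mul c
  have h3 := h2.deriv
  simp only [Function.comp_def] at h3
  rw [timeDeriv, timeDeriv_eq_fderiv hF]
  simp only [rescale]
  rw [h3]
  ring

namespace HeatModel

variable {m : HeatModel d} {ε : ℝ} {k : ℕ} {x : E d} {G : Finset (E d)}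

/-- The rescaling in the definition of `locK`. -/
def locMap (m : HeatModel d) (ε : ℝ) (k : ℕ) (x : E d) : ℝ × E d → ℝ × E d :=
  rescale ε⁻¹ (ε ^ (-(1 / 2 : ℝ))) k m.x₀ x

lemma locK_eq (m : HeatModel d) (ε : ℝ) (k : ℕ) (x : E d) :
    m.locK ε k x = fun p => ε ^ (-(1 / 2 : ℝ) - (d : ℝ) / 4) * m.K (m.locMap ε k x p) := rfl

lemma scale_pos (hε : 0 < ε) : 0 < ε ^ (-(1 / 2 : ℝ)) := Real.rpow_pos_of_pos hε _

lemma tsupport_locK (hε : 0 < ε) : tsupport (m.locK ε k x) = m.locMap ε k x ⁻¹' tsupport m.K := by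
  have hc : ε ^ (-(1 / 2 : ℝ) - (d : ℝ) / 4) ≠ 0 := (Real.rpow_pos_of_pos hε _).ne'
  set A := rescaleHomeomorph (inv_pos.2 hε).ne' (scale_pos hε).ne' (k : ℝ) m.x₀ x
  have h1 : Function.support (m.locK ε k x) = A ⁻¹' Function.support m.K := by
    ext p
    simp only [Function.mem_support, locK_eq, mem_preimage]
    exact ⟨fun h h' => h (by
      rw [show m.locMap ε k x p = A p from rfl, h', mul_zero]), fun h => mul_ne_zero hc h⟩
  rw [tsupport, h1, ← A.preimage_closure]
  rfl

/-- The grid conditions are imposed only for the block `k = 0`; this time shift transports them to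
all blocks. -/
lemma mem_tsupport_locK_iff (hε : 0 < ε) {t : ℝ} {y : E d} :
    (t, y) ∈ tsupport (m.locK ε k x) ↔ (t - k * ε, y) ∈ tsupport (m.locK ε 0 x) := by
  rw [tsupport_locK hε, tsupport_locK hε, mem_preimage, mem_preimage]
  have : m.locMap ε k x (t, y) = m.locMap ε 0 x (t - k * ε, y) := by
    simp only [locMap, rescale, Prod.mk.injEq, and_true, Nat.cast_zero, sub_zero]
    field_simp
  rw [this]

/-- The reference kernel lives in the open unit time interval, so distinct `k` occupy disjoint,
ordered time blocks. -/
lemma time_mem_of_mem_tsupport (hε : 0 < ε) {t : ℝ} {y : E d}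
    (h : (t, y) ∈ tsupport (m.locK ε k x)) : k * ε < t ∧ t < (k + 1) * ε := by
  rw [tsupport_locK hε] at h
  have h1 := (m.K_support h).1
  simp only [locMap, rescale, mem_Ioo] at h1
  obtain ⟨h2, h3⟩ := h1
  rw [sub_pos, ← div_eq_inv_mul, lt_div_iff₀ hε] at h2
  rw [sub_lt_iff_lt_add', ← div_eq_inv_mul, div_lt_iff₀ hε] at h3
  exact ⟨h2, h3⟩

lemma contDiff_locK (m : HeatModel d) (ε : ℝ) (k : ℕ) (x : E d) :
    ContDiff ℝ ((⊤ : ℕ∞) : WithTop ℕ∞) (m.locK ε k x) := by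
  rw [locK_eq]
  refine contDiff_const.mul (m.K_smooth.comp ?_)
  unfold locMap rescale
  fun_prop

lemma hasCompactSupport_comp_locMap (hε : 0 < ε) {F : ℝ × E d → ℝ} (hF : HasCompactSupport F) :
    HasCompactSupport fun p => F (m.locMap ε k x p) :=
  hF.comp_homeomorph (rescaleHomeomorph (inv_pos.2 hε).ne' (scale_pos hε).ne' (k : ℝ) m.x₀ x)

lemma hasCompactSupport_locK (hε : 0 < ε) : HasCompactSupport (m.locK ε k x) :=
  (hasCompactSupport_comp_locMap hε m.K_compact).mul_left

lemma succ_mul_le (hε : 0 < ε) (hN : 0 < m.N ε) (hk : k ≤ m.N ε) : ((k : ℝ) + 1) * ε ≤ m.T := by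
  -- Positivity of `N` rules out truncated subtraction. The `-1` in `N` is what leaves room for the
  -- last block to end by time `T`.
  have h1 : k + 1 ≤ ⌊m.T / ε⌋₊ := by
    unfold N at hN hk
    omega
  have h2 : ((k + 1 : ℕ) : ℝ) ≤ m.T / ε :=
    (Nat.cast_le.2 h1).trans (Nat.floor_le (div_pos m.T_pos hε).le)
  rw [le_div_iff₀ hε] at h2
  exact_mod_cast h2

lemma isSmoothSpaceTimeTest_locK (hε : 0 < ε) (hG : m.IsGrid ε G) (hx : x ∈ G)
    (hN : 0 < m.N ε) (hk : k ≤ m.N ε) : IsSmoothSpaceTimeTest m.T m.D (m.locK ε k x) := by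
  refine ⟨contDiff_locK m ε k x, hasCompactSupport_locK hε, ?_⟩
  rintro ⟨t, y⟩ h
  have h1 := time_mem_of_mem_tsupport hε h
  refine ⟨⟨lt_of_le_of_lt (by positivity) h1.1, h1.2.trans_le (succ_mul_le hε hN hk)⟩, ?_⟩
  exact (hG.1 x hx ((mem_tsupport_locK_iff hε).1 h)).2

lemma notMem_tsupport_locK (hε : 0 < ε) (hG : m.IsGrid ε G) {y : E d} (hx : x ∈ G) (hy : y ∈ G)
    (hxy : x ≠ y) (p : ℝ × E d) : p ∉ tsupport (m.locK ε k x) ∨ p ∉ tsupport (m.locK ε k y) := by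
  by_contra! h
  obtain ⟨t, z⟩ := p
  exact Set.disjoint_left.1 (hG.2 x hx y hy hxy) ((mem_tsupport_locK_iff hε).1 h.1)
    ((mem_tsupport_locK_iff hε).1 h.2)

lemma timeDeriv_locK (m : HeatModel d) (ε : ℝ) (k : ℕ) (x : E d) (p : ℝ × E d) :
    timeDeriv (m.locK ε k x) p =
      ε ^ (-(1 / 2 : ℝ) - (d : ℝ) / 4) * ε⁻¹ * timeDeriv m.K (m.locMap ε k x p) :=
  timeDeriv_comp_affine (m.K_smooth.of_le (by simp)) _ _ _ _ _ _ _

/-- Parabolic scaling: two derivatives at length scale `ε^{1/2}` cost the same `ε⁻¹` as one time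
derivative. -/
lemma spaceLap_locK (hε : 0 < ε) (p : ℝ × E d) : spaceLap (m.locK ε k x) p =
      ε ^ (-(1 / 2 : ℝ) - (d : ℝ) / 4) * ε⁻¹ * spaceLap m.K (m.locMap ε k x p) := by
  have h2 : (2 : WithTop ℕ∞) ≤ ((⊤ : ℕ∞) : WithTop ℕ∞) :=
    WithTop.coe_le_coe.2 (le_top : (2 : ℕ∞) ≤ ⊤)
  have hK : ∀ t, ContDiff ℝ 2 fun y => m.K (t, y) := fun t =>
    (m.K_smooth.comp (contDiff_prodMk_right t)).of_le h2
  have hL : ContDiff ℝ 2 fun y => m.locK ε k x (p.1, y) :=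
    ((contDiff_locK m ε k x).comp (contDiff_prodMk_right p.1)).of_le h2
  have hsq : (ε ^ (-(1 / 2 : ℝ))) ^ 2 = ε⁻¹ := by
    rw [← Real.rpow_natCast, ← Real.rpow_mul hε.le, ← Real.rpow_neg_one]
    norm_num
  rw [spaceLap, spaceLap, laplacian_eq_divGrad hL, laplacian_eq_divGrad (hK _), ← hsq]
  exact divGrad_one_comp_affine (hK (ε⁻¹ * p.1 - k)) (ε ^ (-(1 / 2 : ℝ) - (d : ℝ) / 4))
    (ε ^ (-(1 / 2 : ℝ))) m.x₀ x p.2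

/-- The squared prefactor `ε^{-1-d/2}` cancels the Jacobian `ε · ε^{d/2}`: localization preserves
the `L²` norm. -/
lemma scale_sq_mul (hε : 0 < ε) : (ε ^ (-(1 / 2 : ℝ) - (d : ℝ) / 4)) ^ 2 *
    ((ε⁻¹)⁻¹ * ((ε ^ (-(1 / 2 : ℝ))) ^ d)⁻¹) = 1 := by
  rw [← Real.rpow_natCast, ← Real.rpow_natCast, ← Real.rpow_mul hε.le, ← Real.rpow_mul hε.le,
    inv_inv, ← Real.rpow_neg hε.le]
  nth_rw 2 [← Real.rpow_one ε]
  rw [← Real.rpow_add hε, ← Real.rpow_add hε]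
  convert Real.rpow_zero ε using 2
  push_cast
  ring

lemma integral_sq_comp_locMap (hε : 0 < ε) {F : ℝ × E d → ℝ} (hF : Continuous F)
    (hFc : HasCompactSupport F) :
    ∫ p, (ε ^ (-(1 / 2 : ℝ) - (d : ℝ) / 4) * F (m.locMap ε k x p)) ^ 2 = ∫ p, F p ^ 2 := by
  have h := integral_rescale (inv_pos.2 hε) (scale_pos hε) (k : ℝ) m.x₀ x
    (F := fun p => F p ^ 2) (hF.pow 2) (hFc.comp_left (g := fun r : ℝ => r ^ 2) (by simp))
  simp_rw [mul_pow]
  rw [integral_const_mul]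
  change _ * ∫ p, F (rescale ε⁻¹ (ε ^ (-(1 / 2 : ℝ))) k m.x₀ x p) ^ 2 = _
  rw [h, ← mul_assoc, scale_sq_mul hε, one_mul]

end HeatModel

end Kernel

/-! ### Pairings in `L²` of time and space -/

section Pairing

variable {d : ℕ} {T : ℝ} {D : Set (E d)} {φ ψ : ℝ × E d → ℝ}

lemma IsTest.memLp_prod (hφ : IsTest T D φ) :
    MemLp φ 2 ((volume : Measure (ℝ × E d)).restrict (Ico 0 T ×ˢ D)) :=
  hφ.1.memLp_of_hasCompactSupport hφ.2.1

lemma inner_toL2_prod (hφ : IsTest T D φ) (hψ : IsTest T D ψ)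
    (h : ∀ p, p ∉ Ico 0 T ×ˢ D → φ p * ψ p = 0) :
    inner ℝ (toL2 ((volume : Measure (ℝ × E d)).restrict (Ico 0 T ×ˢ D)) φ)
      (toL2 (volume.restrict (Ico 0 T ×ˢ D)) ψ) = ∫ p, φ p * ψ p := by
  rw [inner_toL2_toL2 hφ.memLp_prod hψ.memLp_prod,
    setIntegral_eq_integral_of_forall_compl_eq_zero h]

lemma inner_toL2_prod_eq_zero (hφ : IsTest T D φ) (hψ : IsTest T D ψ) (h : ∀ p, φ p = 0 ∨ ψ p = 0) :
    inner ℝ (toL2 ((volume : Measure (ℝ × E d)).restrict (Ico 0 T ×ˢ D)) φ)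
      (toL2 (volume.restrict (Ico 0 T ×ˢ D)) ψ) = 0 := by
  have h' : ∀ p, φ p * ψ p = 0 := fun p => mul_eq_zero.2 (h p)
  rw [inner_toL2_toL2 hφ.memLp_prod hψ.memLp_prod]
  simp [h']

lemma inner_slice (hφ : IsTest T D φ) (hψ : IsTest T D ψ) (t : ℝ) :
    inner ℝ (slice D φ t) (slice D ψ t) = ∫ x in D, φ (t, x) * ψ (t, x) :=
  inner_toL2_toL2 (memLp_slice hφ.1 hφ.2.1 t) (memLp_slice hψ.1 hψ.2.1 t)

lemma inner_slice_self (hφ : IsSmoothSpaceTimeTest T D φ) (s : ℝ) :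
    (inner ℝ (slice D φ s) (slice D φ s) : ℝ) = ∫ x, φ (s, x) ^ 2 := by
  rw [inner_slice hφ.isTest hφ.isTest, setIntegral_eq_integral_of_forall_compl_eq_zero]
  · simp_rw [pow_two]
  · intro x hx
    rw [image_eq_zero_of_notMem_tsupport fun h => hx (hφ.tsupport_subset h).2, zero_mul]

lemma integral_inner_slice_self (hT : 0 ≤ T) (hφ : IsSmoothSpaceTimeTest T D φ) :
    ∫ s in (0 : ℝ)..T, (inner ℝ (slice D φ s) (slice D φ s) : ℝ) = ∫ p, φ p ^ 2 := by
  have hsq : HasCompactSupport fun p => φ p ^ 2 := by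
    simp only [pow_two]
    exact hφ.hasCompactSupport.mul_left
  have hint : Integrable (fun p => φ p ^ 2) ((volume : Measure ℝ).prod (volume : Measure (E d))) :=
    (hφ.contDiff.continuous.pow 2).integrable_of_hasCompactSupport hsq
  have e : ∫ p, φ p ^ 2 = ∫ s, ∫ x, φ (s, x) ^ 2 := by
    rw [Measure.volume_eq_prod]
    exact integral_prod _ hint
  rw [intervalIntegral.integral_congr fun s _ => inner_slice_self hφ s, e,
    intervalIntegral.integral_of_le hT]
  refine setIntegral_eq_integral_of_forall_compl_eq_zero fun s hs => ?_
  have h0 : ∀ x, φ (s, x) = 0 := fun x => image_eq_zero_of_notMem_tsupport fun h =>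
    hs (Ioo_subset_Ioc_self (hφ.tsupport_subset h).1)
  simp [h0]

end Pairing

/-! ### The noise in the observation of a localized kernel -/

section Noise

variable {d : ℕ} {m : HeatModel d} {S : ℝ → L2 m.D →L[ℝ] L2 m.D} {Ω : Type*} [MeasurableSpace Ω]
  {P : Measure Ω} {X : Test m.T m.D → Ω → ℝ} {V : L2ST m.T m.D → Ω → ℝ}

/-- The process `(φ, f) ↦ ⟨⟨X, φ⟩⟩ + ε V(f)`. -/
def jointProcess (X : Test m.T m.D → Ω → ℝ) (V : L2ST m.T m.D → Ω → ℝ) (ε : ℝ)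
    (p : Test m.T m.D × L2ST m.T m.D) (ω : Ω) : ℝ := X p.1 ω + ε * V p.2 ω

lemma cov_jointProcess [IsProbabilityMeasure P] (hX : IsSignal m S P X) (hV : IsIsonormal P V)
    (hXV : IndepFun (fun ω φ => X φ ω) (fun ω f => V f ω) P) (ε : ℝ)
    (p q : Test m.T m.D × L2ST m.T m.D) :
    cov[jointProcess X V ε p, jointProcess X V ε q; P] =
      cov[X p.1, X q.1; P] + ε ^ 2 * inner ℝ p.2 q.2 := by
  have e : ∀ p, jointProcess X V ε p = X p.1 + ε • V p.2 := fun _ => rfl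
  have hx := fun φ => hX.memLp φ
  have hv := fun f => (hV.memLp f).const_smul ε
  have h0 : ∀ φ f, cov[X φ, V f; P] = 0 := fun φ f =>
    (hXV.comp (φ := fun g : Test m.T m.D → ℝ => g φ) (ψ := fun g : L2ST m.T m.D → ℝ => g f)
      (measurable_pi_apply φ) (measurable_pi_apply f)).covariance_eq_zero (hx φ) (hV.memLp f)
  rw [e, e, covariance_add_left (hx _) (hv _) ((hx _).add (hv _)),
    covariance_add_right (hx _) (hx _) (hv _), covariance_add_right (hv _) (hx _) (hv _),
    covariance_smul_right, covariance_smul_left, covariance_smul_left, covariance_smul_right,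
    h0, covariance_comm (V _) (X _), h0, hV.covariance_eq]
  ring

open Classical in
/-- A function as a test function (`0` for other functions). -/
def toTest (m : HeatModel d) (φ : ℝ × E d → ℝ) : Test m.T m.D :=
  if h : IsTest m.T m.D φ then ⟨φ, h⟩ else
    ⟨0, continuous_const, HasCompactSupport.zero, by simp⟩

lemma toTest_eq {φ : ℝ × E d → ℝ} (h : IsTest m.T m.D φ) : toTest m φ = ⟨φ, h⟩ := dif_pos h

/-- The joint index at which the observation of `Δφ` is taken. -/
def lapIndex (m : HeatModel d) (φ : ℝ × E d → ℝ) : Test m.T m.D × L2ST m.T m.D :=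
  (toTest m (spaceLap φ), toL2 _ (spaceLap φ))

/-- `∂_t φ + ϑ(x₀) Δφ`. -/
def frozenAdjoint (m : HeatModel d) (φ : ℝ × E d → ℝ) : ℝ × E d → ℝ :=
  fun p => timeDeriv φ p + m.θ m.x₀ * spaceLap φ p

/-- The joint index of the noise in the observation of `φ`. -/
def noiseIndex (m : HeatModel d) (φ : ℝ × E d → ℝ) : Test m.T m.D × L2ST m.T m.D :=
  (toTest m (heatAdjoint m.θ φ), toL2 _ (frozenAdjoint m φ))

variable {φ ψ : ℝ × E d → ℝ}

lemma IsSmoothSpaceTimeTest.isTest_frozenAdjoint (hφ : IsSmoothSpaceTimeTest m.T m.D φ) :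
    IsTest m.T m.D (frozenAdjoint m φ) :=
  hφ.isTest_timeDeriv.add ((hφ.isTest_spaceLap m.isOpen_D).const_mul _)

lemma IsSmoothSpaceTimeTest.spaceLap_eq_zero (hφ : IsSmoothSpaceTimeTest m.T m.D φ)
    {p : ℝ × E d} (hp : p ∉ tsupport φ) : spaceLap φ p = 0 := by
  rw [hφ.spaceLap_eq]
  exact spaceDivGrad_eq_zero _ p hp

lemma IsSmoothSpaceTimeTest.frozenAdjoint_eq_zero (hφ : IsSmoothSpaceTimeTest m.T m.D φ)
    {p : ℝ × E d} (hp : p ∉ tsupport φ) : frozenAdjoint m φ p = 0 := by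
  rw [frozenAdjoint, timeDeriv_eq_zero p hp, hφ.spaceLap_eq_zero hp, mul_zero, add_zero]

lemma heatAdjoint_eq_zero {p : ℝ × E d} (hp : p ∉ tsupport φ) : heatAdjoint m.θ φ p = 0 := by
  rw [heatAdjoint, timeDeriv_eq_zero p hp, spaceDivGrad_eq_zero _ p hp, add_zero]

lemma pairY_spaceLap {d : ℕ} {m : HeatModel d} {Ω : Type*} {X : Test m.T m.D → Ω → ℝ}
    {V : L2ST m.T m.D → Ω → ℝ} {φ : ℝ × E d → ℝ} (ε : ℝ) (hφ : IsSmoothSpaceTimeTest m.T m.D φ) (ω : Ω) :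
    m.pairY X V ε (spaceLap φ) ω = jointProcess X V ε (lapIndex m φ) ω := by
  have hl := hφ.isTest_spaceLap m.isOpen_D
  simp only [HeatModel.pairY, jointProcess, lapIndex, toTest_eq hl, HeatModel.pairX_of_isTest X hl]

lemma integral_noiseIndex [IsProbabilityMeasure P] (hS : IsHeatSemigroup m.D m.θ S)
    (hX : IsSignal m S P X) (hV : IsIsonormal P V) (ε : ℝ)
    (hφ : IsSmoothSpaceTimeTest m.T m.D φ) :
    ∫ ω, jointProcess X V ε (noiseIndex m φ) ω ∂P = 0 := by
  simp only [jointProcess]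
  rw [integral_add ((hX.memLp _).integrable (by simp))
    (((hV.memLp _).integrable (by simp)).const_mul ε), integral_const_mul, hV.mean]
  simp only [noiseIndex, toTest_eq hφ.isTest_heatAdjoint, hX.mean_heatAdjoint hS hφ]
  simp

/-- The signal contribution vanishes by causality, that of the observation noise by disjointness of
supports. -/
lemma cov_noiseIndex_lapIndex [IsProbabilityMeasure P] (hS : IsHeatSemigroup m.D m.θ S)
    (hX : IsSignal m S P X) (hV : IsIsonormal P V)
    (hXV : IndepFun (fun ω φ => X φ ω) (fun ω f => V f ω) P) (ε : ℝ)
    (hφ : IsSmoothSpaceTimeTest m.T m.D φ) (hψ : IsSmoothSpaceTimeTest m.T m.D ψ)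
    (h : ∀ s t x y, (t, x) ∈ tsupport ψ → (s, y) ∈ tsupport φ → t < s) :
    cov[jointProcess X V ε (noiseIndex m φ), jointProcess X V ε (lapIndex m ψ); P] = 0 := by
  rw [cov_jointProcess hX hV hXV]
  simp only [noiseIndex, lapIndex, toTest_eq hφ.isTest_heatAdjoint,
    toTest_eq (hψ.isTest_spaceLap m.isOpen_D)]
  rw [covariance_comm, hX.cov_heatAdjoint_of_before hS hφ, inner_toL2_prod_eq_zero
    hφ.isTest_frozenAdjoint (hψ.isTest_spaceLap m.isOpen_D), mul_zero, add_zero]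
  · intro p
    by_contra! hcon
    have h1 : p ∈ tsupport φ := by by_contra hn; exact hcon.1 (hφ.frozenAdjoint_eq_zero hn)
    have h2 : p ∈ tsupport ψ := by by_contra hn; exact hcon.2 (hψ.spaceLap_eq_zero hn)
    exact lt_irrefl _ (h p.1 p.1 p.2 p.2 h2 h1)
  · intro s t hst
    by_cases hs : ∀ y, φ (s, y) = 0
    · exact Or.inr (slice_eq_zero hs)
    · left
      push Not at hs
      obtain ⟨y, hy⟩ := hs
      refine slice_eq_zero fun x => hψ.spaceLap_eq_zero fun hx => ?_
      exact absurd (h s t x y hx (subset_tsupport _ hy)) (not_lt.2 hst.le)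

lemma cov_noiseIndex_of_before [IsProbabilityMeasure P] (hS : IsHeatSemigroup m.D m.θ S)
    (hX : IsSignal m S P X) (hV : IsIsonormal P V)
    (hXV : IndepFun (fun ω φ => X φ ω) (fun ω f => V f ω) P) (ε : ℝ)
    (hφ : IsSmoothSpaceTimeTest m.T m.D φ) (hψ : IsSmoothSpaceTimeTest m.T m.D ψ)
    (h : ∀ s t x y, (t, x) ∈ tsupport ψ → (s, y) ∈ tsupport φ → t < s) :
    cov[jointProcess X V ε (noiseIndex m φ), jointProcess X V ε (noiseIndex m ψ); P] = 0 := by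
  rw [cov_jointProcess hX hV hXV]
  simp only [noiseIndex, toTest_eq hφ.isTest_heatAdjoint, toTest_eq hψ.isTest_heatAdjoint]
  rw [covariance_comm, hX.cov_heatAdjoint_of_before hS hφ, inner_toL2_prod_eq_zero
    hφ.isTest_frozenAdjoint hψ.isTest_frozenAdjoint, mul_zero, add_zero]
  · intro p
    by_contra! hcon
    have h1 : p ∈ tsupport φ := by by_contra hn; exact hcon.1 (hφ.frozenAdjoint_eq_zero hn)
    have h2 : p ∈ tsupport ψ := by by_contra hn; exact hcon.2 (hψ.frozenAdjoint_eq_zero hn)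
    exact lt_irrefl _ (h p.1 p.1 p.2 p.2 h2 h1)
  · intro s t hst
    by_cases hs : ∀ y, φ (s, y) = 0
    · exact Or.inr (slice_eq_zero hs)
    · left
      push Not at hs
      obtain ⟨y, hy⟩ := hs
      refine slice_eq_zero fun x => heatAdjoint_eq_zero fun hx => ?_
      exact absurd (h s t x y hx (subset_tsupport _ hy)) (not_lt.2 hst.le)

/-- Serves kernels on the same time block at different grid points, where causality says nothing:
whiteness reduces both contributions to `L²` pairings of functions with disjoint supports. -/
lemma cov_noiseIndex_of_disjoint [IsProbabilityMeasure P] (hS : IsHeatSemigroup m.D m.θ S)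
    (hX : IsSignal m S P X) (hV : IsIsonormal P V)
    (hXV : IndepFun (fun ω φ => X φ ω) (fun ω f => V f ω) P) (ε : ℝ)
    (hφ : IsSmoothSpaceTimeTest m.T m.D φ) (hψ : IsSmoothSpaceTimeTest m.T m.D ψ)
    (h : ∀ p, p ∉ tsupport φ ∨ p ∉ tsupport ψ) :
    cov[jointProcess X V ε (noiseIndex m φ), jointProcess X V ε (noiseIndex m ψ); P] = 0 := by
  rw [cov_jointProcess hX hV hXV]
  simp only [noiseIndex, toTest_eq hφ.isTest_heatAdjoint, toTest_eq hψ.isTest_heatAdjoint]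
  rw [hX.cov_heatAdjoint_heatAdjoint hS hψ hφ, inner_toL2_prod_eq_zero
    hφ.isTest_frozenAdjoint hψ.isTest_frozenAdjoint fun p =>
      (h p).imp hφ.frozenAdjoint_eq_zero hψ.frozenAdjoint_eq_zero]
  have h1 : ∀ s, (inner ℝ (slice m.D φ s) (slice m.D ψ s) : ℝ) = 0 := by
    intro s
    have h2 : ∀ x, φ (s, x) * ψ (s, x) = 0 := fun x => mul_eq_zero.2
      ((h (s, x)).imp image_eq_zero_of_notMem_tsupport image_eq_zero_of_notMem_tsupport)
    rw [inner_slice hφ.isTest hψ.isTest]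
    simp [h2]
  simp [h1]

lemma cov_noiseIndex_self [IsProbabilityMeasure P] (hS : IsHeatSemigroup m.D m.θ S)
    (hX : IsSignal m S P X) (hV : IsIsonormal P V)
    (hXV : IndepFun (fun ω φ => X φ ω) (fun ω f => V f ω) P) (ε : ℝ)
    (hφ : IsSmoothSpaceTimeTest m.T m.D φ) :
    cov[jointProcess X V ε (noiseIndex m φ), jointProcess X V ε (noiseIndex m φ); P] =
      m.σ ^ 2 * (∫ p, φ p ^ 2) + ε ^ 2 * ∫ p, frozenAdjoint m φ p ^ 2 := by
  rw [cov_jointProcess hX hV hXV]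
  simp only [noiseIndex, toTest_eq hφ.isTest_heatAdjoint]
  rw [hX.cov_heatAdjoint_heatAdjoint hS hφ hφ, integral_inner_slice_self m.T_pos.le hφ,
    inner_toL2_prod hφ.isTest_frozenAdjoint hφ.isTest_frozenAdjoint fun p hp => ?_]
  · simp_rw [pow_two]
  · rw [hφ.frozenAdjoint_eq_zero fun h => hp ?_, zero_mul]
    exact prod_mono Ioo_subset_Ico_self subset_rfl (hφ.tsupport_subset h)

/-- The error `X' - ϑ(x₀) X^Δ` consists of noise and bias. -/
lemma ae_pairY_eq [IsProbabilityMeasure P] (hS : IsHeatSemigroup m.D m.θ S)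
    (hX : IsSignal m S P X) (hV : IsIsonormal P V) (ε : ℝ)
    (hφ : IsSmoothSpaceTimeTest m.T m.D φ) :
    ∀ᵐ ω ∂P, - m.pairY X V ε (timeDeriv φ) ω - m.θ m.x₀ * m.pairY X V ε (spaceLap φ) ω =
      - jointProcess X V ε (noiseIndex m φ) ω +
        m.pairX X (fun p => spaceDivGrad m.θ φ p - m.θ m.x₀ * spaceLap φ p) ω := by
  have ht := hφ.isTest_timeDeriv
  have hd := hφ.isTest_spaceDivGrad m.isOpen_D m.θ_C1.1
  have hl := hφ.isTest_spaceLap m.isOpen_D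
  -- Three almost sure identities suffice: one for the noise of the signal, one for the bias
  -- operator, one for the observation noise.
  have h1 := hX.ae_eq_add_const_mul hS ht hd 1
  have h2 := hX.ae_eq_add_const_mul hS hd hl (-m.θ m.x₀)
  have h3 := hV.ae_eq_add_smul (toL2 _ (timeDeriv φ)) (toL2 _ (spaceLap φ)) (m.θ m.x₀)
  have e1 : heatAdjoint m.θ φ = fun p => timeDeriv φ p + 1 * spaceDivGrad m.θ φ p := by
    funext p; simp [heatAdjoint]
  have e2 : (fun p => spaceDivGrad m.θ φ p - m.θ m.x₀ * spaceLap φ p) =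
      fun p => spaceDivGrad m.θ φ p + -m.θ m.x₀ * spaceLap φ p := by
    funext p; ring
  have e3 : toL2 ((volume : Measure (ℝ × E d)).restrict (Ico 0 m.T ×ˢ m.D)) (frozenAdjoint m φ) =
      toL2 _ (timeDeriv φ) + m.θ m.x₀ • toL2 _ (spaceLap φ) := by
    rw [← toL2_const_mul _ hl.memLp_prod, ← toL2_add ht.memLp_prod (hl.const_mul _).memLp_prod]
    rfl
  filter_upwards [h1, h2, h3] with ω w1 w2 w3
  simp only [HeatModel.pairY, jointProcess, noiseIndex, e1, e2, e3, w3,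
    toTest_eq (ht.add (hd.const_mul 1)), HeatModel.pairX_of_isTest X ht,
    HeatModel.pairX_of_isTest X hl, HeatModel.pairX_of_isTest X (hd.add (hl.const_mul (-m.θ m.x₀))),
    w1, w2]
  ring

end Noise

/-! ### Error decomposition of the estimator -/

section Decomposition

variable {d : ℕ} {m : HeatModel d} {S : ℝ → L2 m.D →L[ℝ] L2 m.D} {Ω : Type*} [MeasurableSpace Ω]
  {P : Measure Ω} {X : Test m.T m.D → Ω → ℝ} {V : L2ST m.T m.D → Ω → ℝ}

/-- The martingale part of the error. -/
def martingalePart (m : HeatModel d) (X : Test m.T m.D → Ω → ℝ) (V : L2ST m.T m.D → Ω → ℝ)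
    (ε : ℝ) (G : Finset (E d)) (w : E d → ℝ) (ω : Ω) : ℝ :=
  ∑ k ∈ Finset.Icc 1 (m.N ε), ∑ x ∈ G, w x * m.Xlap X V ε (k - 1) x ω *
    jointProcess X V ε (noiseIndex m (m.locK ε k x)) ω

lemma isSmoothSpaceTimeTest_kernel (m : HeatModel d) : IsSmoothSpaceTimeTest 1 univ m.K :=
  ⟨m.K_smooth, m.K_compact, m.K_support.trans (prod_mono subset_rfl (subset_univ _))⟩

/-- The noise level `ε²` exactly compensates the `ε⁻²` from squaring the differential operator, so
dynamic and observation noise are of the same order at this localization. -/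
lemma sigmaKSq_eq {ε : ℝ} (hε : 0 < ε) (k : ℕ) (x : E d) :
    m.σ ^ 2 * (∫ p, m.locK ε k x p ^ 2) + ε ^ 2 * ∫ p, frozenAdjoint m (m.locK ε k x) p ^ 2 =
      m.sigmaKSq := by
  have hK := isSmoothSpaceTimeTest_kernel m
  have hF : IsTest 1 univ (frozenAdjoint m m.K) :=
    hK.isTest_timeDeriv.add ((hK.isTest_spaceLap isOpen_univ).const_mul _)
  have h1 : ∫ p, m.locK ε k x p ^ 2 = ∫ p, m.K p ^ 2 :=
    HeatModel.integral_sq_comp_locMap hε m.K_smooth.continuous m.K_compact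
  have h2 : ε ^ 2 * ∫ p, frozenAdjoint m (m.locK ε k x) p ^ 2 = ∫ p, frozenAdjoint m m.K p ^ 2 := by
    rw [← HeatModel.integral_sq_comp_locMap (m := m) (k := k) (x := x) hε hF.1 hF.2.1,
      ← integral_const_mul]
    congr 1 with p
    simp only [frozenAdjoint, HeatModel.timeDeriv_locK, HeatModel.spaceLap_locK hε]
    field_simp
  rw [h1, h2]
  rfl

variable {ε : ℝ} {G : Finset (E d)} (w : E d → ℝ)

lemma mem_Icc_bounds {k N : ℕ} (hk : k ∈ Finset.Icc 1 N) : 0 < N ∧ k ≤ N ∧ k - 1 ≤ N := by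
  rw [Finset.mem_Icc] at hk
  omega

lemma integral_martingalePart_sq [IsProbabilityMeasure P] (hS : IsHeatSemigroup m.D m.θ S)
    (hX : IsSignal m S P X) (hV : IsIsonormal P V)
    (hXV : IndepFun (fun ω φ => X φ ω) (fun ω f => V f ω) P) (hε : 0 < ε) (hG : m.IsGrid ε G) :
    ∫ ω, martingalePart m X V ε G w ω ^ 2 ∂P = ∫ ω, m.quadVar X V ε G w ω ∂P := by
  have hZ : IsGaussianProcess (jointProcess X V ε) P :=
    isGaussianProcess_add_mul hX.gaussian hV.gaussian hXV ε
  set I := Finset.Icc 1 (m.N ε) ×ˢ G with hI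
  have hT : ∀ i ∈ I, IsSmoothSpaceTimeTest m.T m.D (m.locK ε i.1 i.2) := fun i hi => by
    obtain ⟨h1, h2⟩ := Finset.mem_product.1 hi
    exact HeatModel.isSmoothSpaceTimeTest_locK hε hG h2 (mem_Icc_bounds h1).1 (mem_Icc_bounds h1).2.1
  have hT' : ∀ i ∈ I, IsSmoothSpaceTimeTest m.T m.D (m.locK ε (i.1 - 1) i.2) := fun i hi => by
    obtain ⟨h1, h2⟩ := Finset.mem_product.1 hi
    exact HeatModel.isSmoothSpaceTimeTest_locK hε hG h2 (mem_Icc_bounds h1).1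
      (mem_Icc_bounds h1).2.2
  have hlap : ∀ i ∈ I, ∀ ω, m.Xlap X V ε (i.1 - 1) i.2 ω =
      jointProcess X V ε (lapIndex m (m.locK ε (i.1 - 1) i.2)) ω := fun i hi ω =>
    pairY_spaceLap ε (hT' i hi) ω
  have hbefore : ∀ {k l : ℕ} {x y : E d}, l < k → ∀ s t z z',
      (t, z) ∈ tsupport (m.locK ε l x) → (s, z') ∈ tsupport (m.locK ε k y) → t < s := by
    intro k l x y hlk s t z z' ht hs
    have h1 := (HeatModel.time_mem_of_mem_tsupport hε ht).2
    have h2 := (HeatModel.time_mem_of_mem_tsupport hε hs).1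
    have h3 : (l : ℝ) + 1 ≤ k := by exact_mod_cast hlk
    nlinarith
  have hpos : ∀ i ∈ I, 1 ≤ i.1 := fun i hi =>
    (Finset.mem_Icc.1 (Finset.mem_product.1 hi).1).1
  have key := integral_sq_sum_of_cov_eq_zero hZ I
    (fun i => lapIndex m (m.locK ε (i.1 - 1) i.2)) (fun i => noiseIndex m (m.locK ε i.1 i.2))
    (fun i => w i.2) m.sigmaKSq (fun i hi => integral_noiseIndex hS hX hV ε (hT i hi))
    (fun i hi => by
      rw [cov_noiseIndex_self hS hX hV hXV ε (hT i hi), sigmaKSq_eq hε])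
    (fun i hi => cov_noiseIndex_lapIndex hS hX hV hXV ε (hT i hi) (hT' i hi)
      (hbefore (by have := hpos i hi; omega)))
    (fun i hi j hj hij => by
      rcases lt_trichotomy i.1 j.1 with h | h | h
      · rw [covariance_comm]
        exact cov_noiseIndex_of_before hS hX hV hXV ε (hT j hj) (hT i hi) (hbefore h)
      · refine cov_noiseIndex_of_disjoint hS hX hV hXV ε (hT i hi) (hT j hj) fun p => ?_
        rw [h]
        exact HeatModel.notMem_tsupport_locK hε hG (Finset.mem_product.1 hi).2
          (Finset.mem_product.1 hj).2 (fun h' => hij (Prod.ext h h')) p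
      · exact cov_noiseIndex_of_before hS hX hV hXV ε (hT i hi) (hT j hj) (hbefore h))
    -- The term with the larger `k` supplies the later noise. The lag `k - 1` in the other factor
    -- also covers equal time indices.
    (fun i hi j hj hij => by
      have hi1 := hpos i hi
      have hj1 := hpos j hj
      rcases le_total i.1 j.1 with h | h
      · exact Or.inr (cov_noiseIndex_lapIndex hS hX hV hXV ε (hT j hj) (hT' i hi)
          (hbefore (by omega)))
      · exact Or.inl (cov_noiseIndex_lapIndex hS hX hV hXV ε (hT i hi) (hT' j hj)
          (hbefore (by omega))))
  have e1 : ∀ ω, martingalePart m X V ε G w ω = ∑ i ∈ I, w i.2 *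
      jointProcess X V ε (lapIndex m (m.locK ε (i.1 - 1) i.2)) ω *
      jointProcess X V ε (noiseIndex m (m.locK ε i.1 i.2)) ω := by
    intro ω
    rw [martingalePart, ← Finset.sum_product']
    exact Finset.sum_congr rfl fun i hi => by rw [hlap i hi]
  have e2 : ∀ ω, m.quadVar X V ε G w ω = m.sigmaKSq * ∑ i ∈ I, w i.2 ^ 2 *
      jointProcess X V ε (lapIndex m (m.locK ε (i.1 - 1) i.2)) ω ^ 2 := by
    intro ω
    rw [HeatModel.quadVar, ← Finset.sum_product']
    congr 1
    exact Finset.sum_congr rfl fun i hi => by rw [hlap i hi]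
  simp_rw [e1, e2]
  rw [key, integral_const_mul, integral_finsetSum]
  · simp_rw [integral_const_mul]
  · intro i _
    exact ((hZ.hasGaussianLaw_eval _).memLp_two.integrable_sq).const_mul _

lemma ae_sum_eq [IsProbabilityMeasure P] (hS : IsHeatSemigroup m.D m.θ S)
    (hX : IsSignal m S P X) (hV : IsIsonormal P V) (hε : 0 < ε) (hG : m.IsGrid ε G) :
    ∀ᵐ ω ∂P, (∑ k ∈ Finset.Icc 1 (m.N ε), ∑ x ∈ G,
        w x * m.Xlap X V ε (k - 1) x ω * m.Xdot X V ε k x ω) =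
      m.θ m.x₀ * m.fisher X V ε G w ω + (m.bias X V ε G w ω - martingalePart m X V ε G w ω) := by
  have h : ∀ᵐ ω ∂P, ∀ k ∈ Finset.Icc 1 (m.N ε), ∀ x ∈ G,
      m.Xdot X V ε k x ω - m.θ m.x₀ * m.Xlap X V ε k x ω =
      - jointProcess X V ε (noiseIndex m (m.locK ε k x)) ω +
        m.pairX X (fun p => spaceDivGrad m.θ (m.locK ε k x) p -
          m.θ m.x₀ * spaceLap (m.locK ε k x) p) ω := by
    rw [Finset.eventually_all]
    intro k hk
    rw [Finset.eventually_all]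
    intro x hx
    exact ae_pairY_eq hS hX hV ε (HeatModel.isSmoothSpaceTimeTest_locK hε hG hx
      (mem_Icc_bounds hk).1 (mem_Icc_bounds hk).2.1)
  filter_upwards [h] with ω hω
  simp only [HeatModel.fisher, HeatModel.bias, martingalePart, Finset.mul_sum,
    ← Finset.sum_sub_distrib, ← Finset.sum_add_distrib]
  refine Finset.sum_congr rfl fun k hk => Finset.sum_congr rfl fun x hx => ?_
  linear_combination (w x * m.Xlap X V ε (k - 1) x ω) * hω k hk x hx

lemma memLp_sum_mul_mul [IsProbabilityMeasure P] {N : ℕ} {A B : ℕ → E d → Ω → ℝ}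
    (hA : ∀ k ∈ Finset.Icc 1 N, ∀ x ∈ G, HasGaussianLaw (A k x) P)
    (hB : ∀ k ∈ Finset.Icc 1 N, ∀ x ∈ G, HasGaussianLaw (B k x) P) :
    MemLp (fun ω => ∑ k ∈ Finset.Icc 1 N, ∑ x ∈ G, w x * A k x ω * B k x ω) 2 P := by
  refine memLp_finsetSum _ fun k hk => memLp_finsetSum _ fun x hx => ?_
  simp_rw [mul_assoc]
  exact (memLp_mul_of_hasGaussianLaw (hA k hk x hx) (hB k hk x hx)).const_mul (w x)

lemma hasGaussianLaw_Xlap (hX : IsSignal m S P X) (hV : IsIsonormal P V)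
    (hXV : IndepFun (fun ω φ => X φ ω) (fun ω f => V f ω) P) (hε : 0 < ε) (hG : m.IsGrid ε G)
    {k : ℕ} {x : E d} (hN : 0 < m.N ε) (hk : k ≤ m.N ε) (hx : x ∈ G) :
    HasGaussianLaw (m.Xlap X V ε k x) P := by
  have h := (isGaussianProcess_add_mul hX.gaussian hV.gaussian hXV ε).hasGaussianLaw_eval
    (lapIndex m (m.locK ε k x))
  have e : m.Xlap X V ε k x = jointProcess X V ε (lapIndex m (m.locK ε k x)) :=
    funext fun ω => pairY_spaceLap ε (HeatModel.isSmoothSpaceTimeTest_locK hε hG hx hN hk) ω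
  rw [e]
  exact h

lemma memLp_fisher [IsProbabilityMeasure P] (hX : IsSignal m S P X) (hV : IsIsonormal P V)
    (hXV : IndepFun (fun ω φ => X φ ω) (fun ω f => V f ω) P) (hε : 0 < ε) (hG : m.IsGrid ε G) :
    MemLp (m.fisher X V ε G w) 2 P :=
  memLp_sum_mul_mul w
    (fun _ hk _ hx => hasGaussianLaw_Xlap hX hV hXV hε hG (mem_Icc_bounds hk).1
      (mem_Icc_bounds hk).2.2 hx)
    (fun _ hk _ hx => hasGaussianLaw_Xlap hX hV hXV hε hG (mem_Icc_bounds hk).1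
      (mem_Icc_bounds hk).2.1 hx)

lemma memLp_martingalePart [IsProbabilityMeasure P] (hX : IsSignal m S P X)
    (hV : IsIsonormal P V) (hXV : IndepFun (fun ω φ => X φ ω) (fun ω f => V f ω) P) (hε : 0 < ε)
    (hG : m.IsGrid ε G) : MemLp (martingalePart m X V ε G w) 2 P :=
  memLp_sum_mul_mul w
    (fun _ hk _ hx => hasGaussianLaw_Xlap hX hV hXV hε hG (mem_Icc_bounds hk).1
      (mem_Icc_bounds hk).2.2 hx)
    (fun _ _ _ _ => (isGaussianProcess_add_mul hX.gaussian hV.gaussian hXV ε).hasGaussianLaw_eval _)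

lemma memLp_bias [IsProbabilityMeasure P] (hX : IsSignal m S P X)
    (hV : IsIsonormal P V) (hXV : IndepFun (fun ω φ => X φ ω) (fun ω f => V f ω) P) (hε : 0 < ε)
    (hG : m.IsGrid ε G) : MemLp (m.bias X V ε G w) 2 P := by
  refine memLp_sum_mul_mul w
    (fun _ hk _ hx => hasGaussianLaw_Xlap hX hV hXV hε hG (mem_Icc_bounds hk).1
      (mem_Icc_bounds hk).2.2 hx) fun k hk x hx => ?_
  have hφ := HeatModel.isSmoothSpaceTimeTest_locK hε hG hx (mem_Icc_bounds hk).1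
    (mem_Icc_bounds hk).2.1
  rw [HeatModel.pairX_of_isTest X ((hφ.isTest_spaceDivGrad m.isOpen_D m.θ_C1.1).sub
    ((hφ.isTest_spaceLap m.isOpen_D).const_mul _))]
  exact hX.gaussian.hasGaussianLaw_eval _

end Decomposition

/-! ### Stochastic orders of magnitude -/

section BigO

variable {Ω : Type*} [MeasurableSpace Ω] {P : Measure Ω} [IsProbabilityMeasure P]

lemma IsBigOInProb.mono_rate {Z : ℝ → Ω → ℝ} {r r' : ℝ → ℝ} (hZ : IsBigOInProb P Z r)
    (hr : r =O[𝓝[>] (0 : ℝ)] r') : IsBigOInProb P Z r' := by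
  intro η hη
  obtain ⟨C, hC, h⟩ := hZ η hη
  obtain ⟨K, hK, hb⟩ := hr.exists_pos
  refine ⟨C * K, by positivity, ?_⟩
  filter_upwards [h, hb.bound] with ε h1 h2
  refine le_trans (measureReal_mono fun ω hω => ?_) h1
  refine lt_of_le_of_lt ?_ (show C * K * |r' ε| < |Z ε ω| from hω)
  rw [mul_assoc]
  exact mul_le_mul_of_nonneg_left (by simpa using h2) hC.le

lemma IsBigOInProb.add {A B : ℝ → Ω → ℝ} {r : ℝ → ℝ} (hA : IsBigOInProb P A r)
    (hB : IsBigOInProb P B r) : IsBigOInProb P (fun ε ω => A ε ω + B ε ω) r := by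
  intro η hη
  obtain ⟨C₁, hC₁, h₁⟩ := hA (η / 2) (by positivity)
  obtain ⟨C₂, hC₂, h₂⟩ := hB (η / 2) (by positivity)
  refine ⟨C₁ + C₂, by positivity, ?_⟩
  filter_upwards [h₁, h₂] with ε e₁ e₂
  have hsub : {ω | (C₁ + C₂) * |r ε| < |A ε ω + B ε ω|} ⊆
      {ω | C₁ * |r ε| < |A ε ω|} ∪ {ω | C₂ * |r ε| < |B ε ω|} := by
    intro ω hω
    by_contra hn
    rw [mem_union, not_or] at hn
    have h1 : |A ε ω| ≤ C₁ * |r ε| := not_lt.1 hn.1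
    have h2 : |B ε ω| ≤ C₂ * |r ε| := not_lt.1 hn.2
    have h3 : (C₁ + C₂) * |r ε| < |A ε ω + B ε ω| := hω
    have h4 := abs_add_le (A ε ω) (B ε ω)
    linarith [add_mul C₁ C₂ |r ε|]
  calc P.real _ ≤ P.real _ := measureReal_mono hsub
    _ ≤ _ := measureReal_union_le _ _
    _ ≤ η := by linarith

lemma measureReal_abs_ge_le {Q : Ω → ℝ} (hQ : MemLp Q 2 P) {a : ℝ} (ha : 0 < a) :
    P.real {ω | a ≤ |Q ω|} ≤ (∫ ω, Q ω ^ 2 ∂P) / a ^ 2 := by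
  rw [le_div_iff₀ (by positivity), mul_comm]
  have h := mul_meas_ge_le_integral_of_nonneg (μ := P) (f := fun ω => Q ω ^ 2)
    (Eventually.of_forall fun ω => sq_nonneg _) hQ.integrable_sq (a ^ 2)
  refine le_trans (mul_le_mul_of_nonneg_left (measureReal_mono fun ω hω => ?_) (sq_nonneg a)) h
  have hω' : a ≤ |Q ω| := hω
  rw [mem_ofPred_eq]
  simpa only [sq_abs] using pow_le_pow_left₀ ha.le hω' 2

/-- A quotient whose denominator concentrates at its mean. -/
lemma isBigOInProb_of_div {I Q Z : ℝ → Ω → ℝ} {N r : ℝ → ℝ}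
    (hI : ∀ᶠ ε in 𝓝[>] (0 : ℝ), MemLp (I ε) 2 P) (hQ : ∀ᶠ ε in 𝓝[>] (0 : ℝ), MemLp (Q ε) 2 P)
    (hN : ∀ᶠ ε in 𝓝[>] (0 : ℝ), 0 < N ε) (hr : ∀ᶠ ε in 𝓝[>] (0 : ℝ), 0 < r ε)
    (hmean : N =O[𝓝[>] (0 : ℝ)] fun ε => ∫ ω, I ε ω ∂P)
    (hvar : (fun ε => Var[I ε; P]) =o[𝓝[>] (0 : ℝ)] fun ε => N ε ^ 2)
    (hsq : (fun ε => ∫ ω, Q ε ω ^ 2 ∂P) =O[𝓝[>] (0 : ℝ)] fun ε => r ε ^ 2 * N ε ^ 2)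
    (hZ : ∀ᶠ ε in 𝓝[>] (0 : ℝ), ∀ᵐ ω ∂P, I ε ω ≠ 0 → Z ε ω = Q ε ω / I ε ω) :
    IsBigOInProb P Z r := by
  intro η hη
  obtain ⟨K₀, hK₀, hmean⟩ := hmean.exists_pos
  obtain ⟨K, hK, hsq⟩ := hsq.exists_pos
  -- Half of the lower bound for the mean: `|E I| ≥ 2cN`, so a deviation below `cN` still leaves
  -- `|I| > cN`.
  set c := (2 * K₀)⁻¹ with hc
  have hcpos : 0 < c := by positivity
  -- Chebyshev for `Q` at level `C r c N` needs `K ≤ (η/2) C² c²`; the summand 1 gives `C ≤ C²`,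
  -- which avoids a square root.
  set C := 1 + 2 * K / (η * c ^ 2) with hCdef
  have hC1 : 1 ≤ C := le_add_of_nonneg_right (by positivity)
  have hC0 : 0 < C := by linarith
  refine ⟨C, hC0, ?_⟩
  filter_upwards [hI, hQ, hN, hr, hmean.bound, hvar.bound (show 0 < η / 2 * c ^ 2 by positivity),
    hsq.bound, hZ] with ε hI hQ hN hr hmean hvar hsq hZ
  rw [Real.norm_of_nonneg hN.le, Real.norm_eq_abs] at hmean
  rw [Real.norm_of_nonneg (variance_nonneg _ _), Real.norm_of_nonneg (by positivity)] at hvar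
  rw [Real.norm_of_nonneg (integral_nonneg fun _ => sq_nonneg _),
    Real.norm_of_nonneg (by positivity)] at hsq
  have hmean' : 2 * c * N ε ≤ |∫ ω, I ε ω ∂P| := by
    rw [hc, mul_inv, ← mul_assoc, mul_inv_cancel₀ two_ne_zero, one_mul, inv_mul_le_iff₀ hK₀]
    exact hmean
  have ha : 0 < c * N ε := by positivity
  have hb : 0 < C * r ε * (c * N ε) := by positivity
  have h1 : P.real {ω | c * N ε ≤ |I ε ω - ∫ ω, I ε ω ∂P|} ≤ η / 2 := by
    have h := measureReal_abs_ge_le (hI.sub (memLp_const (∫ ω, I ε ω ∂P))) ha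
    refine le_trans h ?_
    rw [div_le_iff₀ (by positivity)]
    have e : ∫ ω, (I ε - fun _ => ∫ ω', I ε ω' ∂P : Ω → ℝ) ω ^ 2 ∂P = Var[I ε; P] := by
      rw [variance_eq_integral hI.aestronglyMeasurable.aemeasurable]
      rfl
    rw [e]
    refine hvar.trans (le_of_eq ?_)
    ring
  have h2 : P.real {ω | C * r ε * (c * N ε) ≤ |Q ε ω|} ≤ η / 2 := by
    refine (measureReal_abs_ge_le hQ hb).trans ?_
    rw [div_le_iff₀ (by positivity)]
    refine hsq.trans ?_
    have h3 : K ≤ η / 2 * (C ^ 2 * c ^ 2) := by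
      have h4 : C ≤ C ^ 2 := by nlinarith
      have h5 : 2 * K / (η * c ^ 2) ≤ C ^ 2 := by linarith
      rw [div_le_iff₀ (by positivity)] at h5
      linarith
    calc K * (r ε ^ 2 * N ε ^ 2) ≤ (η / 2 * (C ^ 2 * c ^ 2)) * (r ε ^ 2 * N ε ^ 2) := by gcongr
      _ = _ := by ring
  -- Outside the two exceptional sets the denominator is nonzero, so the value of `Z` where `I`
  -- vanishes is irrelevant.
  have hsub : {ω | C * |r ε| < |Z ε ω|} ≤ᵐ[P]
      ({ω | c * N ε ≤ |I ε ω - ∫ ω, I ε ω ∂P|} ∪ {ω | C * r ε * (c * N ε) ≤ |Q ε ω|} : Set Ω) := by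
    filter_upwards [hZ] with ω hZω hω
    by_contra hn
    have hn' : ω ∉ ({ω | c * N ε ≤ |I ε ω - ∫ ω, I ε ω ∂P|} ∪
      {ω | C * r ε * (c * N ε) ≤ |Q ε ω|} : Set Ω) := hn
    rw [mem_union, not_or] at hn'
    have n1 : |I ε ω - ∫ ω, I ε ω ∂P| < c * N ε := not_le.1 hn'.1
    have n2 : |Q ε ω| < C * r ε * (c * N ε) := not_le.1 hn'.2
    have n3 : c * N ε < |I ε ω| := by
      have := abs_sub_abs_le_abs_sub (∫ ω, I ε ω ∂P) (I ε ω)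
      rw [abs_sub_comm] at this
      linarith
    have n4 : C * |r ε| < |Z ε ω| := hω
    rw [hZω (abs_pos.1 (ha.trans n3)), abs_div, lt_div_iff₀ (ha.trans n3), abs_of_pos hr] at n4
    have n5 : C * r ε * (c * N ε) ≤ C * r ε * |I ε ω| := by gcongr
    linarith
  calc P.real _ ≤ P.real _ := ENNReal.toReal_mono (measure_ne_top _ _) (measure_mono_ae hsub)
    _ ≤ _ := measureReal_union_le _ _
    _ ≤ η := by linarith

end BigO

/-! ### Rates -/

lemma isTheta_N {d : ℕ} (m : HeatModel d) :
    (fun ε => (m.N ε : ℝ)) =Θ[𝓝[>] (0 : ℝ)] (fun ε => ε⁻¹) := by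
  have hT := m.T_pos
  -- With `T/ε > 4`, the total loss of at most 2 from the floor and from the `-1` is below half of
  -- `T/ε`.
  have hev : ∀ᶠ ε in 𝓝[>] (0 : ℝ), 0 < ε ∧ ε < m.T / 4 :=
    (eventually_mem_nhdsWithin).and
      (mem_nhdsWithin_of_mem_nhds (eventually_lt_nhds (by positivity)))
  have hbounds : ∀ᶠ ε in 𝓝[>] (0 : ℝ), 0 < ε ∧ (m.N ε : ℝ) ≤ m.T * ε⁻¹ ∧
      m.T / 2 * ε⁻¹ ≤ m.N ε := by
    filter_upwards [hev] with ε hε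
    obtain ⟨h0, h1⟩ := hε
    have h2 : (⌊m.T / ε⌋₊ : ℝ) ≤ m.T / ε := Nat.floor_le (by positivity)
    have h3 : m.T / ε < ⌊m.T / ε⌋₊ + 1 := Nat.lt_floor_add_one _
    have h4 : 4 < m.T / ε := by rw [lt_div_iff₀ h0]; linarith
    have h5 : 1 ≤ ⌊m.T / ε⌋₊ := Nat.one_le_iff_ne_zero.2 fun h => by
      rw [h] at h3; norm_num at h3; linarith
    have h6 : (m.N ε : ℝ) = ⌊m.T / ε⌋₊ - 1 := by
      rw [HeatModel.N, Nat.cast_sub h5, Nat.cast_one]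
    rw [h6, ← div_eq_mul_inv, div_mul_eq_mul_div, ← div_eq_mul_inv]
    exact ⟨h0, by linarith, by linarith⟩
  constructor
  · refine IsBigO.of_bound m.T ?_
    filter_upwards [hbounds] with ε h
    rw [Real.norm_of_nonneg (Nat.cast_nonneg _), Real.norm_of_nonneg (inv_nonneg.2 h.1.le)]
    exact h.2.1
  · refine IsBigO.of_bound (2 / m.T) ?_
    filter_upwards [hbounds] with ε h
    rw [Real.norm_of_nonneg (inv_nonneg.2 h.1.le), Real.norm_of_nonneg (Nat.cast_nonneg _),
      div_mul_eq_mul_div, le_div_iff₀ hT]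
    linarith [h.2.2]

/-- Powers preserve lower and upper bounds up to constants. -/
lemma isBigO_rpow_of_isTheta {f g : ℝ → ℝ} (hf : ∀ᶠ ε in 𝓝[>] (0 : ℝ), 0 < f ε)
    (hg : ∀ᶠ ε in 𝓝[>] (0 : ℝ), 0 < g ε) (h : f =Θ[𝓝[>] (0 : ℝ)] g) (a : ℝ) :
    (fun ε => f ε ^ a) =O[𝓝[>] (0 : ℝ)] fun ε => g ε ^ a := by
  rcases le_total 0 a with ha | ha
  · exact h.1.rpow ha (hg.mono fun _ h => h.le)
  · have h1 := h.2.rpow (neg_nonneg.2 ha) (hf.mono fun _ h => h.le)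
    have h2 := h1.inv_rev (by
      filter_upwards [hg] with ε hg h0
      exact absurd h0 (Real.rpow_pos_of_pos hg _).ne')
    refine (h2.congr' ?_ ?_)
    · filter_upwards [hf] with ε hf
      rw [Real.rpow_neg hf.le, inv_inv]
    · filter_upwards [hg] with ε hg
      rw [Real.rpow_neg hg.le, inv_inv]

lemma isBigO_stochastic_rate {d : ℕ} {N g h : ℝ → ℝ} (hh : ∀ᶠ ε in 𝓝[>] (0 : ℝ), 0 < h ε)
    (hN0 : ∀ᶠ ε in 𝓝[>] (0 : ℝ), 0 < N ε) (hg0 : ∀ᶠ ε in 𝓝[>] (0 : ℝ), 0 < g ε)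
    (hN : N =Θ[𝓝[>] (0 : ℝ)] fun ε => ε⁻¹)
    (hg : g =Θ[𝓝[>] (0 : ℝ)] fun ε => ε ^ (-((d : ℝ) / 2))) :
    (fun ε => 1 / √(N ε * g ε * h ε ^ d)) =O[𝓝[>] (0 : ℝ)]
      fun ε => ε ^ ((1 : ℝ) / 2 + (d : ℝ) / 4) * h ε ^ (-((d : ℝ) / 2)) := by
  have hpos : ∀ᶠ ε in 𝓝[>] (0 : ℝ), 0 < ε := eventually_mem_nhdsWithin
  have h1 := isBigO_rpow_of_isTheta hN0 (hpos.mono fun _ h => inv_pos.2 h) hN (-(1 / 2))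
  have h2 := isBigO_rpow_of_isTheta hg0 (hpos.mono fun _ h => Real.rpow_pos_of_pos h _) hg
    (-(1 / 2))
  refine ((h1.mul h2).mul (isBigO_refl (fun ε => h ε ^ (-((d : ℝ) / 2))) _)).congr' ?_ ?_
  · filter_upwards [hh, hN0, hg0] with ε hh hN0 hg0
    rw [Real.sqrt_eq_rpow, Real.mul_rpow (by positivity) (by positivity),
      Real.mul_rpow hN0.le hg0.le, one_div (_ * _), mul_inv, mul_inv, ← Real.rpow_neg hN0.le,
      ← Real.rpow_neg hg0.le, ← Real.rpow_neg (by positivity), ← Real.rpow_natCast,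
      ← Real.rpow_mul hh.le]
    congr 2
    ring
  · filter_upwards [hpos] with ε hε
    rw [← Real.rpow_neg_one, ← Real.rpow_mul hε.le, ← Real.rpow_mul hε.le, ← Real.rpow_add hε]
    congr 2
    ring

/-- The optimal rate `ε ^ ((2 + d) γ / (4γ + 2d))` is a lower bound for `hRate`. -/
lemma rpow_le_hRate {d : ℕ} {γ : ℝ} (hγ : 0 < γ) {h : ℝ → ℝ} {ε : ℝ} (hε : 0 < ε)
    (hh : 0 < h ε) :
    ε ^ ((2 + (d : ℝ)) * γ / (4 * γ + 2 * d)) ≤ hRate d γ h ε := by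
  set κ := (2 + (d : ℝ)) / (4 * γ + 2 * d) with hκ
  have hden : 0 < 4 * γ + 2 * d := by positivity
  have e1 : (2 + (d : ℝ)) * γ / (4 * γ + 2 * d) = κ * γ := by rw [hκ]; ring
  -- At bandwidth `ε^κ` both terms equal the claimed rate. A larger bandwidth makes the bias term at
  -- least that large, a smaller one the stochastic term.
  rcases le_total (ε ^ κ) (h ε) with hle | hle
  · have h1 : ε ^ ((2 + (d : ℝ)) * γ / (4 * γ + 2 * d)) ≤ h ε ^ γ := by
      rw [e1, Real.rpow_mul hε.le]
      exact Real.rpow_le_rpow (by positivity) hle hγ.le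
    refine h1.trans (le_add_of_nonneg_left (by positivity))
  · have h1 : (ε ^ κ) ^ (-((d : ℝ) / 2)) ≤ h ε ^ (-((d : ℝ) / 2)) :=
      Real.rpow_le_rpow_of_nonpos hh hle (by simp; positivity)
    have e2 : ε ^ ((2 + (d : ℝ)) * γ / (4 * γ + 2 * d)) =
        ε ^ ((1 : ℝ) / 2 + (d : ℝ) / 4) * (ε ^ κ) ^ (-((d : ℝ) / 2)) := by
      rw [← Real.rpow_mul hε.le, ← Real.rpow_add hε]
      congr 1
      rw [hκ]
      field_simp
      ring
    rw [e2]
    refine le_trans ?_ (le_add_of_nonneg_right (by positivity))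
    gcongr

lemma hRate_isBigO {d : ℕ} {γ : ℝ} (hγ : 0 < γ) {h : ℝ → ℝ}
    (hh : ∀ᶠ ε in 𝓝[>] (0 : ℝ), 0 < h ε)
    (hΘ : h =Θ[𝓝[>] (0 : ℝ)] fun ε => ε ^ ((2 + (d : ℝ)) / (4 * γ + 2 * d))) :
    hRate d γ h =O[𝓝[>] (0 : ℝ)] fun ε => ε ^ ((2 + (d : ℝ)) * γ / (4 * γ + 2 * d)) := by
  have hpos : ∀ᶠ ε in 𝓝[>] (0 : ℝ), 0 < ε := eventually_mem_nhdsWithin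
  have hpow : ∀ᶠ ε in 𝓝[>] (0 : ℝ), 0 < ε ^ ((2 + (d : ℝ)) / (4 * γ + 2 * d)) :=
    hpos.mono fun _ h => Real.rpow_pos_of_pos h _
  have hden : 4 * γ + 2 * d ≠ 0 := by positivity
  refine IsBigO.add ?_ ?_
  · refine ((isBigO_refl (fun ε : ℝ => ε ^ ((1 : ℝ) / 2 + (d : ℝ) / 4)) _).mul
      (isBigO_rpow_of_isTheta hh hpow hΘ (-((d : ℝ) / 2)))).congr' EventuallyEq.rfl ?_
    filter_upwards [hpos] with ε hε
    rw [← Real.rpow_mul hε.le, ← Real.rpow_add hε]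
    congr 1
    field_simp
    ring
  · refine (isBigO_rpow_of_isTheta hh hpow hΘ γ).congr' EventuallyEq.rfl ?_
    filter_upwards [hpos] with ε hε
    rw [← Real.rpow_mul hε.le]
    congr 1
    ring

end NoisyHeat

end

/-! ### Assembly of the error decomposition, the moment bounds and the rates -/

theorem theorem4p5 {d : ℕ} (hd : 1 ≤ d) (m : HeatModel d)
    (S : ℝ → L2 m.D →L[ℝ] L2 m.D) (hS : IsHeatSemigroup m.D m.θ S)
    {Ω : Type*} [MeasurableSpace Ω] (P : Measure Ω) [IsProbabilityMeasure P]
    (X : Test m.T m.D → Ω → ℝ) (hX : IsSignal m S P X)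
    (V : L2ST m.T m.D → Ω → ℝ) (hV : IsIsonormal P V)
    (hXV : IndepFun (fun ω φ => X φ ω) (fun ω f => V f ω) P)
    (G : ℝ → Finset (E d)) (hG : ∀ᶠ ε in 𝓝[>] (0 : ℝ), m.IsGrid ε (G ε))
    (w : ℝ → ℝ → E d → ℝ) (h : ℝ → ℝ) (hh : ∀ᶠ ε in 𝓝[>] (0 : ℝ), 0 < h ε)
    (γ : ℝ) (hγ : 1 ≤ γ) (hA : MomentConditions m P X V G w h γ) :
    -- the general rate
    IsBigOInProb P (fun ε ω => m.estimator X V ε (G ε) (w ε (h ε)) ω - m.θ m.x₀)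
      (fun ε => 1 / √((m.N ε : ℝ) * ((G ε).card : ℝ) * h ε ^ d) + h ε ^ γ) ∧
    -- the number of time points
    (fun ε => (m.N ε : ℝ)) =Θ[𝓝[>] (0 : ℝ)] (fun ε => ε⁻¹) ∧
    -- the rate for grids of full size, as a sum of two terms
    ((fun ε => ((G ε).card : ℝ)) =Θ[𝓝[>] (0 : ℝ)] (fun ε => ε ^ (-((d : ℝ) / 2))) →
      ∃ A B : ℝ → Ω → ℝ,
        (∀ ε ω, m.estimator X V ε (G ε) (w ε (h ε)) ω - m.θ m.x₀ = A ε ω + B ε ω) ∧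
        IsBigOInProb P A (fun ε => ε ^ ((1 : ℝ) / 2 + (d : ℝ) / 4) * h ε ^ (-((d : ℝ) / 2))) ∧
        IsBigOInProb P B (fun ε => h ε ^ γ)) ∧
    -- optimality of the bandwidth of order `ε ^ ((2 + d) / (4γ + 2d))`, and the resulting rate
    (h =Θ[𝓝[>] (0 : ℝ)] (fun ε => ε ^ ((2 + (d : ℝ)) / (4 * γ + 2 * d))) →
      (∀ h' : ℝ → ℝ, (∀ᶠ ε in 𝓝[>] (0 : ℝ), 0 < h' ε) →
        hRate d γ h =O[𝓝[>] (0 : ℝ)] hRate d γ h') ∧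
      ((fun ε => ((G ε).card : ℝ)) =Θ[𝓝[>] (0 : ℝ)] (fun ε => ε ^ (-((d : ℝ) / 2))) →
        IsBigOInProb P (fun ε ω => m.estimator X V ε (G ε) (w ε (h ε)) ω - m.θ m.x₀)
          (fun ε => ε ^ ((2 + (d : ℝ)) * γ / (4 * γ + 2 * d))))) := by
  have hγ0 : 0 < γ := by linarith
  have hε : ∀ᶠ ε in 𝓝[>] (0 : ℝ), 0 < ε := eventually_mem_nhdsWithin
  have hNΘ := isTheta_N m
  have hN : ∀ᶠ ε in 𝓝[>] (0 : ℝ), 0 < (m.N ε : ℝ) := by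
    obtain ⟨C, -, hC⟩ := hNΘ.2.exists_pos
    filter_upwards [hC.bound, hε] with ε h1 h2
    rw [Real.norm_of_nonneg (inv_nonneg.2 h2.le), Real.norm_of_nonneg (Nat.cast_nonneg _)] at h1
    refine lt_of_le_of_ne (Nat.cast_nonneg _) fun h0 => ?_
    rw [← h0, mul_zero] at h1
    exact absurd h1 (not_le.2 (inv_pos.2 h2))
  -- An empty grid would make the Fisher information zero, contradicting that its mean is of order
  -- `N`.
  have hcard : ∀ᶠ ε in 𝓝[>] (0 : ℝ), 0 < ((G ε).card : ℝ) := by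
    obtain ⟨C, -, hC⟩ := hA.fisher_mean.2.exists_pos
    filter_upwards [hC.bound, hN] with ε h1 h2
    rw [Nat.cast_pos, Finset.card_pos, Finset.nonempty_iff_ne_empty]
    intro h0
    rw [Real.norm_of_nonneg h2.le, h0] at h1
    simp only [HeatModel.fisher, Finset.sum_empty, Finset.sum_const_zero, integral_zero, norm_zero,
      mul_zero] at h1
    linarith
  have hI : ∀ᶠ ε in 𝓝[>] (0 : ℝ), MemLp (m.fisher X V ε (G ε) (w ε (h ε))) 2 P := by
    filter_upwards [hε, hG] with ε h1 h2 using memLp_fisher _ hX hV hXV h1 h2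
  set r : ℝ → ℝ := fun ε => 1 / √((m.N ε : ℝ) * ((G ε).card : ℝ) * h ε ^ d) with hr
  have hr0 : ∀ᶠ ε in 𝓝[>] (0 : ℝ), 0 < r ε := by
    filter_upwards [hN, hcard, hh] with ε h1 h2 h3
    rw [hr]
    positivity
  have hrsq : (fun ε => (m.N ε : ℝ) * ((G ε).card : ℝ)⁻¹ * (h ε ^ d)⁻¹) =ᶠ[𝓝[>] (0 : ℝ)]
      fun ε => r ε ^ 2 * (m.N ε : ℝ) ^ 2 := by
    filter_upwards [hN, hcard, hh] with ε h1 h2 h3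
    rw [hr, div_pow, Real.sq_sqrt (by positivity)]
    field_simp
  have hhγ : ∀ᶠ ε in 𝓝[>] (0 : ℝ), 0 < h ε ^ γ := hh.mono fun ε h3 => Real.rpow_pos_of_pos h3 _
  set B : ℝ → Ω → ℝ := fun ε ω =>
    m.bias X V ε (G ε) (w ε (h ε)) ω / m.fisher X V ε (G ε) (w ε (h ε)) ω with hBdef
  -- Defining `A` as the remainder makes the splitting hold everywhere; that it equals `-M/I` is
  -- needed only almost surely and where the Fisher information is nonzero.
  set A : ℝ → Ω → ℝ := fun ε ω =>
    m.estimator X V ε (G ε) (w ε (h ε)) ω - m.θ m.x₀ - B ε ω with hAdef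
  have hAB : ∀ ε ω, m.estimator X V ε (G ε) (w ε (h ε)) ω - m.θ m.x₀ = A ε ω + B ε ω :=
    fun ε ω => (sub_add_cancel _ _).symm
  have hB : IsBigOInProb P B (fun ε => h ε ^ γ) := by
    refine isBigOInProb_of_div hI ?_ hN hhγ hA.fisher_mean.2 hA.fisher_var ?_
      (Eventually.of_forall fun ε => Eventually.of_forall fun ω _ => rfl)
    · filter_upwards [hε, hG] with ε h1 h2 using memLp_bias _ hX hV hXV h1 h2
    · refine hA.bias_sq_mean.congr' EventuallyEq.rfl ?_
      filter_upwards [hh] with ε h3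
      rw [mul_comm 2 γ, Real.rpow_mul h3.le, Real.rpow_two]
  have hAr : IsBigOInProb P A r := by
    refine isBigOInProb_of_div
      (Q := fun ε ω => - martingalePart m X V ε (G ε) (w ε (h ε)) ω)
      hI ?_ hN hr0 hA.fisher_mean.2 hA.fisher_var ?_ ?_
    · filter_upwards [hε, hG] with ε h1 h2 using (memLp_martingalePart _ hX hV hXV h1 h2).neg
    · refine hA.quadVar_mean.congr' ?_ ?_
      · filter_upwards [hε, hG] with ε h1 h2
        simp_rw [neg_sq]
        exact (integral_martingalePart_sq _ hS hX hV hXV h1 h2).symm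
      · exact hrsq
    · filter_upwards [hε, hG] with ε h1 h2
      filter_upwards [ae_sum_eq (w ε (h ε)) hS hX hV h1 h2] with ω h3 h4
      simp only [hAdef, hBdef, HeatModel.estimator]
      rw [h3]
      field_simp
      ring
  refine ⟨?_, hNΘ, ?_, fun hΘ => ⟨fun h' hh' => ?_, fun hGΘ => ?_⟩⟩
  · simp_rw [hAB]
    refine (hAr.mono_rate (IsBigO.of_bound' ?_)).add (hB.mono_rate (IsBigO.of_bound' ?_))
    · filter_upwards [hr0, hhγ] with ε h1 h2
      rw [Real.norm_of_nonneg h1.le, Real.norm_of_nonneg (add_pos h1 h2).le]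
      exact le_add_of_nonneg_right h2.le
    · filter_upwards [hr0, hhγ] with ε h1 h2
      rw [Real.norm_of_nonneg h2.le, Real.norm_of_nonneg (add_pos h1 h2).le]
      exact le_add_of_nonneg_left h1.le
  · exact fun hGΘ =>
      ⟨A, B, hAB, hAr.mono_rate (isBigO_stochastic_rate hh hN hcard hNΘ hGΘ), hB⟩
  -- The bandwidth `h` attains up to a constant the rate that no `h'` can beat.
  · refine (hRate_isBigO hγ0 hh hΘ).trans (IsBigO.of_bound' ?_)
    filter_upwards [hε, hh'] with ε h1 h2
    have h3 := rpow_le_hRate (d := d) hγ0 h1 h2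
    have h4 : 0 ≤ ε ^ ((2 + (d : ℝ)) * γ / (4 * γ + 2 * d)) := Real.rpow_nonneg h1.le _
    rwa [Real.norm_of_nonneg h4, Real.norm_of_nonneg (h4.trans h3)]
  · simp_rw [hAB]
    have hrate := hRate_isBigO hγ0 hh hΘ
    refine ((hAr.mono_rate (isBigO_stochastic_rate hh hN hcard hNΘ hGΘ)).mono_rate
      (IsBigO.trans (IsBigO.of_bound' ?_) hrate)).add
      (hB.mono_rate (IsBigO.trans (IsBigO.of_bound' ?_) hrate))
    · filter_upwards [hε, hh] with ε h1 h2
      rw [Real.norm_of_nonneg (by positivity), hRate, Real.norm_of_nonneg (by positivity)]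
      exact le_add_of_nonneg_right (by positivity)
    · filter_upwards [hε, hh] with ε h1 h2
      rw [Real.norm_of_nonneg (by positivity), hRate, Real.norm_of_nonneg (by positivity)]
      exact le_add_of_nonneg_left (by positivity)
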